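/- Let $n\in\mathbb N$. For a real finite-dimensional space $X$ let $\mathcal G(X)=\mathcal E_M(X)/\mathcal N(X)$ be the (special) Colombeau algebra: nets $(u_\varepsilon)_{\varepsilon\in(0,1]}$ in $C^\infty(X;\mathbb C)$ such that every seminorm $\sup_K|\partial^\alpha u_\varepsilon|$ ($K$ compact) is $O(\varepsilon^{-N})$ for some $N$, modulo nets for which every such seminorm is $O(\varepsilon^{q})$ for all $q$. All operations are defined on representatives. Call $u\in\mathcal G(X)$ real valued if it has a real valued representative; compactly supported with respect to $x$ (for $X=\mathbb R_t\times\mathbb R^n_x$) if $\operatorname{supp}u\subseteq\mathbb R\times K$ for some compact $K$. A net $(\mu_\varepsilon)$ is slow scale if $|\mu_\varepsilon|^q=O(\varepsilon^{-1})$ for all $q\ge0$. The element $u$ is of logarithmic type if it has a representative with $\sup_K|u_\varepsilon|=O(\log(1/\varepsilon))$ for all compact $K$; of slow scale logarithmic type if it has a representative such that for each compact $K$ there is a slow scale net $\mu_\varepsilon\ge1$ with $\sup_K|u_\varepsilon|=O(\log\mu_\varepsilon)$; and slow scale regular if it has a representative such that for all compact $K$ and all $\alpha$ there is a slow scale net with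 $\sup_K|\partial^\alpha u_\varepsilon|=O(\mu_\varepsilon)$. Let $a_{1,1},\dots,a_{1,n},a_0\in\mathcal G(\mathbb R^{n+1})$, let $u_0\in\mathcal G(\mathbb R^n)$ have compact support, write $D=-i\partial$, $D_j=D_{x_j}$, and consider $$D_tu=\sum_{j=1}^n a_{1,j}(t,x)D_ju+a_0(t,x)u,\qquad u(0,\cdot)=u_0. \tag{1}$$ Hypotheses: * (h1) the $a_{1,j}$ are real valued, compactly supported with respect to $x$, and all $\partial_{x_k}a_{1,j}$ are of logarithmic type; * (i1) $a_0$ is compactly supported with respect to $x$ and of logarithmic type; * (h2) the $a_{1,j}$ are real valued, slow scale regular, compactly supported with respect to $x$, and all $\partial_{x_k}a_{1,j}$ are of slow scale logarithmic type; * (i2) $a_0$ is slow scale regular, compactly supported with respect to $x$ and of slow scale logarithmic type. **(i)** Assume (h1) and (i1). Then: * the characteristic system $\partial_s\gamma_h(x,t,s)=-a_{1,h}(s,\gamma(x,t,s))$, $\gamma_h(x,t,t)=x_h$ ($h=1,\dots,n$) has a unique solution $\gamma=(\gamma_1,\dots,\gamma_n)$, $\gamma_h\in\mathcal G(\mathbb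 R^{n+2})$, among those represented by real valued nets that map, for small $\varepsilon$, each compact set into a fixed compact set; * $\phi(t,x,\eta)=\sum_{h=1}^n\gamma_h(x,t,0)\eta_h\in\mathcal G(\mathbb R^{n+1}\times\mathbb R^n)$ solves $\partial_t\phi=\sum_j a_{1,j}\partial_{x_j}\phi$, $\phi(0,x,\eta)=x\cdot\eta$, and $\phi(t,x,\eta)-y\cdot\eta$ is a generalised phase function with respect to $(y,\eta)$: it is represented by real nets $\psi_\varepsilon(t,x,y,\eta)$ which are continuous, smooth for $\eta\neq0$, positively homogeneous of degree $1$ in $\eta$, with $\nabla_{y,\eta}\psi_\varepsilon\ne0$ for $\eta\neq0$, such that for all compact sets of $(t,x,y)$ and all $\alpha,\beta$ the supremum of $|\eta|^{|\alpha|-1}|\partial_\eta^\alpha\partial_{t,x,y}^\beta\psi_\varepsilon|$ over the compact set and all $\eta\ne0$ is $O(\varepsilon^{-N})$ for some $N$, and $|\nabla_{y,\eta}\psi_\varepsilon|^2\ge\varepsilon^r$ on the compact set and $|\eta|=1$ for some $r>0$ and all small $\varepsilon$; * the problem $D_tb=\sum_j a_{1,j}D_jb+a_0b$, $b(0,\cdot)=1$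 has a unique solution $b\in\mathcal G(\mathbb R^{n+1})$, and $b=e^{i\beta}$ with $\beta(t,x)=\int_0^ta_0(s,\gamma(x,t,s))\,ds\in\mathcal G(\mathbb R^{n+1})$; * problem (1) has a unique solution $u\in\mathcal G(\mathbb R^{n+1})$, and it is given by the generalised Fourier integral operator $$u(t,x)=F_\phi(b)(u_0)(t,x)=(2\pi)^{-n}\int_{\mathbb R^n}e^{i\phi(t,x,\eta)}\,b(t,x)\,\widehat{u_0}(\eta)\,d\eta,\qquad \widehat{u_0}(\eta)=\int_{\mathbb R^n} e^{-iy\cdot\eta}u_0(y)\,dy,$$ evaluated on representatives, where $\phi$ is represented by phase functions as above and $u_0$ by functions supported in a common compact set. **(ii)** Assume (h2) and (i2). Then all of (i) holds and, in addition, $\phi$ and $b$ are slow scale regular, and $\phi(t,x,\eta)-y\cdot\eta$ is a slow scale generalised phase function (it has a representative as in (i) for which the symbol seminorms above are $O(\mu_\varepsilon)$ with slow scale nets $\mu_\varepsilon$, and for which $|\nabla_{y,\eta}\psi_\varepsilon|^2\ge 1/s_\varepsilon$ for small $\varepsilon$, with a slow scale net $s_\varepsilon>0$). -/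

import Mathlib

open Filter Topology MeasureTheory
open scoped ContDiff

namespace Colombeau

/-! ### Nets and asymptotics -/

/-- The parameter set `(0,1]`. -/
abbrev Eps : Type := Set.Ioc (0 : ℝ) 1

/-- The filter `ε → 0` on `(0,1]`. -/
def toZero : Filter Eps := comap (fun ε : Eps => (ε : ℝ)) (𝓝 0)

/-- Slow scale nets: `|r_ε|^q = O(ε⁻¹)` for every `q ≥ 0`.  Only moduli enter, so real nets suffice. -/
def SlowScale (r : Eps → ℝ) : Prop :=
  ∀ q : ℝ, 0 ≤ q → (fun ε => |r ε| ^ q) =O[toZero] (fun ε : Eps => ((ε : ℝ))⁻¹)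

/-! ### The Colombeau algebra `G(X) = EM(X) / N(X)` on a normed space `X` (such as `ℝᵈ`)

The seminorms `sup_{x ∈ K} ‖D^k f(x)‖` (`K` compact, `k ∈ ℕ`, `D^k` the `k`-th total derivative)
define the usual topology of `C^∞`; they are equivalent to the suprema over `K` of the partial
derivatives `∂^α f` with `|α| = k`. -/

section Algebra

variable (X : Type*) [NormedAddCommGroup X] [NormedSpace ℝ X]

variable {X} in
/-- Bounds defining moderateness: for all `K` and `k` there is `N` with
`sup_K ‖D^k u_ε‖ = O(ε^{-N})`. -/
def ModerateBound (u : Eps → X → ℂ) : Prop :=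
  ∀ K : Set X, IsCompact K → ∀ k : ℕ, ∃ N : ℕ, ∃ C : ℝ, ∀ᶠ ε in toZero, ∀ x ∈ K,
    ‖iteratedFDeriv ℝ k (u ε) x‖ ≤ C * ((ε : ℝ)⁻¹) ^ N

variable {X} in
/-- Bounds defining negligibility on an open set `V`: for all compact `K ⊆ V`, all `k` and `q`,
`sup_K ‖D^k u_ε‖ = O(ε^q)`. -/
def NegligibleBoundOn (V : Set X) (u : Eps → X → ℂ) : Prop :=
  ∀ K : Set X, IsCompact K → K ⊆ V → ∀ k q : ℕ, ∃ C : ℝ, ∀ᶠ ε in toZero, ∀ x ∈ K,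
    ‖iteratedFDeriv ℝ k (u ε) x‖ ≤ C * (ε : ℝ) ^ q

theorem one_le_inv_eps (ε : Eps) : (1 : ℝ) ≤ (ε : ℝ)⁻¹ :=
  (one_le_inv₀ ε.2.1).2 ε.2.2

variable {X}

theorem iteratedFDeriv_add_le {u v : X → ℂ} (hu : ContDiff ℝ ∞ u) (hv : ContDiff ℝ ∞ v)
    (k : ℕ) (x : X) :
    ‖iteratedFDeriv ℝ k (u + v) x‖ ≤ ‖iteratedFDeriv ℝ k u x‖ + ‖iteratedFDeriv ℝ k v x‖ := by
  rw [iteratedFDeriv_add (hu.of_le (by exact_mod_cast le_top)) (hv.of_le (by exact_mod_cast le_top))]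
  exact norm_add_le _ _

theorem ModerateBound.add {u v : Eps → X → ℂ} (hu : ∀ ε, ContDiff ℝ ∞ (u ε))
    (hv : ∀ ε, ContDiff ℝ ∞ (v ε)) (mu : ModerateBound u) (mv : ModerateBound v) :
    ModerateBound (u + v) := by
  intro K hK k
  obtain ⟨N, C, h⟩ := mu K hK k
  obtain ⟨M, D, h'⟩ := mv K hK k
  refine ⟨N + M, |C| + |D|, ?_⟩
  filter_upwards [h, h'] with ε h h' x hx
  have e1 := one_le_inv_eps ε
  have p1 : ((ε : ℝ)⁻¹) ^ N ≤ ((ε : ℝ)⁻¹) ^ (N + M) := pow_le_pow_right₀ e1 (by omega)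
  have p2 : ((ε : ℝ)⁻¹) ^ M ≤ ((ε : ℝ)⁻¹) ^ (N + M) := pow_le_pow_right₀ e1 (by omega)
  have q1 : C * ((ε : ℝ)⁻¹) ^ N ≤ |C| * ((ε : ℝ)⁻¹) ^ (N + M) := by
    gcongr
    exact le_abs_self C
  have q2 : D * ((ε : ℝ)⁻¹) ^ M ≤ |D| * ((ε : ℝ)⁻¹) ^ (N + M) := by
    gcongr
    exact le_abs_self D
  have := iteratedFDeriv_add_le (hu ε) (hv ε) k x
  have h1 := h x hx
  have h2 := h' x hx
  change ‖iteratedFDeriv ℝ k (u ε + v ε) x‖ ≤ _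
  linarith

theorem NegligibleBoundOn.add {V : Set X} {u v : Eps → X → ℂ} (hu : ∀ ε, ContDiff ℝ ∞ (u ε))
    (hv : ∀ ε, ContDiff ℝ ∞ (v ε)) (mu : NegligibleBoundOn V u) (mv : NegligibleBoundOn V v) :
    NegligibleBoundOn V (u + v) := by
  intro K hK hKV k q
  obtain ⟨C, h⟩ := mu K hK hKV k q
  obtain ⟨D, h'⟩ := mv K hK hKV k q
  refine ⟨C + D, ?_⟩
  filter_upwards [h, h'] with ε h h' x hx
  have := iteratedFDeriv_add_le (hu ε) (hv ε) k x
  have h1 := h x hx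
  have h2 := h' x hx
  change ‖iteratedFDeriv ℝ k (u ε + v ε) x‖ ≤ _
  linarith

/-- Uniform version of a bound that is available for each of finitely many orders. -/
theorem ModerateBound.uniform {u : Eps → X → ℂ} (mu : ModerateBound u) {K : Set X}
    (hK : IsCompact K) (k : ℕ) : ∃ N : ℕ, ∃ C : ℝ, 0 ≤ C ∧ ∀ᶠ ε in toZero, ∀ x ∈ K, ∀ i ≤ k,
      ‖iteratedFDeriv ℝ i (u ε) x‖ ≤ C * ((ε : ℝ)⁻¹) ^ N := by
  induction k with
  | zero =>
    obtain ⟨N, C, h⟩ := mu K hK 0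
    refine ⟨N, |C|, abs_nonneg C, ?_⟩
    filter_upwards [h] with ε h x hx i hi
    obtain rfl : i = 0 := by omega
    refine (h x hx).trans ?_
    have e0 : (0 : ℝ) ≤ ((ε : ℝ)⁻¹) ^ N := pow_nonneg (zero_le_one.trans (one_le_inv_eps ε)) _
    exact mul_le_mul_of_nonneg_right (le_abs_self C) e0
  | succ k ih =>
    obtain ⟨N, C, hC, h⟩ := ih
    obtain ⟨M, D, h'⟩ := mu K hK (k + 1)
    refine ⟨N + M, C + |D|, by positivity, ?_⟩
    filter_upwards [h, h'] with ε h h' x hx i hi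
    have e1 := one_le_inv_eps ε
    have e0 : (0 : ℝ) ≤ (ε : ℝ)⁻¹ := zero_le_one.trans e1
    have p1 : ((ε : ℝ)⁻¹) ^ N ≤ ((ε : ℝ)⁻¹) ^ (N + M) := pow_le_pow_right₀ e1 (by omega)
    have p2 : ((ε : ℝ)⁻¹) ^ M ≤ ((ε : ℝ)⁻¹) ^ (N + M) := pow_le_pow_right₀ e1 (by omega)
    rcases Nat.lt_or_ge i (k + 1) with hi' | hi'
    · refine (h x hx i (by omega)).trans ?_
      gcongr
      exact le_add_of_nonneg_right (abs_nonneg D)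
    · obtain rfl : i = k + 1 := by omega
      refine (h' x hx).trans ?_
      gcongr
      exact (le_abs_self D).trans (le_add_of_nonneg_left hC)

theorem NegligibleBoundOn.uniform {V : Set X} {u : Eps → X → ℂ} (mu : NegligibleBoundOn V u)
    {K : Set X} (hK : IsCompact K) (hKV : K ⊆ V) (k q : ℕ) :
    ∃ C : ℝ, 0 ≤ C ∧ ∀ᶠ ε in toZero, ∀ x ∈ K, ∀ i ≤ k,
      ‖iteratedFDeriv ℝ i (u ε) x‖ ≤ C * (ε : ℝ) ^ q := by
  induction k with
  | zero =>
    obtain ⟨C, h⟩ := mu K hK hKV 0 q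
    refine ⟨|C|, abs_nonneg C, ?_⟩
    filter_upwards [h] with ε h x hx i hi
    obtain rfl : i = 0 := by omega
    refine (h x hx).trans ?_
    exact mul_le_mul_of_nonneg_right (le_abs_self C) (pow_nonneg ε.2.1.le _)
  | succ k ih =>
    obtain ⟨C, hC, h⟩ := ih
    obtain ⟨D, h'⟩ := mu K hK hKV (k + 1) q
    refine ⟨C + |D|, by positivity, ?_⟩
    filter_upwards [h, h'] with ε h h' x hx i hi
    have e0 : (0 : ℝ) ≤ (ε : ℝ) ^ q := pow_nonneg ε.2.1.le _
    rcases Nat.lt_or_ge i (k + 1) with hi' | hi'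
    · refine (h x hx i (by omega)).trans ?_
      exact mul_le_mul_of_nonneg_right (le_add_of_nonneg_right (abs_nonneg D)) e0
    · obtain rfl : i = k + 1 := by omega
      refine (h' x hx).trans ?_
      exact mul_le_mul_of_nonneg_right ((le_abs_self D).trans (le_add_of_nonneg_left hC)) e0

/-- Leibniz estimate from uniform bounds of the factors. -/
theorem iteratedFDeriv_mul_le_of_le {u v : X → ℂ} (hu : ContDiff ℝ ∞ u) (hv : ContDiff ℝ ∞ v)
    {k : ℕ} {x : X} {A B : ℝ} (hA : 0 ≤ A)
    (h : ∀ i ≤ k, ‖iteratedFDeriv ℝ i u x‖ ≤ A) (h' : ∀ i ≤ k, ‖iteratedFDeriv ℝ i v x‖ ≤ B) :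
    ‖iteratedFDeriv ℝ k (u * v) x‖ ≤ 2 ^ k * A * B := by
  have hle : ((k : ℕ∞) : WithTop ℕ∞) ≤ ∞ := by exact_mod_cast le_top
  refine (norm_iteratedFDeriv_mul_le (N := ∞) hu hv x hle).trans ?_
  calc ∑ i ∈ Finset.range (k + 1), (k.choose i : ℝ) * ‖iteratedFDeriv ℝ i u x‖ *
        ‖iteratedFDeriv ℝ (k - i) v x‖
      ≤ ∑ i ∈ Finset.range (k + 1), (k.choose i : ℝ) * A * B := by
        refine Finset.sum_le_sum fun i hi => ?_
        have hi' : i ≤ k := by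
          have := Finset.mem_range.1 hi
          omega
        have h1 := h i hi'
        have h2 := h' (k - i) (by omega)
        gcongr
    _ = 2 ^ k * A * B := by
        rw [← Finset.sum_mul, ← Finset.sum_mul]
        congr 2
        exact_mod_cast Nat.sum_range_choose k

theorem ModerateBound.mul {u v : Eps → X → ℂ} (hu : ∀ ε, ContDiff ℝ ∞ (u ε))
    (hv : ∀ ε, ContDiff ℝ ∞ (v ε)) (mu : ModerateBound u) (mv : ModerateBound v) :
    ModerateBound (u * v) := by
  intro K hK k
  obtain ⟨N, C, hC, h⟩ := mu.uniform hK k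
  obtain ⟨M, D, hD, h'⟩ := mv.uniform hK k
  refine ⟨N + M, 2 ^ k * C * D, ?_⟩
  filter_upwards [h, h'] with ε h h' x hx
  have e0 : (0 : ℝ) ≤ (ε : ℝ)⁻¹ := zero_le_one.trans (one_le_inv_eps ε)
  refine (iteratedFDeriv_mul_le_of_le (hu ε) (hv ε) (by positivity) (h x hx) (h' x hx)).trans
    (le_of_eq ?_)
  ring

theorem NegligibleBoundOn.mul_left {V : Set X} {u v : Eps → X → ℂ}
    (hu : ∀ ε, ContDiff ℝ ∞ (u ε)) (hv : ∀ ε, ContDiff ℝ ∞ (v ε)) (mu : ModerateBound u)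
    (mv : NegligibleBoundOn V v) : NegligibleBoundOn V (u * v) := by
  intro K hK hKV k q
  obtain ⟨N, C, hC, h⟩ := mu.uniform hK k
  obtain ⟨D, hD, h'⟩ := mv.uniform hK hKV k (q + N)
  refine ⟨2 ^ k * C * D, ?_⟩
  filter_upwards [h, h'] with ε h h' x hx
  have e0 : (0 : ℝ) ≤ (ε : ℝ)⁻¹ := zero_le_one.trans (one_le_inv_eps ε)
  have e1 : (ε : ℝ) ≠ 0 := ε.2.1.ne'
  refine (iteratedFDeriv_mul_le_of_le (hu ε) (hv ε) (by positivity) (h x hx) (h' x hx)).trans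
    (le_of_eq ?_)
  have : ((ε : ℝ)⁻¹) ^ N * (ε : ℝ) ^ N = 1 := by
    rw [← mul_pow, inv_mul_cancel₀ e1, one_pow]
  calc 2 ^ k * (C * ((ε : ℝ)⁻¹) ^ N) * (D * (ε : ℝ) ^ (q + N))
      = 2 ^ k * C * D * (ε : ℝ) ^ q * (((ε : ℝ)⁻¹) ^ N * (ε : ℝ) ^ N) := by ring
    _ = 2 ^ k * C * D * (ε : ℝ) ^ q := by rw [this, mul_one]

theorem moderateBound_smooth {f : X → ℂ} (hf : ContDiff ℝ ∞ f) :
    ModerateBound (fun _ : Eps => f) := by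
  intro K hK k
  have hc : Continuous (iteratedFDeriv ℝ k f) :=
    hf.continuous_iteratedFDeriv (by exact_mod_cast le_top)
  obtain ⟨C, hC⟩ := hK.exists_bound_of_continuousOn hc.continuousOn
  exact ⟨0, C, Eventually.of_forall fun ε x hx => by simpa using hC x hx⟩

variable (X) in
/-- The algebra `EM(X)` of moderate nets of smooth functions. -/
def moderate : Subalgebra ℂ (Eps → X → ℂ) where
  carrier := {u | (∀ ε, ContDiff ℝ ∞ (u ε)) ∧ ModerateBound u}
  mul_mem' hu hv := ⟨fun ε => (hu.1 ε).mul (hv.1 ε), hu.2.mul hu.1 hv.1 hv.2⟩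
  add_mem' hu hv := ⟨fun ε => (hu.1 ε).add (hv.1 ε), hu.2.add hu.1 hv.1 hv.2⟩
  algebraMap_mem' _ := ⟨fun _ => contDiff_const, moderateBound_smooth contDiff_const⟩

variable (X) in
/-- The ideal `N(X)` of negligible nets. -/
def negligible : Ideal (moderate X) where
  carrier := {u | NegligibleBoundOn Set.univ (u : Eps → X → ℂ)}
  add_mem' {u v} hu hv := NegligibleBoundOn.add u.2.1 v.2.1 hu hv
  zero_mem' := by
    intro K _ _ k q
    refine ⟨0, Eventually.of_forall fun ε x _ => ?_⟩
    have : ((0 : moderate X) : Eps → X → ℂ) ε = fun _ => (0 : ℂ) := rfl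
    rw [this, iteratedFDeriv_fun_zero]
    simp
  smul_mem' c u hu := NegligibleBoundOn.mul_left c.2.1 u.2.1 c.2.2 hu

variable (X) in
/-- The Colombeau algebra `G(X)`. -/
abbrev G : Type _ := moderate X ⧸ negligible X

/-- `U` is a representative of `u ∈ G(X)`. -/
def IsRep (U : Eps → X → ℂ) (u : G X) : Prop :=
  ∃ h : U ∈ moderate X, Ideal.Quotient.mk (negligible X) ⟨U, h⟩ = u

/-! ### Operations on `G` -/

/-- A smooth function as a generalised function (constant net). -/
def ofSmooth (f : X → ℂ) (hf : ContDiff ℝ ∞ f) : G X :=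
  Ideal.Quotient.mk (negligible X) ⟨fun _ => f, fun _ => hf, moderateBound_smooth hf⟩

theorem contDiff_dirDeriv {f : X → ℂ} (hf : ContDiff ℝ ∞ f) (v : X) :
    ContDiff ℝ ∞ (fun x => fderiv ℝ f x v) :=
  (hf.fderiv_right (m := ∞) (by simp)).clm_apply contDiff_const

theorem norm_iteratedFDeriv_dirDeriv_le {f : X → ℂ} (hf : ContDiff ℝ ∞ f) (v : X) (k : ℕ) (x : X) :
    ‖iteratedFDeriv ℝ k (fun x => fderiv ℝ f x v) x‖ ≤ ‖v‖ * ‖iteratedFDeriv ℝ (k + 1) f x‖ := by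
  have h1 : ContDiff ℝ ∞ (fderiv ℝ f) := hf.fderiv_right (m := ∞) (by simp)
  have h2 := (ContinuousLinearMap.apply ℝ ℂ v).norm_iteratedFDeriv_comp_left
    (n := k) (N := ∞) (x := x) h1.contDiffAt (by exact_mod_cast le_top)
  have h3 : ‖ContinuousLinearMap.apply ℝ ℂ v‖ ≤ ‖v‖ := by
    refine ContinuousLinearMap.opNorm_le_bound _ (norm_nonneg v) fun L => ?_
    rw [mul_comm]
    exact L.le_opNorm v
  rw [norm_iteratedFDeriv_fderiv] at h2
  exact h2.trans (mul_le_mul_of_nonneg_right h3 (norm_nonneg _))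

theorem dirDeriv_mem_moderate (v : X) {U : Eps → X → ℂ} (hU : U ∈ moderate X) :
    (fun ε x => fderiv ℝ (U ε) x v) ∈ moderate X := by
  refine ⟨fun ε => contDiff_dirDeriv (hU.1 ε) v, fun K hK k => ?_⟩
  obtain ⟨N, C, h⟩ := hU.2 K hK (k + 1)
  refine ⟨N, ‖v‖ * C, ?_⟩
  filter_upwards [h] with ε h x hx
  refine (norm_iteratedFDeriv_dirDeriv_le (hU.1 ε) v k x).trans ?_
  rw [mul_assoc]
  exact mul_le_mul_of_nonneg_left (h x hx) (norm_nonneg v)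

/-- The directional derivative of a moderate net. -/
noncomputable def dirDerivNet (v : X) : moderate X →+ moderate X where
  toFun U := ⟨fun ε x => fderiv ℝ ((U : Eps → X → ℂ) ε) x v, dirDeriv_mem_moderate v U.2⟩
  map_zero' := by
    ext ε x
    change fderiv ℝ (fun _ : X => (0 : ℂ)) x v = 0
    simp
  map_add' U W := by
    ext ε x
    change fderiv ℝ ((U : Eps → X → ℂ) ε + (W : Eps → X → ℂ) ε) x v = _
    rw [fderiv_add ((U.2.1 ε).differentiable (by simp) x) ((W.2.1 ε).differentiable (by simp) x)]
    rfl

theorem dirDerivNet_mem_negligible (v : X) {U : moderate X} (hU : U ∈ negligible X) :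
    dirDerivNet v U ∈ negligible X := by
  intro K hK hKV k q
  obtain ⟨C, h⟩ := hU K hK hKV (k + 1) q
  refine ⟨‖v‖ * C, ?_⟩
  filter_upwards [h] with ε h x hx
  refine (norm_iteratedFDeriv_dirDeriv_le (U.2.1 ε) v k x).trans ?_
  rw [mul_assoc]
  exact mul_le_mul_of_nonneg_left (h x hx) (norm_nonneg v)

/-- The directional derivative `∂_v` on `G(X)`. -/
noncomputable def pd (v : X) : G X →+ G X :=
  QuotientAddGroup.map (negligible X).toAddSubgroup (negligible X).toAddSubgroup (dirDerivNet v)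
    fun _ hU => dirDerivNet_mem_negligible v hU

/-- `D_v = -i ∂_v`. -/
noncomputable def D (v : X) (u : G X) : G X := (-Complex.I) • pd v u

variable {Y : Type*} [NormedAddCommGroup Y] [NormedSpace ℝ Y]

theorem norm_iteratedFDeriv_pull_le {f : X → ℂ} (hf : ContDiff ℝ ∞ f) (L : Y →L[ℝ] X) (k : ℕ)
    (y : Y) : ‖iteratedFDeriv ℝ k (f ∘ L) y‖ ≤ ‖L‖ ^ k * ‖iteratedFDeriv ℝ k f (L y)‖ := by
  rw [L.iteratedFDeriv_comp_right hf y (i := k) (by exact_mod_cast le_top)]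
  refine (ContinuousMultilinearMap.norm_compContinuousLinearMap_le _ _).trans (le_of_eq ?_)
  simp [mul_comm]

theorem pull_mem_moderate (L : Y →L[ℝ] X) {U : Eps → X → ℂ} (hU : U ∈ moderate X) :
    (fun ε => U ε ∘ L) ∈ moderate Y := by
  refine ⟨fun ε => (hU.1 ε).comp L.contDiff, fun K hK k => ?_⟩
  obtain ⟨N, C, h⟩ := hU.2 (L '' K) (hK.image L.continuous) k
  refine ⟨N, ‖L‖ ^ k * C, ?_⟩
  filter_upwards [h] with ε h y hy
  refine (norm_iteratedFDeriv_pull_le (hU.1 ε) L k y).trans ?_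
  rw [mul_assoc]
  exact mul_le_mul_of_nonneg_left (h _ ⟨y, hy, rfl⟩) (by positivity)

/-- Composition of a moderate net with a linear map. -/
def pullNet (L : Y →L[ℝ] X) : moderate X →+* moderate Y where
  toFun U := ⟨fun ε => (U : Eps → X → ℂ) ε ∘ L, pull_mem_moderate L U.2⟩
  map_one' := rfl
  map_mul' _ _ := rfl
  map_zero' := rfl
  map_add' _ _ := rfl

/-- The pullback `u ↦ u ∘ L` along a linear map, `G(X) → G(Y)`. -/
def pull (L : Y →L[ℝ] X) : G X →+* G Y :=
  Ideal.quotientMap (negligible Y) (pullNet L) <| by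
    intro U hU K hK _ k q
    obtain ⟨C, h⟩ := hU (L '' K) (hK.image L.continuous) (Set.subset_univ _) k q
    refine ⟨‖L‖ ^ k * C, ?_⟩
    filter_upwards [h] with ε h y hy
    refine (norm_iteratedFDeriv_pull_le (U.2.1 ε) L k y).trans ?_
    rw [mul_assoc]
    exact mul_le_mul_of_nonneg_left (h _ ⟨y, hy, rfl⟩) (by positivity)

/-! ### Special types of generalised functions -/

/-- `u` is real valued: it has a representative consisting of real valued functions. -/
def RealValued (u : G X) : Prop :=
  ∃ U : Eps → X → ℝ, IsRep (fun ε x => (U ε x : ℂ)) u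

/-- `u` restricted to the open set `V` is zero in `G(V)`. -/
def VanishesOn (u : G X) (V : Set X) : Prop :=
  ∃ U, IsRep U u ∧ NegligibleBoundOn V U

/-- The support: the complement of the union of all open sets on which `u` vanishes. -/
def gsupport (u : G X) : Set X :=
  {x | ∀ V : Set X, IsOpen V → x ∈ V → ¬ VanishesOn u V}

/-- `u ∈ G_c(X)`. -/
def CompactlySupported (u : G X) : Prop :=
  ∃ K : Set X, IsCompact K ∧ gsupport u ⊆ K

/-- `u ∈ G(ℝ × X)` is compactly supported with respect to the second variable. -/
def CompactlySupportedInX (u : G (ℝ × X)) : Prop :=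
  ∃ K : Set X, IsCompact K ∧ gsupport u ⊆ Set.univ ×ˢ K

/-- Logarithmic type. -/
def LogType (u : G X) : Prop :=
  ∃ U, IsRep U u ∧ ∀ K : Set X, IsCompact K → ∃ C : ℝ, ∀ᶠ ε in toZero, ∀ x ∈ K,
    ‖U ε x‖ ≤ C * Real.log ((ε : ℝ)⁻¹)

/-- Slow scale logarithmic type (the slow scale net is `≥ 1`, so that its logarithm is a bound). -/
def SlowScaleLogType (u : G X) : Prop :=
  ∃ U, IsRep U u ∧ ∀ K : Set X, IsCompact K → ∃ μ : Eps → ℝ, SlowScale μ ∧ (∀ ε, 1 ≤ μ ε) ∧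
    ∃ C : ℝ, ∀ᶠ ε in toZero, ∀ x ∈ K, ‖U ε x‖ ≤ C * Real.log (μ ε)

/-- Slow scale regularity. -/
def SlowScaleRegular (u : G X) : Prop :=
  ∃ U, IsRep U u ∧ ∀ K : Set X, IsCompact K → ∀ k : ℕ, ∃ μ : Eps → ℝ, SlowScale μ ∧
    ∃ C : ℝ, ∀ᶠ ε in toZero, ∀ x ∈ K, ‖iteratedFDeriv ℝ k (U ε) x‖ ≤ C * |μ ε|

end Algebra

/-! ### Generalised phase functions -/

section Phase

variable {X Y Z : Type*} [NormedAddCommGroup X] [NormedSpace ℝ X] [NormedAddCommGroup Y]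
  [NormedSpace ℝ Y] [NormedAddCommGroup Z] [NormedSpace ℝ Z]

/-- `|ξ|^{-1+k} ‖D_ξ^k D_{(x,y)}^l ψ(x,y,ξ)‖`, whose suprema over compact sets of `(x,y)` and all
`ξ ≠ 0` are the seminorms of the space of symbols homogeneous of order `1` in `ξ`. -/
noncomputable def hgSeminorm (ψ : X → Y → Z → ℝ) (k l : ℕ) (x : X) (y : Y) (ξ : Z) : ℝ :=
  ‖ξ‖ ^ ((k : ℤ) - 1) *
    ‖iteratedFDeriv ℝ k (fun ζ => iteratedFDeriv ℝ l (fun p : X × Y => ψ p.1 p.2 ζ) (x, y)) ξ‖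

/-- `‖∇_{y,ξ} ψ(x,y,ξ)‖²`. -/
noncomputable def gradSq (ψ : X → Y → Z → ℝ) (x : X) (y : Y) (ξ : Z) : ℝ :=
  ‖fderiv ℝ (fun p : Y × Z => ψ x p.1 p.2) (y, ξ)‖ ^ 2

/-- Nets of phase functions in `(y,ξ)` depending on the parameter `x`: continuous, smooth off
`ξ = 0`, positively homogeneous of degree `1` in `ξ`, with nowhere vanishing `(y,ξ)`-gradient. -/
structure IsPhaseNet (ψ : Eps → X → Y → Z → ℝ) : Prop where
  continuous : ∀ ε, Continuous fun p : X × Y × Z => ψ ε p.1 p.2.1 p.2.2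
  smooth : ∀ ε, ContDiffOn ℝ ∞ (fun p : X × Y × Z => ψ ε p.1 p.2.1 p.2.2) {p | p.2.2 ≠ 0}
  homogeneous : ∀ ε x y ξ, ∀ r : ℝ, 0 < r → ψ ε x y (r • ξ) = r * ψ ε x y ξ
  grad_ne_zero : ∀ ε x y ξ, ξ ≠ 0 → gradSq (ψ ε) x y ξ ≠ 0

/-- Moderate nets of phase functions, i.e. the representatives of generalised phase functions
with respect to the variables `(y,ξ)`. -/
structure IsModeratePhase (ψ : Eps → X → Y → Z → ℝ) : Prop extends IsPhaseNet ψ where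
  moderate : ∀ (K : Set (X × Y)), IsCompact K → ∀ k l : ℕ, ∃ N : ℕ, ∃ C : ℝ, ∀ᶠ ε : Eps in toZero,
    ∀ p ∈ K, ∀ ξ : Z, ξ ≠ 0 → hgSeminorm (ψ ε) k l p.1 p.2 ξ ≤ C * ((ε : ℝ)⁻¹) ^ N
  grad : ∀ (K : Set X) (L : Set Y), IsCompact K → IsCompact L → ∃ r : ℝ, 0 < r ∧
    ∀ᶠ ε : Eps in toZero, ∀ x ∈ K, ∀ y ∈ L, ∀ ξ : Z, ‖ξ‖ = 1 → (ε : ℝ) ^ r ≤ gradSq (ψ ε) x y ξ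

/-- Slow scale nets of phase functions. -/
structure IsSlowScalePhase (ψ : Eps → X → Y → Z → ℝ) : Prop extends IsPhaseNet ψ where
  slowScale : ∀ (K : Set (X × Y)), IsCompact K → ∀ k l : ℕ, ∃ μ : Eps → ℝ, SlowScale μ ∧
    ∃ C : ℝ, ∀ᶠ ε in toZero,
      ∀ p ∈ K, ∀ ξ : Z, ξ ≠ 0 → hgSeminorm (ψ ε) k l p.1 p.2 ξ ≤ C * |μ ε|
  grad : ∀ (K : Set X) (L : Set Y), IsCompact K → IsCompact L →
    ∃ s : Eps → ℝ, SlowScale s ∧ (∀ ε, 0 < s ε) ∧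
      ∀ᶠ ε in toZero, ∀ x ∈ K, ∀ y ∈ L, ∀ ξ : Z, ‖ξ‖ = 1 → (s ε)⁻¹ ≤ gradSq (ψ ε) x y ξ

end Phase

/-! ### The Cauchy problem, the characteristics and the Fourier integral operator -/

/-- `ℝⁿ`. -/
abbrev Sp (n : ℕ) : Type := EuclideanSpace ℝ (Fin n)

section Transport

variable {n : ℕ}

/-- The coordinate vector `e_j` of `ℝⁿ`. -/
noncomputable def e (j : Fin n) : Sp n := EuclideanSpace.single j 1

/-- The coordinate function `x ↦ x_h`, complex valued. -/
noncomputable def coordFn (h : Fin n) : Sp n → ℂ := fun x => ((x h : ℝ) : ℂ)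

theorem contDiff_coordFn (h : Fin n) : ContDiff ℝ ∞ (coordFn h) :=
  Complex.ofRealCLM.contDiff.comp (EuclideanSpace.proj (𝕜 := ℝ) h).contDiff

/-- `x_h` as a generalised function on `ℝⁿ`. -/
noncomputable def coord (h : Fin n) : G (Sp n) := ofSmooth (coordFn h) (contDiff_coordFn h)

/-- `u(0,·)` for `u ∈ G(ℝ × X)`. -/
noncomputable def atTimeZero {X : Type*} [NormedAddCommGroup X] [NormedSpace ℝ X] (u : G (ℝ × X)) :
    G X :=
  pull (ContinuousLinearMap.inr ℝ ℝ X) u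

/-- `u ∈ G(ℝ × ℝⁿ)` solves `D_t u = ∑ a_j D_j u + a₀ u`, `u(0,·) = u₀`. -/
def SolvesCauchy (a : Fin n → G (ℝ × Sp n)) (a₀ : G (ℝ × Sp n)) (u₀ : G (Sp n))
    (u : G (ℝ × Sp n)) : Prop :=
  D ((1 : ℝ), (0 : Sp n)) u = ∑ j, a j * D ((0 : ℝ), e j) u + a₀ * u ∧ atTimeZero u = u₀

/-- Points `(x,t,s)` of `ℝⁿ × ℝ × ℝ`. -/
abbrev FlowSp (n : ℕ) : Type := Sp n × ℝ × ℝ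

/-- `Γ` is a net of `ℝⁿ`-valued maps that represents `(γ_1,…,γ_n)` and is c-bounded (eventually it
maps a given compact set into a fixed compact set), so that it may be inserted into generalised
functions. -/
def IsFlowRep (γ : Fin n → G (FlowSp n)) (Γ : Eps → FlowSp n → Sp n) : Prop :=
  (∀ h, IsRep (fun ε p => ((Γ ε p h : ℝ) : ℂ)) (γ h)) ∧
    ∀ K : Set (FlowSp n), IsCompact K → ∃ L : Set (Sp n), IsCompact L ∧
      ∀ᶠ ε in toZero, ∀ p ∈ K, Γ ε p ∈ L

/-- `w(x,t,s) = f(s, γ(x,t,s))` in `G(ℝⁿ × ℝ × ℝ)`. -/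
def IsAlong (f : G (ℝ × Sp n)) (γ : Fin n → G (FlowSp n)) (w : G (FlowSp n)) : Prop :=
  ∃ F Γ, IsRep F f ∧ IsFlowRep γ Γ ∧ IsRep (fun ε p => F ε (p.2.2, Γ ε p)) w

/-- The linear map `(x,t) ↦ (x,t,t)`. -/
noncomputable def diagMap (n : ℕ) : Sp n × ℝ →L[ℝ] FlowSp n :=
  (ContinuousLinearMap.fst ℝ (Sp n) ℝ).prod
    ((ContinuousLinearMap.snd ℝ (Sp n) ℝ).prod (ContinuousLinearMap.snd ℝ (Sp n) ℝ))

/-- `γ` solves the characteristic system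
`∂_s γ_h(x,t,s) = -a_h(s, γ(x,t,s))`, `γ_h(x,t,t) = x_h` in `G(ℝⁿ × ℝ × ℝ)`. -/
structure IsCharacteristic (a : Fin n → G (ℝ × Sp n)) (γ : Fin n → G (FlowSp n)) : Prop where
  ode : ∀ h, ∃ w, IsAlong (a h) γ w ∧ pd ((0 : Sp n), (0 : ℝ), (1 : ℝ)) (γ h) = -w
  init : ∀ h, pull (diagMap n) (γ h) = pull (ContinuousLinearMap.fst ℝ (Sp n) ℝ) (coord h)

/-- Points `(t,x,η)`. -/
abbrev PhaseSp (n : ℕ) : Type := ℝ × Sp n × Sp n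

/-- `(t,x,η) ↦ (t,x)`. -/
noncomputable def toTX (n : ℕ) : PhaseSp n →L[ℝ] ℝ × Sp n :=
  (ContinuousLinearMap.fst ℝ ℝ (Sp n × Sp n)).prod
    ((ContinuousLinearMap.fst ℝ (Sp n) (Sp n)).comp (ContinuousLinearMap.snd ℝ ℝ (Sp n × Sp n)))

/-- `(t,x,η) ↦ η`. -/
noncomputable def toEta (n : ℕ) : PhaseSp n →L[ℝ] Sp n :=
  (ContinuousLinearMap.snd ℝ (Sp n) (Sp n)).comp (ContinuousLinearMap.snd ℝ ℝ (Sp n × Sp n))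

/-- `(t,x) ↦ (x,t,0)`. -/
noncomputable def toFlowZero (n : ℕ) : ℝ × Sp n →L[ℝ] FlowSp n :=
  (ContinuousLinearMap.snd ℝ ℝ (Sp n)).prod ((ContinuousLinearMap.fst ℝ ℝ (Sp n)).prod 0)

/-- `φ(t,x,η) = ∑_h γ_h(x,t,0) η_h` in `G(ℝ × ℝⁿ × ℝⁿ)`. -/
noncomputable def phase (γ : Fin n → G (FlowSp n)) : G (PhaseSp n) :=
  ∑ h, pull (toTX n) (pull (toFlowZero n) (γ h)) * pull (toEta n) (coord h)

/-- `φ` solves the eikonal problem `∂_t φ = ∑ a_j ∂_{x_j} φ`, `φ(0,x,η) = x·η`. -/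
def SolvesEikonal (a : Fin n → G (ℝ × Sp n)) (φ : G (PhaseSp n)) : Prop :=
  pd ((1 : ℝ), (0 : Sp n), (0 : Sp n)) φ =
      ∑ j, pull (toTX n) (a j) * pd ((0 : ℝ), e j, (0 : Sp n)) φ ∧
    atTimeZero φ = ∑ h, pull (ContinuousLinearMap.fst ℝ (Sp n) (Sp n)) (coord h) *
      pull (ContinuousLinearMap.snd ℝ (Sp n) (Sp n)) (coord h)

/-- The net `φ_ε(t,x,η) - y·η`, with parameter `(t,x)`. -/
noncomputable def fullPhase (Φ : Eps → PhaseSp n → ℝ) : Eps → ℝ × Sp n → Sp n → Sp n → ℝ :=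
  fun ε p y η => Φ ε (p.1, p.2, η) - inner ℝ y η

/-- `Φ` is a representative of `φ`, real valued and homogeneous of degree `1` in `η`, such that
`φ(t,x,η) - y·η` is a generalised phase function with respect to `(y,η)`. -/
def IsPhaseRep (Φ : Eps → PhaseSp n → ℝ) (φ : G (PhaseSp n)) : Prop :=
  IsRep (fun ε p => (Φ ε p : ℂ)) φ ∧ IsModeratePhase (fullPhase Φ)

/-- `φ(t,x,η) - y·η` is a generalised phase function. -/
def IsGenPhase (φ : G (PhaseSp n)) : Prop := ∃ Φ, IsPhaseRep Φ φ

/-- `φ(t,x,η) - y·η` is a slow scale generalised phase function. -/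
def IsSlowScaleGenPhase (φ : G (PhaseSp n)) : Prop :=
  ∃ Φ, IsPhaseRep Φ φ ∧ IsSlowScalePhase (fullPhase Φ)

/-- `b(t,x) = e^{iβ(t,x)}` with `β(t,x) = ∫_0^t a₀(s, γ(x,t,s)) ds`. -/
def IsExpIntegral (a₀ : G (ℝ × Sp n)) (γ : Fin n → G (FlowSp n)) (b : G (ℝ × Sp n)) : Prop :=
  ∃ (A : Eps → ℝ × Sp n → ℂ) (Γ : Eps → FlowSp n → Sp n) (β : G (ℝ × Sp n))
    (B : Eps → ℝ × Sp n → ℂ),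
    IsRep A a₀ ∧ IsFlowRep γ Γ ∧
      IsRep (fun ε p => ∫ s in (0 : ℝ)..p.1, A ε (s, Γ ε (p.2, p.1, s))) β ∧
      IsRep B β ∧ IsRep (fun ε p => Complex.exp (Complex.I * B ε p)) b

/-- The Fourier transform `∫ e^{-i y·η} f(y) dy`. -/
noncomputable def fourierT (f : Sp n → ℂ) (η : Sp n) : ℂ :=
  ∫ y, Complex.exp (-(Complex.I * ((inner ℝ y η : ℝ) : ℂ))) * f y

/-- The integrand `e^{iφ(t,x,η)} b(t,x) û(η)`. -/
noncomputable def fioIntegrand (φ : PhaseSp n → ℝ) (b : ℝ × Sp n → ℂ) (u : Sp n → ℂ)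
    (p : ℝ × Sp n) (η : Sp n) : ℂ :=
  Complex.exp (Complex.I * (φ (p.1, p.2, η) : ℂ)) * b p * fourierT u η

/-- `u = F_φ(b) u₀`, that is `u(t,x) = (2π)^{-n} ∫ e^{iφ(t,x,η)} b(t,x) û₀(η) dη`, at the level of
representatives; `u₀` is represented by functions supported in a common compact set. -/
def IsFIO (φ : G (PhaseSp n)) (b : G (ℝ × Sp n)) (u₀ : G (Sp n)) (u : G (ℝ × Sp n)) : Prop :=
  ∃ (Φ : Eps → PhaseSp n → ℝ) (B : Eps → ℝ × Sp n → ℂ) (U₀ : Eps → Sp n → ℂ),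
    IsPhaseRep Φ φ ∧ IsRep B b ∧ IsRep U₀ u₀ ∧
      (∃ K : Set (Sp n), IsCompact K ∧ ∀ ε, ∀ x ∉ K, U₀ ε x = 0) ∧
      (∀ ε p, Integrable (fioIntegrand (Φ ε) (B ε) (U₀ ε) p)) ∧
      IsRep (fun ε p => (((2 * Real.pi) ^ n : ℝ) : ℂ)⁻¹ *
        ∫ η, fioIntegrand (Φ ε) (B ε) (U₀ ε) p η) u

/-- Real valued, compactly supported in `x`, with `x`-derivatives of logarithmic type. -/
structure HypH1 (a : Fin n → G (ℝ × Sp n)) : Prop where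
  realValued : ∀ j, RealValued (a j)
  support : ∀ j, CompactlySupportedInX (a j)
  logType : ∀ j k, LogType (pd ((0 : ℝ), e k) (a j))

/-- Real valued, slow scale regular, compactly supported in `x`, with `x`-derivatives of slow scale
logarithmic type. -/
structure HypH2 (a : Fin n → G (ℝ × Sp n)) : Prop where
  realValued : ∀ j, RealValued (a j)
  slowScale : ∀ j, SlowScaleRegular (a j)
  support : ∀ j, CompactlySupportedInX (a j)
  logType : ∀ j k, SlowScaleLogType (pd ((0 : ℝ), e k) (a j))

/-- Compactly supported in `x` and of logarithmic type. -/
structure HypI1 (a₀ : G (ℝ × Sp n)) : Prop where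
  support : CompactlySupportedInX a₀
  logType : LogType a₀

/-- Slow scale regular, compactly supported in `x` and of slow scale logarithmic type. -/
structure HypI2 (a₀ : G (ℝ × Sp n)) : Prop where
  slowScale : SlowScaleRegular a₀
  support : CompactlySupportedInX a₀
  logType : SlowScaleLogType a₀

/-- The representation of the solution: `γ` is the characteristic curve, `φ = ∑ γ_h(x,t,0) η_h` is a
generalised phase function that solves the eikonal problem, `b = e^{iβ}` is the solution of the
transport problem with initial value `1`, `u` is the solution with initial value `u₀`, and
`u = F_φ(b) u₀`. -/
structure FIOFormula (a : Fin n → G (ℝ × Sp n)) (a₀ : G (ℝ × Sp n)) (u₀ : G (Sp n))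
    (γ : Fin n → G (FlowSp n)) (φ : G (PhaseSp n)) (b u : G (ℝ × Sp n)) : Prop where
  characteristic : IsCharacteristic a γ
  characteristic_unique : ∀ γ', IsCharacteristic a γ' → γ' = γ
  phase_eq : φ = phase γ
  genPhase : IsGenPhase φ
  eikonal : SolvesEikonal a φ
  transport : SolvesCauchy a a₀ 1 b
  transport_unique : ∀ b', SolvesCauchy a a₀ 1 b' → b' = b
  exp_eq : IsExpIntegral a₀ γ b
  solution : SolvesCauchy a a₀ u₀ u
  solution_unique : ∀ u', SolvesCauchy a a₀ u₀ u' → u' = u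
  formula : IsFIO φ b u₀ u

end Transport

end Colombeau

/-! For fixed ε this is the method of characteristics. After cutting off in x, the coefficients have
real representatives that vanish outside a fixed ball, so the vector field f = -(a_1,…,a_n) has
bounded derivatives on every strip |t| ≤ T and its flow γ is global and smooth. The foot point
γ(x,t,0) is constant along characteristics, and ∫_0^t a₀(s,γ(x,t,s)) ds has derivative a₀ along
them. Hence γ(x,t,0)·η solves the eikonal equation, e^{iβ} the transport equation with initial value
1, and u₀(γ(x,t,0)) e^{iβ} the Cauchy problem. As φ is linear in η, the Fourier integral is Fourier
inversion of u₀ at the foot point.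

The real issue is growth in ε. The derivatives of γ are bounded by powers of M e^{2TΛ}, where M
bounds derivatives of f and Λ only its first x-derivative (`exists_norm_iteratedFDeriv_flow_le`): in
the Faà di Bruno formula the top derivative of γ is multiplied by D_x f alone
(`norm_iteratedFDeriv_field_comp_le`). Logarithmic type of D_x f makes e^{2TΛ} moderate, slow scale
logarithmic type makes it slow scale. The same mechanism, applied to a₀, controls e^{iβ}. Both parts
of the theorem are treated at once by measuring growth in an abstract class of nets (`IsScale`,
`SBound`, `LogNet`).

The bounds are proved for Picard iterates uniformly in the iteration. Interpolation between
derivatives of orders k and k+2 then makes all derivatives converge, which gives smoothness of the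
flow and the same bounds for it.

Uniqueness is a Gronwall estimate along characteristics: initial error and residual are null nets,
the Gronwall factor is the exponential of a logarithmic net and so moderate, and the difference is
null. Estimates of values suffice, because a moderate net with negligible values is negligible
(`negligible_of_zero_order`), again by interpolation. -/

namespace Colombeau

/-! ### Iterated derivatives: limits, interpolation, parameter integrals -/

section Calculus

variable {P F H : Type*} [NormedAddCommGroup P] [NormedSpace ℝ P] [NormedAddCommGroup F]
  [NormedSpace ℝ F] [NormedAddCommGroup H] [NormedSpace ℝ H]

theorem natCast_le_infty (k : ℕ) : ((k : ℕ) : WithTop ℕ∞) ≤ ∞ := by exact_mod_cast le_top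

theorem hasFDerivAt_iteratedFDeriv {f : P → F} (hf : ContDiff ℝ ∞ f) (k : ℕ) (x : P) :
    HasFDerivAt (iteratedFDeriv ℝ k f) (iteratedFDeriv ℝ (k + 1) f x).curryLeft x :=
  (contDiff_iff_ftaylorSeries.1 hf).fderiv k (by exact_mod_cast WithTop.coe_lt_top _) x

theorem continuous_iteratedFDeriv {f : P → F} (hf : ContDiff ℝ ∞ f) (k : ℕ) :
    Continuous (iteratedFDeriv ℝ k f) :=
  hf.continuous_iteratedFDeriv (natCast_le_infty k)

/-- A formal Taylor series consisting of successive derivatives. -/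
theorem contDiff_and_iteratedFDeriv_eq {f : P → F}
    {p : P → FormalMultilinearSeries ℝ P F} (h0 : ∀ x, (p x 0).curry0 = f x)
    (h : ∀ k x, HasFDerivAt (fun y => p y k) (p x (k + 1)).curryLeft x) :
    ContDiff ℝ ∞ f ∧ ∀ k x, iteratedFDeriv ℝ k f x = p x k := by
  have hT : HasFTaylorSeriesUpTo ∞ f p :=
    ⟨h0, fun k _ x => h k x, fun k _ => continuous_iff_continuousAt.2 fun x => (h k x).continuousAt⟩
  exact ⟨hT.contDiff, fun k x => (hT.eq_iteratedFDeriv (natCast_le_infty k) x).symm⟩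

theorem norm_iteratedFDeriv_sub_le {f : P → F} (hf : ContDiff ℝ ∞ f) (k : ℕ) {s : Set P}
    (hs : Convex ℝ s) {B : ℝ} (hB : ∀ y ∈ s, ‖iteratedFDeriv ℝ (k + 1) f y‖ ≤ B) {x y : P}
    (hx : x ∈ s) (hy : y ∈ s) :
    ‖iteratedFDeriv ℝ k f y - iteratedFDeriv ℝ k f x‖ ≤ B * ‖y - x‖ := by
  refine hs.norm_image_sub_le_of_norm_hasFDerivWithin_le (𝕜 := ℝ)
    (fun z _ => (hasFDerivAt_iteratedFDeriv hf k z).hasFDerivWithinAt) (fun z hz => ?_) hx hy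
  rw [ContinuousMultilinearMap.curryLeft_norm]
  exact hB z hz

/-- Interpolation between the derivatives of order `k` and `k + 2`. -/
theorem norm_iteratedFDeriv_succ_le_interpolation {f : P → F} (hf : ContDiff ℝ ∞ f) (k : ℕ) {x : P}
    {a B h : ℝ} (hh : 0 < h) (ha : ∀ y ∈ Metric.closedBall x h, ‖iteratedFDeriv ℝ k f y‖ ≤ a)
    (hB : ∀ y ∈ Metric.closedBall x h, ‖iteratedFDeriv ℝ (k + 2) f y‖ ≤ B) :
    ‖iteratedFDeriv ℝ (k + 1) f x‖ ≤ 2 * a / h + h * B := by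
  have hx : x ∈ Metric.closedBall x h := Metric.mem_closedBall_self hh.le
  have ha0 : 0 ≤ a := (norm_nonneg _).trans (ha x hx)
  have hB0 : 0 ≤ B := (norm_nonneg _).trans (hB x hx)
  have key : ∀ y ∈ Metric.closedBall x h,
      ‖(iteratedFDeriv ℝ (k + 1) f y).curryLeft - (iteratedFDeriv ℝ (k + 1) f x).curryLeft‖
        ≤ B * h := by
    intro y hy
    have h1 : (iteratedFDeriv ℝ (k + 1) f y).curryLeft - (iteratedFDeriv ℝ (k + 1) f x).curryLeft
        = (iteratedFDeriv ℝ (k + 1) f y - iteratedFDeriv ℝ (k + 1) f x).curryLeft := rfl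
    rw [h1, ContinuousMultilinearMap.curryLeft_norm]
    refine (norm_iteratedFDeriv_sub_le hf (k + 1) (convex_closedBall x h) hB hx hy).trans ?_
    gcongr
    rw [← dist_eq_norm]
    exact hy
  rw [← ContinuousMultilinearMap.curryLeft_norm]
  refine ContinuousLinearMap.opNorm_le_of_unit_norm (by positivity) fun v hv => ?_
  -- For a unit vector v, the increment of the k-th derivative over the step h v, of norm at most
  -- 2a, equals h times the (k+1)-st derivative in direction v up to an error B h². Dividing by h
  -- gives the claim.
  have hy : x + h • v ∈ Metric.closedBall x h := by simp [norm_smul, hv, abs_of_pos hh]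
  have h2 := (convex_closedBall x h).norm_image_sub_le_of_norm_hasFDerivWithin_le' (𝕜 := ℝ)
    (fun z _ => (hasFDerivAt_iteratedFDeriv hf k z).hasFDerivWithinAt) key hx hy
  rw [add_sub_cancel_left, map_smul] at h2
  have h3 : ‖h • v‖ = h := by simp [norm_smul, hv, abs_of_pos hh]
  have h4 := norm_sub_le (iteratedFDeriv ℝ k f (x + h • v) - iteratedFDeriv ℝ k f x)
    (iteratedFDeriv ℝ k f (x + h • v) - iteratedFDeriv ℝ k f x -
      h • (iteratedFDeriv ℝ (k + 1) f x).curryLeft v)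
  rw [sub_sub_cancel, norm_smul, Real.norm_of_nonneg hh.le] at h4
  have h5 := norm_sub_le (iteratedFDeriv ℝ k f (x + h • v)) (iteratedFDeriv ℝ k f x)
  have h6 := ha _ hy
  have h7 := ha _ hx
  rw [h3] at h2
  have h8 : h * ‖(iteratedFDeriv ℝ (k + 1) f x).curryLeft v‖ ≤ h * (2 * a / h + h * B) := by
    have : h * (2 * a / h + h * B) = 2 * a + B * h * h := by field_simp
    rw [this]
    linarith
  exact le_of_mul_le_mul_left h8 hh

/-- A uniformly Cauchy sequence of smooth functions whose derivatives of any order are locally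
uniformly bounded: the derivatives converge locally uniformly. -/
theorem uniformCauchySeqOn_iteratedFDeriv {f : ℕ → P → F} (hf : ∀ m, ContDiff ℝ ∞ (f m))
    (hC : ∀ R, UniformCauchySeqOn f atTop (Metric.ball 0 R))
    (hB : ∀ (k : ℕ) (R : ℝ), ∃ B, ∀ m, ∀ x ∈ Metric.ball (0 : P) R, ‖iteratedFDeriv ℝ k (f m) x‖ ≤ B)
    (k : ℕ) (R : ℝ) :
    UniformCauchySeqOn (fun m => iteratedFDeriv ℝ k (f m)) atTop (Metric.ball 0 R) := by
  induction k generalizing R with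
  | zero =>
    rw [Metric.uniformCauchySeqOn_iff]
    intro δ hδ
    obtain ⟨N, hN⟩ := Metric.uniformCauchySeqOn_iff.1 (hC R) δ hδ
    refine ⟨N, fun m hm l hl x hx => ?_⟩
    simp only [iteratedFDeriv_zero_eq_comp, Function.comp_apply, LinearIsometryEquiv.dist_map]
    exact hN m hm l hl x hx
  | succ k ih =>
    obtain ⟨B, hB⟩ := hB (k + 2) (R + 1)
    rw [Metric.uniformCauchySeqOn_iff]
    intro δ hδ
    -- The step h makes the term h · 2|B| at most δ/2. With h fixed, the k-th derivatives are taken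
    -- δh/8-close, which contributes 2(δh/8)/h = δ/4. The cap h ≤ 1 keeps the balls inside radius R
    -- + 1.
    set h : ℝ := min 1 (δ / (4 * (|B| + 1))) with hh
    have hh0 : 0 < h := by positivity
    have hh1 : h ≤ 1 := min_le_left _ _
    have hh2 : h * (2 * |B|) ≤ δ / 2 := by
      have : h ≤ δ / (4 * (|B| + 1)) := min_le_right _ _
      calc h * (2 * |B|) ≤ δ / (4 * (|B| + 1)) * (2 * (|B| + 1)) := by gcongr; linarith
        _ = δ / 2 := by field_simp; norm_num
    obtain ⟨N, hN⟩ := (Metric.uniformCauchySeqOn_iff.1 (ih (R + 1))) (δ * h / 8) (by positivity)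
    refine ⟨N, fun m hm l hl x hx => ?_⟩
    have hsub : ∀ j : ℕ, ∀ y, iteratedFDeriv ℝ j (f m - f l) y =
        iteratedFDeriv ℝ j (f m) y - iteratedFDeriv ℝ j (f l) y := fun j y =>
      iteratedFDeriv_sub_apply ((hf m).of_le (natCast_le_infty j)).contDiffAt
        ((hf l).of_le (natCast_le_infty j)).contDiffAt
    have hball : ∀ y ∈ Metric.closedBall x h, y ∈ Metric.ball (0 : P) (R + 1) := by
      intro y hy
      rw [Metric.mem_ball] at hx ⊢
      rw [Metric.mem_closedBall] at hy
      linarith [dist_triangle y x 0]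
    have := norm_iteratedFDeriv_succ_le_interpolation ((hf m).sub (hf l)) k (x := x) hh0
      (a := δ * h / 8) (B := 2 * |B|) (fun y hy => by
        have h1 := hN m hm l hl y (hball y hy)
        rw [dist_eq_norm] at h1
        erw [hsub]
        exact h1.le) (fun y hy => by
        have h1 := hB m y (hball y hy)
        have h2 := hB l y (hball y hy)
        erw [hsub]
        have h3 := norm_sub_le (iteratedFDeriv ℝ (k + 2) (f m) y) (iteratedFDeriv ℝ (k + 2) (f l) y)
        linarith [le_abs_self B])
    erw [hsub] at this
    rw [dist_eq_norm]
    have h9 : 2 * (δ * h / 8) / h = δ / 4 := by field_simp; norm_num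
    rw [h9] at this
    linarith

/-- A locally uniformly Cauchy sequence of smooth functions whose derivatives of any order are
locally uniformly bounded has a smooth limit, and the derivatives converge. -/
theorem contDiff_of_tendsto_of_bounded [CompleteSpace F] {f : ℕ → P → F} {g : P → F}
    (hf : ∀ m, ContDiff ℝ ∞ (f m))
    (hC : ∀ R, UniformCauchySeqOn f atTop (Metric.ball 0 R))
    (hB : ∀ (k : ℕ) (R : ℝ), ∃ B, ∀ m, ∀ x ∈ Metric.ball (0 : P) R, ‖iteratedFDeriv ℝ k (f m) x‖ ≤ B)
    (hg : ∀ x, Tendsto (fun m => f m x) atTop (𝓝 (g x))) :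
    ContDiff ℝ ∞ g ∧ ∀ k x,
      Tendsto (fun m => iteratedFDeriv ℝ k (f m) x) atTop (𝓝 (iteratedFDeriv ℝ k g x)) := by
  have hU := uniformCauchySeqOn_iteratedFDeriv hf hC hB
  have hex : ∀ x (k : ℕ), ∃ y, Tendsto (fun m => iteratedFDeriv ℝ k (f m) x) atTop (𝓝 y) := by
    intro x k
    refine cauchySeq_tendsto_of_complete ((hU k (‖x‖ + 1)).cauchySeq (x := x) ?_)
    simp
  choose p hp using hex
  have hT : ∀ k R, TendstoUniformlyOn (fun m => iteratedFDeriv ℝ k (f m)) (fun x => p x k) atTop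
      (Metric.ball 0 R) := fun k R =>
    (hU k R).tendstoUniformlyOn_of_tendsto fun x _ => hp x k
  obtain ⟨h1, h2⟩ := contDiff_and_iteratedFDeriv_eq (f := g) (p := p) (fun x => by
    refine tendsto_nhds_unique (f := fun m => f m x) ?_ (hg x)
    have := ((continuousMultilinearCurryFin0 ℝ P F).continuous.tendsto _).comp (hp x 0)
    exact this) (fun k x => by
    have hc : TendstoUniformlyOn (fun m y => (iteratedFDeriv ℝ (k + 1) (f m) y).curryLeft)
        (fun y => (p y (k + 1)).curryLeft) atTop (Metric.ball 0 (‖x‖ + 1)) :=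
      (continuousMultilinearCurryLeftEquiv ℝ (fun _ : Fin (k + 1) => P) F).lipschitz.uniformContinuous
        |>.comp_tendstoUniformlyOn (hT (k + 1) (‖x‖ + 1))
    exact hasFDerivAt_of_tendstoUniformlyOn Metric.isOpen_ball hc
      (fun m y _ => hasFDerivAt_iteratedFDeriv (hf m) k y) (fun y _ => hp y k) (by simp))
  exact ⟨h1, fun k x => h2 k x ▸ hp x k⟩

/-- Freezing θ is a translation followed by the inclusion of P. This form makes the partial
derivatives jointly continuous in (p, θ), as differentiation under the integral requires. -/
theorem iteratedFDeriv_comp_prodMk {h : P × ℝ → F} (hh : ContDiff ℝ ∞ h) (k : ℕ) (p : P) (θ : ℝ) :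
    iteratedFDeriv ℝ k (fun p => h (p, θ)) p =
      (iteratedFDeriv ℝ k h (p, θ)).compContinuousLinearMap
        fun _ => ContinuousLinearMap.inl ℝ P ℝ := by
  have h1 : (fun p => h (p, θ)) = (fun z => h (z + (0, θ))) ∘ ContinuousLinearMap.inl ℝ P ℝ := by
    ext p
    simp
  have h2 : ContDiff ℝ ∞ fun z => h (z + (0, θ)) := hh.comp (contDiff_id.add contDiff_const)
  rw [h1, (ContinuousLinearMap.inl ℝ P ℝ).iteratedFDeriv_comp_right h2 p (natCast_le_infty k),
    iteratedFDeriv_comp_add_right']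
  simp

theorem continuous_iteratedFDeriv_comp_prodMk {h : P × ℝ → F} (hh : ContDiff ℝ ∞ h) (k : ℕ) :
    Continuous fun z : P × ℝ => iteratedFDeriv ℝ k (fun p => h (p, z.2)) z.1 := by
  simp_rw [iteratedFDeriv_comp_prodMk hh]
  exact (ContinuousMultilinearMap.compContinuousLinearMapL
    fun _ : Fin k => ContinuousLinearMap.inl ℝ P ℝ).continuous.comp (continuous_iteratedFDeriv hh k)

/-- The isometry `J` stands for currying: derivatives of order k+1 are multilinear maps, whereas the
derivative of the k-th derivative is a linear map into multilinear maps. Since `J` commutes with the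
integral, the successive integrals form a Taylor series. -/
theorem hasFDerivAt_parameter_integral [FiniteDimensional ℝ P] {V W : Type*}
    [NormedAddCommGroup V] [NormedSpace ℝ V] [NormedAddCommGroup W] [NormedSpace ℝ W]
    [CompleteSpace V] [CompleteSpace W] (J : W ≃ₗᵢ[ℝ] (P →L[ℝ] V)) {K : P × ℝ → V} {K' : P × ℝ → W}
    (hK : Continuous K) (hK' : Continuous K')
    (h : ∀ p θ, HasFDerivAt (fun p => K (p, θ)) (J (K' (p, θ))) p) (p : P) :
    HasFDerivAt (fun p => ∫ θ in (0 : ℝ)..1, K (p, θ)) (J (∫ θ in (0 : ℝ)..1, K' (p, θ))) p := by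
  have : ProperSpace P := FiniteDimensional.proper ℝ P
  have hc : IsCompact (Metric.closedBall p 1 ×ˢ Set.Icc (0 : ℝ) 1) :=
    (isCompact_closedBall p 1).prod isCompact_Icc
  obtain ⟨B, hB⟩ := hc.exists_bound_of_continuousOn hK'.continuousOn
  have hK1 : ∀ q, Continuous fun θ => K (q, θ) := fun q => hK.comp (Continuous.prodMk_right q)
  have hK2 : Continuous fun θ => K' (p, θ) := hK'.comp (Continuous.prodMk_right p)
  have h1 := intervalIntegral.hasFDerivAt_integral_of_dominated_of_fderiv_le (μ := volume)
    (𝕜 := ℝ) (a := 0) (b := 1) (x₀ := p) (F := fun p θ => K (p, θ))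
    (F' := fun p θ => J (K' (p, θ))) (bound := fun _ => B) (Metric.closedBall_mem_nhds p one_pos)
    (Eventually.of_forall fun q => (hK1 q).aestronglyMeasurable)
    ((hK1 p).intervalIntegrable 0 1)
    (J.continuous.comp hK2).aestronglyMeasurable (Eventually.of_forall fun θ hθ q hq => by
      rw [J.norm_map]
      rw [Set.uIoc_of_le zero_le_one] at hθ
      exact hB (q, θ) ⟨hq, hθ.1.le, hθ.2⟩) (by simp)
    (Eventually.of_forall fun θ _ q _ => h q θ)
  have h2 := J.toLinearIsometry.toContinuousLinearMap.intervalIntegral_comp_comm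
    (hK2.intervalIntegrable (μ := volume) 0 1)
  exact h2 ▸ h1

/-- Parameter integrals of smooth functions are smooth, with derivatives under the integral. -/
theorem contDiff_parameter_integral [FiniteDimensional ℝ P] [CompleteSpace F] {h : P × ℝ → F}
    (hh : ContDiff ℝ ∞ h) :
    ContDiff ℝ ∞ (fun p => ∫ θ in (0 : ℝ)..1, h (p, θ)) ∧ ∀ k p,
      iteratedFDeriv ℝ k (fun p => ∫ θ in (0 : ℝ)..1, h (p, θ)) p =
        ∫ θ in (0 : ℝ)..1, iteratedFDeriv ℝ k (fun p => h (p, θ)) p := by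
  have hs : ∀ θ, ContDiff ℝ ∞ fun p => h (p, θ) := fun θ => hh.comp (contDiff_prodMk_left θ)
  refine contDiff_and_iteratedFDeriv_eq
    (p := fun p k => ∫ θ in (0 : ℝ)..1, iteratedFDeriv ℝ k (fun p => h (p, θ)) p) (fun p => ?_)
    (fun k p => ?_)
  · have hc : Continuous fun θ => iteratedFDeriv ℝ 0 (fun p => h (p, θ)) p :=
      (continuous_iteratedFDeriv_comp_prodMk hh 0).comp (Continuous.prodMk_right p)
    have := ((continuousMultilinearCurryFin0 ℝ P F).toContinuousLinearEquiv :
      (P [×0]→L[ℝ] F) →L[ℝ] F).intervalIntegral_comp_comm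
        (hc.intervalIntegrable (μ := volume) 0 1)
    exact this.symm
  · exact hasFDerivAt_parameter_integral
      (continuousMultilinearCurryLeftEquiv ℝ (fun _ : Fin (k + 1) => P) F)
      (K := fun z : P × ℝ => iteratedFDeriv ℝ k (fun p => h (p, z.2)) z.1)
      (K' := fun z : P × ℝ => iteratedFDeriv ℝ (k + 1) (fun p => h (p, z.2)) z.1)
      (continuous_iteratedFDeriv_comp_prodMk hh k)
      (continuous_iteratedFDeriv_comp_prodMk hh (k + 1))
      (fun q θ => hasFDerivAt_iteratedFDeriv (hs θ) k q) p

theorem norm_iteratedFDeriv_comp_linear_le {f : H → F} (hf : ContDiff ℝ ∞ f) (L : P →L[ℝ] H)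
    (k : ℕ) (x : P) : ‖iteratedFDeriv ℝ k (f ∘ L) x‖ ≤ ‖L‖ ^ k * ‖iteratedFDeriv ℝ k f (L x)‖ := by
  rw [L.iteratedFDeriv_comp_right hf x (natCast_le_infty k)]
  refine (ContinuousMultilinearMap.norm_compContinuousLinearMap_le _ _).trans (le_of_eq ?_)
  simp [mul_comm]

theorem norm_iteratedFDeriv_linear_comp_le {f : P → F} (hf : ContDiff ℝ ∞ f) (L : F →L[ℝ] H)
    (k : ℕ) (x : P) : ‖iteratedFDeriv ℝ k (L ∘ f) x‖ ≤ ‖L‖ * ‖iteratedFDeriv ℝ k f x‖ :=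
  L.norm_iteratedFDeriv_comp_left hf.contDiffAt (natCast_le_infty k)

theorem norm_iteratedFDeriv_linear_le (L : P →L[ℝ] F) {k : ℕ} (hk : 1 ≤ k) (x : P) :
    ‖iteratedFDeriv ℝ k L x‖ ≤ ‖L‖ := by
  obtain ⟨k, rfl⟩ : ∃ j, k = j + 1 := ⟨k - 1, by omega⟩
  rw [← norm_iteratedFDeriv_fderiv]
  have h : fderiv ℝ L = fun _ => L := by
    ext1 y
    exact L.fderiv
  rw [h]
  rcases Nat.eq_zero_or_pos k with rfl | hk
  · simp
  · rw [iteratedFDeriv_const_of_ne (by omega)]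
    simp

end Calculus

/-! ### Integration along the last variable -/

section FlowIntegral

variable {E F : Type*} [NormedAddCommGroup E] [NormedSpace ℝ E] [NormedAddCommGroup F]
  [NormedSpace ℝ F]

/-- `(x,t,s) ↦ s` -/
noncomputable def endTime (E : Type*) [NormedAddCommGroup E] [NormedSpace ℝ E] :
    E × ℝ × ℝ →L[ℝ] ℝ :=
  (ContinuousLinearMap.snd ℝ ℝ ℝ).comp (ContinuousLinearMap.snd ℝ E (ℝ × ℝ))

/-- `(x,t,s) ↦ t` -/
noncomputable def startTime (E : Type*) [NormedAddCommGroup E] [NormedSpace ℝ E] :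
    E × ℝ × ℝ →L[ℝ] ℝ :=
  (ContinuousLinearMap.fst ℝ ℝ ℝ).comp (ContinuousLinearMap.snd ℝ E (ℝ × ℝ))

/-- `(x,t,s) ↦ (x,t,t+θ(s-t))` -/
noncomputable def segMap (E : Type*) [NormedAddCommGroup E] [NormedSpace ℝ E] (θ : ℝ) :
    E × ℝ × ℝ →L[ℝ] E × ℝ × ℝ :=
  (ContinuousLinearMap.fst ℝ E (ℝ × ℝ)).prod
    ((startTime E).prod (startTime E + θ • (endTime E - startTime E)))

@[simp] theorem endTime_apply (p : E × ℝ × ℝ) : endTime E p = p.2.2 := rfl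
@[simp] theorem startTime_apply (p : E × ℝ × ℝ) : startTime E p = p.2.1 := rfl
@[simp] theorem segMap_apply (θ : ℝ) (p : E × ℝ × ℝ) :
    segMap E θ p = (p.1, p.2.1, p.2.1 + θ * (p.2.2 - p.2.1)) := rfl

theorem abs_segment_le {θ t s T : ℝ} (hθ : θ ∈ Set.Icc (0 : ℝ) 1) (ht : |t| ≤ T) (hs : |s| ≤ T) :
    |t + θ * (s - t)| ≤ T := by
  obtain ⟨h0, h1⟩ := hθ
  rw [abs_le] at *
  constructor <;> nlinarith

theorem norm_segMap_le {θ : ℝ} (hθ : θ ∈ Set.Icc (0 : ℝ) 1) : ‖segMap E θ‖ ≤ 1 := by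
  refine ContinuousLinearMap.opNorm_le_bound _ zero_le_one fun p => ?_
  have h1 : ‖p.1‖ ≤ ‖p‖ := norm_fst_le p
  have h2 : |p.2.1| ≤ ‖p‖ := (norm_fst_le p.2).trans (norm_snd_le p)
  have h3 : |p.2.2| ≤ ‖p‖ := (norm_snd_le p.2).trans (norm_snd_le p)
  rw [one_mul, segMap_apply]
  exact norm_prod_le_iff.2 ⟨h1, norm_prod_le_iff.2 ⟨h2, abs_segment_le hθ h2 h3⟩⟩

theorem norm_endTime_le : ‖endTime E‖ ≤ 1 := by
  refine ContinuousLinearMap.opNorm_le_bound _ zero_le_one fun p => ?_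
  rw [one_mul]
  exact (norm_snd_le p.2).trans (norm_snd_le p)

theorem norm_startTime_le : ‖startTime E‖ ≤ 1 := by
  refine ContinuousLinearMap.opNorm_le_bound _ zero_le_one fun p => ?_
  rw [one_mul]
  exact (norm_fst_le p.2).trans (norm_snd_le p)

/-- `(x,t,s) ↦ ∫_t^s h(x,t,r) dr` -/
noncomputable def flowInt (h : E × ℝ × ℝ → F) (p : E × ℝ × ℝ) : F :=
  ∫ r in p.2.1..p.2.2, h (p.1, p.2.1, r)

/-- The substitution r = t + θ(s-t) moves the variable limits into the integrand, which leaves a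
linear factor s-t and a parameter integral over [0,1]. -/
theorem flowInt_eq (h : E × ℝ × ℝ → F) (p : E × ℝ × ℝ) :
    flowInt h p = (endTime E - startTime E) p • ∫ θ in (0 : ℝ)..1, h (segMap E θ p) := by
  have := intervalIntegral.smul_integral_comp_add_mul (a := 0) (b := 1)
    (fun r => h (p.1, p.2.1, r)) (p.2.2 - p.2.1) p.2.1
  simp only [mul_zero, add_zero, mul_one, add_sub_cancel] at this
  rw [flowInt, ← this]
  simp [mul_comm]

theorem integral_mul_exp (A c : ℝ) :
    c * ∫ θ in (0 : ℝ)..1, A * Real.exp (θ * c) = A * (Real.exp c - 1) := by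
  have h : ∀ θ ∈ Set.uIcc (0 : ℝ) 1, HasDerivAt (fun θ => A * Real.exp (θ * c))
      (c * (A * Real.exp (θ * c))) θ := fun θ _ => by
    exact (((hasDerivAt_id θ).mul_const c).exp.const_mul A).congr_deriv (by simp; ring)
  rw [← intervalIntegral.integral_const_mul, intervalIntegral.integral_eq_sub_of_hasDerivAt h
    (by apply Continuous.intervalIntegrable; fun_prop)]
  simp
  ring

theorem contDiff_segMap_comp {h : E × ℝ × ℝ → F} (hh : ContDiff ℝ ∞ h) :
    ContDiff ℝ ∞ fun z : (E × ℝ × ℝ) × ℝ => h (segMap E z.2 z.1) := by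
  simp only [segMap_apply]
  fun_prop

variable [FiniteDimensional ℝ E] [CompleteSpace F]

theorem contDiff_flowInt {h : E × ℝ × ℝ → F} (hh : ContDiff ℝ ∞ h) : ContDiff ℝ ∞ (flowInt h) := by
  have h1 : flowInt h = fun p => (endTime E - startTime E) p •
      ∫ θ in (0 : ℝ)..1, h (segMap E θ p) := funext (flowInt_eq h)
  rw [h1]
  exact (endTime E - startTime E).contDiff.smul
    (contDiff_parameter_integral (contDiff_segMap_comp hh)).1

/-- Derivatives of `flowInt h` from exponential bounds of the derivatives of `h`. -/
theorem norm_iteratedFDeriv_flowInt_le {h : E × ℝ × ℝ → F} (hh : ContDiff ℝ ∞ h) (k : ℕ)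
    (p : E × ℝ × ℝ) {A Λ R R' : ℝ}
    (hk : ∀ θ ∈ Set.Icc (0 : ℝ) 1, ‖iteratedFDeriv ℝ k h (segMap E θ p)‖ ≤
      Λ * (A * Real.exp (Λ * (θ * |p.2.2 - p.2.1|))) + R)
    (hk' : ∀ j, k = j + 1 → ∀ θ ∈ Set.Icc (0 : ℝ) 1,
      ‖iteratedFDeriv ℝ j h (segMap E θ p)‖ ≤ R') :
    ‖iteratedFDeriv ℝ k (flowInt h) p‖ ≤
      A * (Real.exp (Λ * |p.2.2 - p.2.1|) - 1) + |p.2.2 - p.2.1| * R + 2 * k * R' := by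
  set d := |p.2.2 - p.2.1| with hd
  obtain ⟨hI, hI'⟩ := contDiff_parameter_integral (contDiff_segMap_comp hh)
  set I : E × ℝ × ℝ → F := fun p => ∫ θ in (0 : ℝ)..1, h (segMap E θ p) with hIdef
  have h1 : flowInt h = fun p => (endTime E - startTime E) p • I p := funext (flowInt_eq h)
  have hseg : ∀ j θ, θ ∈ Set.Icc (0 : ℝ) 1 → ‖iteratedFDeriv ℝ j (fun q => h (segMap E θ q)) p‖ ≤
      ‖iteratedFDeriv ℝ j h (segMap E θ p)‖ := fun j θ hθ => by
    refine (norm_iteratedFDeriv_comp_linear_le hh (segMap E θ) j p).trans ?_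
    exact mul_le_of_le_one_left (norm_nonneg _) (pow_le_one₀ (norm_nonneg _) (norm_segMap_le hθ))
  -- An integrand ΛA e^{Λθd} integrates to exactly A(e^{Λd} - 1). The summand -A is what later
  -- absorbs the lower order terms in the Picard induction.
  have b0 : d * ‖iteratedFDeriv ℝ k I p‖ ≤ A * (Real.exp (Λ * d) - 1) + d * R := by
    rw [hI' k p]
    have : ‖∫ θ in (0 : ℝ)..1, iteratedFDeriv ℝ k (fun q => h (segMap E θ q)) p‖ ≤
        ∫ θ in (0 : ℝ)..1, (Λ * (A * Real.exp (θ * (Λ * d))) + R) := by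
      refine intervalIntegral.norm_integral_le_of_norm_le zero_le_one
        (Eventually.of_forall fun θ hθ => ?_) (by apply Continuous.intervalIntegrable; fun_prop)
      have hθ' : θ ∈ Set.Icc (0 : ℝ) 1 := ⟨hθ.1.le, hθ.2⟩
      refine (hseg k θ hθ').trans ((hk θ hθ').trans (le_of_eq ?_))
      ring_nf
    refine (mul_le_mul_of_nonneg_left this (abs_nonneg _)).trans (le_of_eq ?_)
    rw [intervalIntegral.integral_add (by apply Continuous.intervalIntegrable; fun_prop) (by simp),
      intervalIntegral.integral_const_mul, ← integral_mul_exp]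
    simp
    ring
  have b1 : ∀ j, k = j + 1 → ‖iteratedFDeriv ℝ j I p‖ ≤ R' := fun j hj => by
    rw [hI' j p]
    have := intervalIntegral.norm_integral_le_of_norm_le_const (a := 0) (b := 1) (C := R')
      (f := fun θ => iteratedFDeriv ℝ j (fun q => h (segMap E θ q)) p) (fun θ hθ => by
        rw [Set.uIoc_of_le zero_le_one] at hθ
        have hθ' : θ ∈ Set.Icc (0 : ℝ) 1 := ⟨hθ.1.le, hθ.2⟩
        exact (hseg j θ hθ').trans (hk' j hj θ hθ'))
    simpa using this
  have hL : ‖endTime E - startTime E‖ ≤ 2 :=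
    (norm_sub_le _ _).trans (by linarith [norm_endTime_le (E := E), norm_startTime_le (E := E)])
  rw [h1]
  refine (norm_iteratedFDeriv_smul_le (endTime E - startTime E).contDiff hI p
    (natCast_le_infty k)).trans ?_
  -- The factor s-t is linear, so only two terms of the Leibniz formula survive: the factor itself
  -- with order k of the integral, and its first derivative, of norm at most 2, with order k-1.
  have h2 : ∀ i, 2 ≤ i → iteratedFDeriv ℝ i (endTime E - startTime E) p = 0 := fun i hi => by
    obtain ⟨j, rfl⟩ : ∃ j, i = j + 2 := ⟨i - 2, by omega⟩
    rw [← norm_eq_zero, ← norm_iteratedFDeriv_fderiv]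
    have : fderiv ℝ (endTime E - startTime E) = fun _ => endTime E - startTime E := by
      ext1 y
      exact (endTime E - startTime E).fderiv
    rw [this, iteratedFDeriv_const_of_ne (by omega)]
    simp
  rcases k with _ | j
  · simpa [← hd] using b0
  · rw [Finset.sum_range_succ', Finset.sum_range_succ', Finset.sum_eq_zero (fun i _ => by
      rw [h2 _ (by omega)]; simp)]
    have e1 := norm_iteratedFDeriv_linear_le (endTime E - startTime E) le_rfl p
    have e2 := b1 j rfl
    have e3 : ‖iteratedFDeriv ℝ (0 + 1) (endTime E - startTime E) p‖ *
        ‖iteratedFDeriv ℝ (j + 1 - (0 + 1)) I p‖ ≤ 2 * R' :=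
      mul_le_mul (e1.trans hL) e2 (norm_nonneg _) (by norm_num)
    have e4 := mul_le_mul_of_nonneg_left e3 (Nat.cast_nonneg (α := ℝ) (j + 1))
    simp only [zero_add, Nat.choose_one_right, Nat.choose_zero_right, Nat.cast_one, one_mul,
      norm_iteratedFDeriv_zero, Nat.sub_zero]
    have e5 : ‖(endTime E - startTime E) p‖ = d := rfl
    rw [e5]
    linarith

end FlowIntegral

/-! ### Derivatives of `f(s, g)` -/

section Composition

variable {P E F : Type*} [NormedAddCommGroup P] [NormedSpace ℝ P] [NormedAddCommGroup E]
  [NormedSpace ℝ E] [NormedAddCommGroup F] [NormedSpace ℝ F]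

theorem norm_iteratedFDeriv_prodMk_le {f : P → E} {g : P → F} (hf : ContDiff ℝ ∞ f)
    (hg : ContDiff ℝ ∞ g) (k : ℕ) (x : P) :
    ‖iteratedFDeriv ℝ k (fun x => (f x, g x)) x‖ ≤
      max ‖iteratedFDeriv ℝ k f x‖ ‖iteratedFDeriv ℝ k g x‖ := by
  rw [iteratedFDeriv_prodMk hf.contDiffAt hg.contDiffAt (natCast_le_infty k)]
  exact (ContinuousMultilinearMap.opNorm_prod _ _).le

/-- The part of the Faà di Bruno formula for `f(σ, g)` that contains the highest derivative of `g`
involves only the partial derivative of `f` in the second variable. -/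
theorem norm_iteratedFDeriv_field_comp_le {f : ℝ × E → F} (hf : ContDiff ℝ ∞ f) {g : P → E}
    (hg : ContDiff ℝ ∞ g) {σ : P →L[ℝ] ℝ} (hσ : ‖σ‖ ≤ 1) (j : ℕ) (p : P) {M D Λ : ℝ} (hD : 1 ≤ D)
    (hM : ∀ i ≤ j + 1, ‖iteratedFDeriv ℝ i f (σ p, g p)‖ ≤ M)
    (hΛ : ‖(fderiv ℝ f (σ p, g p)).comp (ContinuousLinearMap.inr ℝ ℝ E)‖ ≤ Λ)
    (hgD : ∀ i, 1 ≤ i → i ≤ j → ‖iteratedFDeriv ℝ i g p‖ ≤ D) :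
    ‖iteratedFDeriv ℝ (j + 1) (fun q => f (σ q, g q)) p‖ ≤
      Λ * ‖iteratedFDeriv ℝ (j + 1) g p‖ + (j.factorial + 2 ^ j * j.factorial) * M * D ^ (j + 1) := by
  have hM0 : 0 ≤ M := (norm_nonneg _).trans (hM 0 (by omega))
  have hD0 : 0 ≤ D := zero_le_one.trans hD
  set G : P → ℝ × E := fun q => (σ q, g q) with hG
  have hGs : ContDiff ℝ ∞ G := σ.contDiff.prodMk hg
  have hGD : ∀ i, 1 ≤ i → i ≤ j → ‖iteratedFDeriv ℝ i G p‖ ≤ D ^ i := fun i h1 h2 => by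
    refine (norm_iteratedFDeriv_prodMk_le σ.contDiff hg i p).trans (max_le ?_ ?_)
    · exact ((norm_iteratedFDeriv_linear_le σ h1 p).trans hσ).trans (one_le_pow₀ hD)
    · exact (hgD i h1 h2).trans (le_self_pow₀ hD (by omega))
  have hf' : ContDiff ℝ ∞ (fderiv ℝ f) := hf.fderiv_right (m := ∞) (by simp)
  have hg' : ContDiff ℝ ∞ (fderiv ℝ g) := hg.fderiv_right (m := ∞) (by simp)
  have hfG : ContDiff ℝ ∞ (fderiv ℝ f ∘ G) := hf'.comp hGs
  have hfGle : ∀ i ≤ j, ‖iteratedFDeriv ℝ i (fderiv ℝ f ∘ G) p‖ ≤ j.factorial * M * D ^ i := by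
    intro i hi
    refine (norm_iteratedFDeriv_comp_le hf' hGs (natCast_le_infty i) p (C := M) (D := D)
      (fun l hl => ?_) fun l h1 h2 => hGD l h1 (h2.trans hi)).trans ?_
    · rw [norm_iteratedFDeriv_fderiv]
      exact hM _ (by omega)
    · have : (i.factorial : ℝ) ≤ j.factorial := by exact_mod_cast Nat.factorial_le hi
      gcongr
  -- The chain rule is split into the time part D f ∘ (σ, 0), carried by `L1`, and the space part
  -- D_x f ∘ D g, with D_x f extracted by `L2`. The time part involves g only up to order j.
  set L1 : (ℝ × E →L[ℝ] F) →L[ℝ] (P →L[ℝ] F) := (ContinuousLinearMap.compL ℝ P (ℝ × E) F).flip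
    ((ContinuousLinearMap.inl ℝ ℝ E).comp σ) with hL1
  set L2 : (ℝ × E →L[ℝ] F) →L[ℝ] (E →L[ℝ] F) := (ContinuousLinearMap.compL ℝ E (ℝ × E) F).flip
    (ContinuousLinearMap.inr ℝ ℝ E) with hL2
  have hL1n : ‖L1‖ ≤ 1 := by
    refine ContinuousLinearMap.opNorm_le_bound _ zero_le_one fun A => ?_
    rw [one_mul]
    refine (A.opNorm_comp_le _).trans (mul_le_of_le_one_right (norm_nonneg _) ?_)
    refine (ContinuousLinearMap.opNorm_comp_le _ _).trans ?_
    exact mul_le_one₀ (ContinuousLinearMap.norm_inl_le_one ℝ ℝ E) (norm_nonneg _) hσ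
  have hL2n : ‖L2‖ ≤ 1 := by
    refine ContinuousLinearMap.opNorm_le_bound _ zero_le_one fun A => ?_
    rw [one_mul]
    exact (A.opNorm_comp_le _).trans
      (mul_le_of_le_one_right (norm_nonneg _) (ContinuousLinearMap.norm_inr_le_one ℝ ℝ E))
  have hder : fderiv ℝ (fun q => f (σ q, g q)) = (L1 ∘ (fderiv ℝ f ∘ G)) +
      fun q => ContinuousLinearMap.compL ℝ P E F ((L2 ∘ (fderiv ℝ f ∘ G)) q) (fderiv ℝ g q) := by
    ext1 q
    have h1 : HasFDerivAt G (σ.prod (fderiv ℝ g q)) q :=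
      σ.hasFDerivAt.prodMk (hg.differentiable (by simp) q).hasFDerivAt
    have h2 : HasFDerivAt (fun q => f (σ q, g q)) ((fderiv ℝ f (G q)).comp (σ.prod (fderiv ℝ g q))) q :=
      (hf.differentiable (by simp) (G q)).hasFDerivAt.comp q h1
    rw [h2.fderiv]
    ext v
    simp only [ContinuousLinearMap.comp_apply, Pi.add_apply, Function.comp_apply, hL1, hL2,
      add_apply, ContinuousLinearMap.flip_apply, ContinuousLinearMap.compL_apply,
      ContinuousLinearMap.prod_apply, ContinuousLinearMap.inl_apply, ContinuousLinearMap.inr_apply]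
    rw [← map_add]
    simp
  have hs1 : ContDiff ℝ ∞ (L1 ∘ (fderiv ℝ f ∘ G)) := L1.contDiff.comp hfG
  have hs2 : ContDiff ℝ ∞ (L2 ∘ (fderiv ℝ f ∘ G)) := L2.contDiff.comp hfG
  have hs3 : ContDiff ℝ ∞ fun q =>
      ContinuousLinearMap.compL ℝ P E F ((L2 ∘ (fderiv ℝ f ∘ G)) q) (fderiv ℝ g q) :=
    (ContinuousLinearMap.compL ℝ P E F).isBoundedBilinearMap.contDiff.comp (hs2.prodMk hg')
  rw [← norm_iteratedFDeriv_fderiv, hder, iteratedFDeriv_add_apply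
    (hs1.of_le (natCast_le_infty j)).contDiffAt (hs3.of_le (natCast_le_infty j)).contDiffAt]
  have b1 : ‖iteratedFDeriv ℝ j (L1 ∘ (fderiv ℝ f ∘ G)) p‖ ≤ j.factorial * M * D ^ (j + 1) := by
    refine (norm_iteratedFDeriv_linear_comp_le hfG L1 j p).trans ?_
    refine (mul_le_of_le_one_left (norm_nonneg _) hL1n).trans ((hfGle j le_rfl).trans ?_)
    gcongr
    omega
  have b2 := (ContinuousLinearMap.compL ℝ P E F).norm_iteratedFDeriv_le_of_bilinear_of_le_one
    hs2 hg' p (natCast_le_infty j) (ContinuousLinearMap.norm_compL_le ℝ P E F)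
  -- The term split off has all j derivatives on D g and hence the factor D_x f, bounded by Λ. In
  -- every other term at least one derivative falls on D_x f, so g is differentiated at most j
  -- times.
  rw [Finset.sum_range_succ'] at b2
  have b3 : ∑ i ∈ Finset.range j, (j.choose (i + 1) : ℝ) *
      ‖iteratedFDeriv ℝ (i + 1) (L2 ∘ (fderiv ℝ f ∘ G)) p‖ *
        ‖iteratedFDeriv ℝ (j - (i + 1)) (fderiv ℝ g) p‖ ≤ 2 ^ j * j.factorial * M * D ^ (j + 1) := by
    calc _ ≤ ∑ i ∈ Finset.range j, (j.choose (i + 1) : ℝ) * (j.factorial * M * D ^ j) * D := by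
          refine Finset.sum_le_sum fun i hi => ?_
          have hi' := Finset.mem_range.1 hi
          have c1 : ‖iteratedFDeriv ℝ (i + 1) (L2 ∘ (fderiv ℝ f ∘ G)) p‖ ≤
              j.factorial * M * D ^ j := by
            refine (norm_iteratedFDeriv_linear_comp_le hfG L2 _ p).trans ?_
            refine (mul_le_of_le_one_left (norm_nonneg _) hL2n).trans
              ((hfGle (i + 1) (by omega)).trans ?_)
            gcongr
            omega
          have c2 : ‖iteratedFDeriv ℝ (j - (i + 1)) (fderiv ℝ g) p‖ ≤ D := by
            rw [norm_iteratedFDeriv_fderiv]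
            exact hgD _ (by omega) (by omega)
          gcongr
      _ = (∑ i ∈ Finset.range j, (j.choose (i + 1) : ℝ)) * (j.factorial * M * D ^ (j + 1)) := by
          rw [Finset.sum_mul]
          exact Finset.sum_congr rfl fun i _ => by ring
      _ ≤ 2 ^ j * (j.factorial * M * D ^ (j + 1)) := by
          gcongr
          have h1 : ∑ i ∈ Finset.range (j + 1), (j.choose i : ℝ) = 2 ^ j := by
            exact_mod_cast Nat.sum_range_choose j
          rw [Finset.sum_range_succ'] at h1
          have : (0 : ℝ) ≤ j.choose 0 := by positivity
          linarith
      _ = _ := by ring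
  have b4 : (j.choose 0 : ℝ) * ‖iteratedFDeriv ℝ 0 (L2 ∘ (fderiv ℝ f ∘ G)) p‖ *
      ‖iteratedFDeriv ℝ (j - 0) (fderiv ℝ g) p‖ ≤ Λ * ‖iteratedFDeriv ℝ (j + 1) g p‖ := by
    rw [norm_iteratedFDeriv_zero, Nat.choose_zero_right, Nat.cast_one, one_mul, Nat.sub_zero,
      norm_iteratedFDeriv_fderiv]
    exact mul_le_mul_of_nonneg_right hΛ (norm_nonneg _)
  refine (norm_add_le _ _).trans ?_
  linarith

end Composition

/-! ### Picard iteration for the flow of a vector field -/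

section Picard

variable {E : Type*} [NormedAddCommGroup E] [NormedSpace ℝ E]

/-- Picard iterates of `γ(x,t,s) = x + ∫_t^s f(r,γ(x,t,r)) dr`. -/
noncomputable def picardIter (f : ℝ × E → E) : ℕ → E × ℝ × ℝ → E
  | 0 => fun p => p.1
  | m + 1 => fun p => p.1 + flowInt (fun q => f (endTime E q, picardIter f m q)) p

/-- Bounds of a vector field for times in `[-T,T]`: `M` bounds the derivatives up to order `k` and
`Λ` the first derivative in `x`. -/
structure FieldBound (f : ℝ × E → E) (T : ℝ) (k : ℕ) (M Λ : ℝ) : Prop where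
  one_le : 1 ≤ M
  nonneg : 0 ≤ Λ
  deriv_le : ∀ t, |t| ≤ T → ∀ x, ∀ i ≤ k, ‖iteratedFDeriv ℝ i f (t, x)‖ ≤ M
  partial_le : ∀ t, |t| ≤ T → ∀ x,
    ‖(fderiv ℝ f (t, x)).comp (ContinuousLinearMap.inr ℝ ℝ E)‖ ≤ Λ

theorem FieldBound.mono {f : ℝ × E → E} {T : ℝ} {k l : ℕ} {M Λ : ℝ} (h : FieldBound f T k M Λ)
    (hl : l ≤ k) : FieldBound f T l M Λ :=
  ⟨h.one_le, h.nonneg, fun t ht x i hi => h.deriv_le t ht x i (hi.trans hl), h.partial_le⟩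

theorem FieldBound.norm_sub_le {f : ℝ × E → E} (hf : ContDiff ℝ ∞ f) {T : ℝ} {k : ℕ} {M Λ : ℝ}
    (h : FieldBound f T k M Λ) {t : ℝ} (ht : |t| ≤ T) (x y : E) :
    ‖f (t, y) - f (t, x)‖ ≤ Λ * ‖y - x‖ := by
  refine convex_univ.norm_image_sub_le_of_norm_hasFDerivWithin_le (𝕜 := ℝ)
    (f := fun x => f (t, x))
    (f' := fun x => (fderiv ℝ f (t, x)).comp (ContinuousLinearMap.inr ℝ ℝ E))
    (fun z _ => ?_) (fun z _ => h.partial_le t ht z) (Set.mem_univ x) (Set.mem_univ y)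
  exact ((hf.differentiable (by simp) (t, z)).hasFDerivAt.comp z
    (hasFDerivAt_prodMk_right t z)).hasFDerivWithinAt

variable [FiniteDimensional ℝ E] [CompleteSpace E]

theorem contDiff_picardIter {f : ℝ × E → E} (hf : ContDiff ℝ ∞ f) (m : ℕ) :
    ContDiff ℝ ∞ (picardIter f m) := by
  induction m with
  | zero => exact contDiff_fst
  | succ m ih => exact contDiff_fst.add (contDiff_flowInt (hf.comp ((endTime E).contDiff.prodMk ih)))

/-- One Picard step for the top derivative. The bound A e^{Λ|s-t|} reproduces itself under
integration because the top derivative of g carries only the factor Λ; the remaining terms depend on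
lower orders alone. -/
theorem norm_iteratedFDeriv_flowInt_field_le {f : ℝ × E → E} (hf : ContDiff ℝ ∞ f) {T : ℝ}
    {k : ℕ} {M Λ D A : ℝ} (h : FieldBound f T (k + 1) M Λ) (hD : 1 ≤ D) {g : E × ℝ × ℝ → E}
    (hg : ContDiff ℝ ∞ g) (hk : ∀ p : E × ℝ × ℝ, |p.2.1| ≤ T → |p.2.2| ≤ T → ∀ i, 1 ≤ i → i ≤ k →
      ‖iteratedFDeriv ℝ i g p‖ ≤ D)
    (hA : ∀ p : E × ℝ × ℝ, |p.2.1| ≤ T → |p.2.2| ≤ T →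
      ‖iteratedFDeriv ℝ (k + 1) g p‖ ≤ A * Real.exp (Λ * |p.2.2 - p.2.1|))
    (p : E × ℝ × ℝ) (hp1 : |p.2.1| ≤ T) (hp2 : |p.2.2| ≤ T) :
    ‖iteratedFDeriv ℝ (k + 1) (flowInt fun q => f (endTime E q, g q)) p‖ ≤
      A * (Real.exp (Λ * |p.2.2 - p.2.1|) - 1) +
        2 * T * ((k.factorial + 2 ^ k * k.factorial) * M * D ^ (k + 1)) +
        2 * (k + 1 : ℕ) * (k.factorial * M * D ^ k) := by
  have hM := zero_le_one.trans h.one_le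
  have hD0 := zero_le_one.trans hD
  have hh : ContDiff ℝ ∞ fun q => f (endTime E q, g q) := hf.comp ((endTime E).contDiff.prodMk hg)
  have hseg : ∀ θ ∈ Set.Icc (0 : ℝ) 1, |(segMap E θ p).2.2| ≤ T := fun θ hθ =>
    abs_segment_le hθ hp1 hp2
  have hseg1 : ∀ θ, |(segMap E θ p).2.1| ≤ T := fun θ => hp1
  have hseg2 : ∀ θ ∈ Set.Icc (0 : ℝ) 1,
      |(segMap E θ p).2.2 - (segMap E θ p).2.1| = θ * |p.2.2 - p.2.1| := fun θ hθ => by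
    simp [abs_mul, abs_of_nonneg hθ.1]
  have key1 : ∀ θ ∈ Set.Icc (0 : ℝ) 1,
      ‖iteratedFDeriv ℝ (k + 1) (fun q => f (endTime E q, g q)) (segMap E θ p)‖ ≤
        Λ * (A * Real.exp (Λ * (θ * |p.2.2 - p.2.1|))) +
          (k.factorial + 2 ^ k * k.factorial) * M * D ^ (k + 1) := fun θ hθ => by
    have hq1 := hseg1 θ
    have hq2 := hseg θ hθ
    have hq3 := hseg2 θ hθ
    generalize segMap E θ p = q at *
    have h1 := norm_iteratedFDeriv_field_comp_le hf hg (norm_endTime_le (E := E)) k q (M := M)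
      (Λ := Λ) hD (fun i hi => h.deriv_le (endTime E q) hq2 _ i hi)
      (h.partial_le (endTime E q) hq2 _) (hk q hq1 hq2)
    have h2 := hA q hq1 hq2
    rw [hq3] at h2
    have := mul_le_mul_of_nonneg_left h2 h.nonneg
    linarith
  have key2 : ∀ j, k + 1 = j + 1 → ∀ θ ∈ Set.Icc (0 : ℝ) 1,
      ‖iteratedFDeriv ℝ j (fun q => f (endTime E q, g q)) (segMap E θ p)‖ ≤
        k.factorial * M * D ^ k := by
    intro j hj θ hθ
    obtain rfl : k = j := Nat.succ.inj hj
    have hq1 := hseg1 θ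
    have hq2 := hseg θ hθ
    generalize segMap E θ p = q at *
    refine norm_iteratedFDeriv_comp_le (g := f) (f := fun q => (endTime E q, g q)) hf
      ((endTime E).contDiff.prodMk hg) (natCast_le_infty k) q (C := M) (D := D)
      (fun i hi => h.deriv_le (endTime E q) hq2 (g q) i (hi.trans (Nat.le_succ k))) ?_
    intro i h1 h2
    refine (norm_iteratedFDeriv_prodMk_le (endTime E).contDiff hg i _).trans (max_le ?_ ?_)
    · exact ((norm_iteratedFDeriv_linear_le (endTime E) h1 q).trans norm_endTime_le).trans
        (one_le_pow₀ hD)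
    · exact (hk q hq1 hq2 i h1 h2).trans (le_self_pow₀ hD (Nat.one_le_iff_ne_zero.1 h1))
  have key := norm_iteratedFDeriv_flowInt_le hh (k + 1) p key1 key2
  have hd : |p.2.2 - p.2.1| ≤ 2 * T := (abs_sub _ _).trans (by linarith)
  have h4 : |p.2.2 - p.2.1| * ((k.factorial + 2 ^ k * k.factorial) * M * D ^ (k + 1)) ≤
      2 * T * ((k.factorial + 2 ^ k * k.factorial) * M * D ^ (k + 1)) := by gcongr
  linarith

/-- The constant is a fixed point of the Picard step. If R collects the lower order terms, then A =
1 + R satisfies 1 + A(e^{Λ|s-t|} - 1) + R = A e^{Λ|s-t|}, so the bound does not deteriorate with m.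
-/
theorem norm_iteratedFDeriv_picardIter_succ_le {f : ℝ × E → E} (hf : ContDiff ℝ ∞ f) {T : ℝ}
    (hT : 0 ≤ T) {k : ℕ} {M Λ D : ℝ} (h : FieldBound f T (k + 1) M Λ) (hD : 1 ≤ D)
    (hk : ∀ m, ∀ p : E × ℝ × ℝ, |p.2.1| ≤ T → |p.2.2| ≤ T → ∀ i, 1 ≤ i → i ≤ k →
      ‖iteratedFDeriv ℝ i (picardIter f m) p‖ ≤ D) (m : ℕ) :
    ∀ p : E × ℝ × ℝ, |p.2.1| ≤ T → |p.2.2| ≤ T →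
    ‖iteratedFDeriv ℝ (k + 1) (picardIter f m) p‖ ≤
      (1 + 2 * T * ((k.factorial + 2 ^ k * k.factorial) * M * D ^ (k + 1)) +
        2 * (k + 1 : ℕ) * (k.factorial * M * D ^ k)) * Real.exp (Λ * |p.2.2 - p.2.1|) := by
  have hM := zero_le_one.trans h.one_le
  have hΛ := h.nonneg
  have hfst : ∀ p, ‖iteratedFDeriv ℝ (k + 1) (fun p : E × ℝ × ℝ => p.1) p‖ ≤ 1 := fun p =>
    (norm_iteratedFDeriv_linear_le (ContinuousLinearMap.fst ℝ E (ℝ × ℝ)) (by omega) p).trans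
      (ContinuousLinearMap.norm_fst_le ℝ E (ℝ × ℝ))
  induction m with
  | zero =>
    intro p _ _
    refine (hfst p).trans (one_le_mul_of_one_le_of_one_le ?_ (Real.one_le_exp (by positivity)))
    rw [add_assoc]
    exact le_add_of_nonneg_right (by positivity)
  | succ m ih =>
    intro p hp1 hp2
    have hs := contDiff_picardIter hf m
    have hh : ContDiff ℝ ∞ fun q => f (endTime E q, picardIter f m q) :=
      hf.comp ((endTime E).contDiff.prodMk hs)
    have key := norm_iteratedFDeriv_flowInt_field_le hf h hD hs (hk m) ih p hp1 hp2
    have hadd : iteratedFDeriv ℝ (k + 1) (picardIter f (m + 1)) p =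
        iteratedFDeriv ℝ (k + 1) (fun p : E × ℝ × ℝ => p.1) p +
          iteratedFDeriv ℝ (k + 1) (flowInt fun q => f (endTime E q, picardIter f m q)) p :=
      iteratedFDeriv_add_apply (contDiff_fst.of_le (natCast_le_infty _)).contDiffAt
        ((contDiff_flowInt hh).of_le (natCast_le_infty _)).contDiffAt
    rw [hadd]
    refine (norm_add_le _ _).trans ?_
    have h5 := hfst p
    linarith

/-- The derivatives of the Picard iterates are bounded by powers of the derivatives of the field and
of `e^{2TΛ}`. -/
theorem exists_norm_iteratedFDeriv_picardIter_le (E : Type*) [NormedAddCommGroup E] [NormedSpace ℝ E]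
    [FiniteDimensional ℝ E] [CompleteSpace E] {T : ℝ} (hT : 0 ≤ T) (k : ℕ) :
    ∃ (c : ℝ) (N : ℕ), 1 ≤ c ∧ ∀ f : ℝ × E → E, ContDiff ℝ ∞ f → ∀ M Λ, FieldBound f T k M Λ →
      ∀ m, ∀ p : E × ℝ × ℝ, |p.2.1| ≤ T → |p.2.2| ≤ T → ∀ i, 1 ≤ i → i ≤ k →
        ‖iteratedFDeriv ℝ i (picardIter f m) p‖ ≤ c * (M * Real.exp (2 * T * Λ)) ^ N := by
  induction k with
  | zero => exact ⟨1, 0, le_rfl, fun f _ M Λ _ m p _ _ i h1 h2 => absurd h1 (by omega)⟩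
  | succ k ih =>
    obtain ⟨c, N, hc, ih⟩ := ih
    set c0 : ℝ := 1 + 2 * T * (k.factorial + 2 ^ k * k.factorial) +
      2 * (k + 1 : ℕ) * k.factorial with hc0
    have hc01 : 1 ≤ c0 := by
      have h1 : 0 ≤ 2 * T * (k.factorial + 2 ^ k * k.factorial) := by positivity
      have h2 : (0 : ℝ) ≤ 2 * (k + 1 : ℕ) * k.factorial := by positivity
      linarith
    -- With Z = M e^{2TΛ}, the lower order bound D = c Z^N enters to the power k+1. The two
    -- additional powers of Z come from M ≤ Z and from the exponential, which is also at most Z.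
    refine ⟨c0 * c ^ (k + 1), N * (k + 1) + 2, one_le_mul_of_one_le_of_one_le hc01 (one_le_pow₀ hc),
      fun f hf M Λ h m p hp1 hp2 i h1 h2 => ?_⟩
    have hM := h.one_le
    have hΛ := h.nonneg
    set Z := M * Real.exp (2 * T * Λ) with hZ
    have hexp : 1 ≤ Real.exp (2 * T * Λ) := Real.one_le_exp (by positivity)
    have hZ1 : 1 ≤ Z := one_le_mul_of_one_le_of_one_le hM hexp
    have hMZ : M ≤ Z := le_mul_of_one_le_right (by linarith) hexp
    have heZ : Real.exp (2 * T * Λ) ≤ Z := le_mul_of_one_le_left (by positivity) hM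
    have hD : 1 ≤ c * Z ^ N := one_le_mul_of_one_le_of_one_le hc (one_le_pow₀ hZ1)
    have hold := ih f hf M Λ (h.mono (by omega))
    rcases Nat.lt_or_ge i (k + 1) with hi | hi
    · refine (hold m p hp1 hp2 i h1 (by omega)).trans ?_
      have e1 : c ≤ c0 * c ^ (k + 1) := by
        have : c ≤ c ^ (k + 1) := le_self_pow₀ hc (by omega)
        nlinarith
      have e2 : Z ^ N ≤ Z ^ (N * (k + 1) + 2) := pow_le_pow_right₀ hZ1 (by nlinarith)
      gcongr
    · obtain rfl : i = k + 1 := by omega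
      refine (norm_iteratedFDeriv_picardIter_succ_le hf hT h hD hold m p hp1 hp2).trans ?_
      set D := c * Z ^ N with hDdef
      have hd : |p.2.2 - p.2.1| ≤ 2 * T := (abs_sub _ _).trans (by linarith)
      have e1 : Real.exp (Λ * |p.2.2 - p.2.1|) ≤ Z := by
        refine (Real.exp_le_exp.2 ?_).trans heZ
        nlinarith
      have e2 : D ^ k ≤ D ^ (k + 1) := pow_le_pow_right₀ hD (by omega)
      have e3 : 1 ≤ Z * D ^ (k + 1) := one_le_mul_of_one_le_of_one_le hZ1 (one_le_pow₀ hD)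
      calc _ ≤ (1 * (Z * D ^ (k + 1)) +
            2 * T * ((k.factorial + 2 ^ k * k.factorial) * Z * D ^ (k + 1)) +
            2 * (k + 1 : ℕ) * (k.factorial * Z * D ^ (k + 1))) * Z := by
            rw [one_mul]
            gcongr
        _ = c0 * Z ^ 2 * D ^ (k + 1) := by rw [hc0]; ring
        _ = _ := by rw [hDdef]; ring

end Picard

/-! ### Gronwall's inequality on both sides of the initial time -/

section Gronwall

variable {V : Type*} [NormedAddCommGroup V] [NormedSpace ℝ V]

/-- From e^y - 1 ≤ y e^y; this removes the quotient ε/K, so that K = 0 needs no separate treatment.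
-/
theorem gronwallBound_le {δ K ε x : ℝ} (hK : 0 ≤ K) (hε : 0 ≤ ε) :
    gronwallBound δ K ε x ≤ (δ + ε * x) * Real.exp (K * x) := by
  rcases hK.eq_or_lt with rfl | hK
  · simp [gronwallBound_K0]
  · rw [gronwallBound_of_K_ne_0 hK.ne', add_mul]
    refine add_le_add_right ?_ _
    have h1 : 1 - K * x ≤ Real.exp (-(K * x)) := by linarith [Real.add_one_le_exp (-(K * x))]
    have h2 : Real.exp (K * x) - 1 ≤ K * x * Real.exp (K * x) := by
      have h3 := mul_le_mul_of_nonneg_right h1 (Real.exp_pos (K * x)).le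
      rw [← Real.exp_add] at h3
      simp at h3
      linarith
    calc ε / K * (Real.exp (K * x) - 1) ≤ ε / K * (K * x * Real.exp (K * x)) := by gcongr
      _ = ε * x * Real.exp (K * x) := by field_simp

/-- Reversal of time reduces the case s < t to the usual forward Gronwall inequality. -/
theorem norm_le_of_norm_deriv_le {g g' : ℝ → V} (hg : ∀ r, HasDerivAt g (g' r) r) {t s K δ : ℝ}
    (hK : 0 ≤ K) (hδ : 0 ≤ δ) (h : ∀ r ∈ Set.uIcc t s, ‖g' r‖ ≤ K * ‖g r‖ + δ) :
    ‖g s‖ ≤ (‖g t‖ + δ * |s - t|) * Real.exp (K * |s - t|) := by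
  wlog hts : t ≤ s generalizing g g' t s
  · have hg2 : ∀ r, HasDerivAt (fun r => g (-r)) (-g' (-r)) r := fun r => by
      simpa [Function.comp_def] using (hg (-r)).scomp r (hasDerivAt_neg r)
    have := this (t := -t) (s := -s) hg2 (fun r hr => by
      rw [norm_neg]
      refine h _ ?_
      rw [Set.mem_uIcc] at hr ⊢
      rcases hr with ⟨h1, h2⟩ | ⟨h1, h2⟩
      · exact Or.inr ⟨by linarith, by linarith⟩
      · exact Or.inl ⟨by linarith, by linarith⟩) (by linarith)
    rw [neg_neg, neg_neg, show -s - -t = -(s - t) by ring, abs_neg] at this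
    exact this
  · rw [Set.uIcc_of_le hts] at h
    rw [abs_of_nonneg (sub_nonneg.2 hts)]
    refine (norm_le_gronwallBound_of_norm_deriv_right_le (f' := g')
      (fun r _ => (hg r).continuousAt.continuousWithinAt)
      (fun r _ => (hg r).hasDerivWithinAt) le_rfl (fun r hr => h r ⟨hr.1, hr.2.le⟩) s
      ⟨hts, le_rfl⟩).trans (gronwallBound_le hK hδ)

end Gronwall

theorem flowInt_sub {E F : Type*} [NormedAddCommGroup E] [NormedAddCommGroup F] [NormedSpace ℝ F]
    {h₁ h₂ : E × ℝ × ℝ → F} (hh₁ : Continuous h₁) (hh₂ : Continuous h₂) (p : E × ℝ × ℝ) :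
    flowInt (fun q => h₁ q - h₂ q) p = flowInt h₁ p - flowInt h₂ p :=
  intervalIntegral.integral_sub (Continuous.intervalIntegrable (by fun_prop) _ _)
    (Continuous.intervalIntegrable (by fun_prop) _ _)

/-! ### The flow of a vector field with bounded derivatives -/

section Flow

variable {E : Type*} [NormedAddCommGroup E] [NormedSpace ℝ E]

/-- Time dependent smooth vector fields all of whose derivatives are bounded on bounded time
intervals. -/
structure IsBddField (f : ℝ × E → E) : Prop where
  smooth : ContDiff ℝ ∞ f
  bdd : ∀ (k : ℕ) (T : ℝ), ∃ B, ∀ t, |t| ≤ T → ∀ x, ‖iteratedFDeriv ℝ k f (t, x)‖ ≤ B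

/-- These crude constants serve only qualitative statements about a single field. Growth in ε is
tracked by `CoeffNet.exists_fieldBound`, where Λ has to be logarithmic. -/
theorem IsBddField.exists_fieldBound {f : ℝ × E → E} (hf : IsBddField f) (T : ℝ) (k : ℕ) :
    ∃ M Λ, FieldBound f T k M Λ := by
  choose B hB using fun k => hf.bdd k T
  have hpar : ∀ t, |t| ≤ T → ∀ x,
      ‖(fderiv ℝ f (t, x)).comp (ContinuousLinearMap.inr ℝ ℝ E)‖ ≤ |B 1| := fun t ht x => by
    refine (ContinuousLinearMap.opNorm_comp_le _ _).trans ?_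
    refine (mul_le_of_le_one_right (norm_nonneg _)
      (ContinuousLinearMap.norm_inr_le_one ℝ ℝ E)).trans ?_
    rw [← norm_iteratedFDeriv_one]
    exact (hB 1 t ht x).trans (le_abs_self _)
  refine ⟨1 + ∑ i ∈ Finset.range (k + 1), |B i|, |B 1|, ?_, abs_nonneg _, fun t ht x i hi => ?_,
    hpar⟩
  · exact le_add_of_nonneg_right (Finset.sum_nonneg fun i _ => abs_nonneg _)
  · refine (hB i t ht x).trans ((le_abs_self _).trans ?_)
    have := Finset.single_le_sum (f := fun i => |B i|) (fun i _ => abs_nonneg (B i))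
      (Finset.mem_range.2 (Nat.lt_succ_of_le hi))
    linarith

/-- The flow of `f`, the solution of `∂_s γ = f(s, γ)`, `γ(x,t,t) = x`. -/
noncomputable def flow (f : ℝ × E → E) (p : E × ℝ × ℝ) : E :=
  haveI : Nonempty E := ⟨0⟩
  limUnder atTop fun m => picardIter f m p

theorem norm_flowInt_le [FiniteDimensional ℝ E] {F : Type*} [NormedAddCommGroup F] [NormedSpace ℝ F] [CompleteSpace F]
    {h : E × ℝ × ℝ → F} (hh : ContDiff ℝ ∞ h) (p : E × ℝ × ℝ) {A Λ R : ℝ}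
    (hk : ∀ θ ∈ Set.Icc (0 : ℝ) 1, ‖h (segMap E θ p)‖ ≤
      Λ * (A * Real.exp (Λ * (θ * |p.2.2 - p.2.1|))) + R) :
    ‖flowInt h p‖ ≤ A * (Real.exp (Λ * |p.2.2 - p.2.1|) - 1) + |p.2.2 - p.2.1| * R := by
  have := norm_iteratedFDeriv_flowInt_le hh 0 p (A := A) (Λ := Λ) (R := R) (R' := 0)
    (by simpa only [norm_iteratedFDeriv_zero] using hk) (fun j hj => absurd hj (by omega))
  simpa using this

variable [FiniteDimensional ℝ E] [CompleteSpace E] {f : ℝ × E → E}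

theorem contDiff_field_picardIter (hf : ContDiff ℝ ∞ f) (m : ℕ) :
    ContDiff ℝ ∞ fun q => f (endTime E q, picardIter f m q) :=
  hf.comp ((endTime E).contDiff.prodMk (contDiff_picardIter hf m))

theorem norm_picardIter_sub_fst_le (hf : ContDiff ℝ ∞ f) {T : ℝ} {k : ℕ} {M Λ : ℝ}
    (h : FieldBound f T k M Λ) (m : ℕ) (p : E × ℝ × ℝ) (hp1 : |p.2.1| ≤ T) (hp2 : |p.2.2| ≤ T) :
    ‖picardIter f m p - p.1‖ ≤ 2 * T * M := by
  have hM := zero_le_one.trans h.one_le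
  have hT := (abs_nonneg _).trans hp1
  rcases m with _ | m
  · simp only [picardIter, sub_self, norm_zero]
    positivity
  · simp only [picardIter, add_sub_cancel_left]
    refine (norm_flowInt_le (contDiff_field_picardIter hf m) p (A := 0) (Λ := 0) (R := M)
      fun θ hθ => ?_).trans ?_
    · have := h.deriv_le _ (abs_segment_le hθ hp1 hp2) (picardIter f m (segMap E θ p)) 0
        (Nat.zero_le k)
      rw [norm_iteratedFDeriv_zero] at this
      simpa using this
    · have hd : |p.2.2 - p.2.1| ≤ 2 * T := (abs_sub _ _).trans (by linarith)
      simp only [zero_mul, zero_add]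
      gcongr

/-- In the norm with weight e^{2Λ|s-t|} the Picard map contracts by 1/2, because integrating Λ
e^{2Λr} costs only Λ/(2Λ). Thus no smallness of the time interval is needed. -/
theorem norm_picardIter_succ_sub_le (hf : ContDiff ℝ ∞ f) {T : ℝ} {k : ℕ} {M Λ : ℝ}
    (h : FieldBound f T k M Λ) (m : ℕ) : ∀ p : E × ℝ × ℝ, |p.2.1| ≤ T → |p.2.2| ≤ T →
    ‖picardIter f (m + 1) p - picardIter f m p‖ ≤
      2 * T * M * (1 / 2) ^ m * Real.exp (2 * Λ * |p.2.2 - p.2.1|) := by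
  have hM := zero_le_one.trans h.one_le
  have hΛ := h.nonneg
  induction m with
  | zero =>
    intro p hp1 hp2
    have hT := (abs_nonneg _).trans hp1
    refine (norm_picardIter_sub_fst_le hf h 1 p hp1 hp2).trans ?_
    rw [pow_zero, mul_one]
    exact le_mul_of_one_le_right (by positivity) (Real.one_le_exp (by positivity))
  | succ m ih =>
    intro p hp1 hp2
    have hT := (abs_nonneg _).trans hp1
    have h1 := contDiff_field_picardIter hf (m + 1)
    have h2 := contDiff_field_picardIter hf m
    have h3 : picardIter f (m + 1 + 1) p - picardIter f (m + 1) p =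
        flowInt (fun q => f (endTime E q, picardIter f (m + 1) q) -
          f (endTime E q, picardIter f m q)) p := by
      rw [flowInt_sub h1.continuous h2.continuous]
      exact add_sub_add_left_eq_sub _ _ _
    rw [h3]
    refine (norm_flowInt_le (h1.sub h2) p (A := 2 * T * M * (1 / 2) ^ (m + 1)) (Λ := 2 * Λ) (R := 0)
      fun θ hθ => ?_).trans ?_
    · have hq2 := abs_segment_le hθ hp1 hp2
      have := (h.norm_sub_le hf hq2 (picardIter f m (segMap E θ p))
        (picardIter f (m + 1) (segMap E θ p))).trans
          (mul_le_mul_of_nonneg_left (ih (segMap E θ p) hp1 hq2) hΛ)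
      refine this.trans (le_of_eq ?_)
      have h5 : |(segMap E θ p).2.2 - (segMap E θ p).2.1| = θ * |p.2.2 - p.2.1| := by
        simp [abs_mul, abs_of_nonneg hθ.1]
      rw [h5]
      ring
    · have : 0 ≤ 2 * T * M * (1 / 2) ^ (m + 1) := by positivity
      linarith

theorem cauchySeq_picardIter_and_bound (hf : IsBddField f) (T : ℝ) :
    ∃ C, ∀ p : E × ℝ × ℝ, |p.2.1| ≤ T → |p.2.2| ≤ T → ∀ m,
      dist (picardIter f m p) (picardIter f (m + 1) p) ≤ C * (1 / 2) ^ m := by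
  obtain ⟨M, Λ, h⟩ := hf.exists_fieldBound T 0
  refine ⟨2 * T * M * Real.exp (2 * Λ * (2 * T)), fun p hp1 hp2 m => ?_⟩
  have hM := zero_le_one.trans h.one_le
  have hΛ := h.nonneg
  have hT := (abs_nonneg _).trans hp1
  have hd : |p.2.2 - p.2.1| ≤ 2 * T := (abs_sub _ _).trans (by linarith)
  rw [dist_comm, dist_eq_norm]
  refine (norm_picardIter_succ_sub_le hf.smooth h m p hp1 hp2).trans ?_
  rw [mul_right_comm]
  gcongr

theorem tendsto_picardIter (hf : IsBddField f) (p : E × ℝ × ℝ) :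
    Tendsto (fun m => picardIter f m p) atTop (𝓝 (flow f p)) := by
  obtain ⟨C, hC⟩ := cauchySeq_picardIter_and_bound hf (max |p.2.1| |p.2.2|)
  have hN : Nonempty E := ⟨0⟩
  have h : CauchySeq fun m => picardIter f m p := cauchySeq_of_le_geometric (1 / 2) C (by norm_num)
    (hC p (le_max_left _ _) (le_max_right _ _))
  exact tendsto_nhds_limUnder (cauchySeq_tendsto_of_complete h)

theorem tendstoUniformlyOn_picardIter (hf : IsBddField f) (R : ℝ) :
    TendstoUniformlyOn (picardIter f) (flow f) atTop (Metric.ball 0 R) := by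
  obtain ⟨C, hC⟩ := cauchySeq_picardIter_and_bound hf R
  rw [Metric.tendstoUniformlyOn_iff]
  intro δ hδ
  have h0 : Tendsto (fun m : ℕ => C * (1 / 2) ^ m / (1 - 1 / 2)) atTop (𝓝 0) := by
    have := (tendsto_pow_atTop_nhds_zero_of_lt_one (r := (1 / 2 : ℝ)) (by norm_num)
      (by norm_num)).const_mul C
    simpa using this.div_const (1 - 1 / 2)
  filter_upwards [h0.eventually (gt_mem_nhds hδ)] with m hm p hp
  have hp' : ‖p‖ ≤ R := (mem_ball_zero_iff.1 hp).le
  have hp1 : |p.2.1| ≤ R := ((norm_fst_le p.2).trans (norm_snd_le p)).trans hp'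
  have hp2 : |p.2.2| ≤ R := ((norm_snd_le p.2).trans (norm_snd_le p)).trans hp'
  rw [dist_comm]
  exact (dist_le_of_le_geometric_of_tendsto (1 / 2) C (by norm_num) (hC p hp1 hp2)
    (tendsto_picardIter hf p) m).trans_lt hm

/-- Locally uniform convergence together with derivative bounds uniform in m gives smooth dependence
on all variables without a linearised equation. The convergence of derivatives also carries the
quantitative bounds over to the flow. -/
theorem flow_aux (hf : IsBddField f) : ContDiff ℝ ∞ (flow f) ∧ ∀ k p,
    Tendsto (fun m => iteratedFDeriv ℝ k (picardIter f m) p) atTop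
      (𝓝 (iteratedFDeriv ℝ k (flow f) p)) := by
  refine contDiff_of_tendsto_of_bounded (contDiff_picardIter hf.smooth)
    (fun R => (tendstoUniformlyOn_picardIter hf R).uniformCauchySeqOn) (fun k R => ?_)
    (tendsto_picardIter hf)
  obtain ⟨c, N, -, hc⟩ := exists_norm_iteratedFDeriv_picardIter_le E (abs_nonneg R) k
  obtain ⟨M, Λ, h⟩ := hf.exists_fieldBound |R| k
  have hM := zero_le_one.trans h.one_le
  refine ⟨max (|R| + 2 * |R| * M) (c * (M * Real.exp (2 * |R| * Λ)) ^ N), fun m p hp => ?_⟩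
  have hp' : ‖p‖ ≤ |R| := (mem_ball_zero_iff.1 hp).le.trans (le_abs_self R)
  have hp1 : |p.2.1| ≤ |R| := ((norm_fst_le p.2).trans (norm_snd_le p)).trans hp'
  have hp2 : |p.2.2| ≤ |R| := ((norm_snd_le p.2).trans (norm_snd_le p)).trans hp'
  rcases Nat.eq_zero_or_pos k with rfl | hk
  · refine le_max_of_le_left ?_
    rw [norm_iteratedFDeriv_zero]
    have h1 := norm_picardIter_sub_fst_le hf.smooth h m p hp1 hp2
    have h2 := norm_add_le (picardIter f m p - p.1) p.1
    rw [sub_add_cancel] at h2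
    linarith [norm_fst_le p]
  · exact le_max_of_le_right (hc f hf.smooth M Λ h m p hp1 hp2 k hk le_rfl)

theorem contDiff_flow (hf : IsBddField f) : ContDiff ℝ ∞ (flow f) := (flow_aux hf).1

/-- The derivatives of the flow are bounded by powers of the derivatives of the field and of
`e^{2TΛ}`. -/
theorem exists_norm_iteratedFDeriv_flow_le (E : Type*) [NormedAddCommGroup E] [NormedSpace ℝ E]
    [FiniteDimensional ℝ E] [CompleteSpace E] {T : ℝ} (hT : 0 ≤ T) (k : ℕ) :
    ∃ (c : ℝ) (N : ℕ), 1 ≤ c ∧ ∀ f : ℝ × E → E, IsBddField f → ∀ M Λ, FieldBound f T k M Λ →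
      ∀ p : E × ℝ × ℝ, |p.2.1| ≤ T → |p.2.2| ≤ T → ∀ i, 1 ≤ i → i ≤ k →
        ‖iteratedFDeriv ℝ i (flow f) p‖ ≤ c * (M * Real.exp (2 * T * Λ)) ^ N := by
  obtain ⟨c, N, hc1, hc⟩ := exists_norm_iteratedFDeriv_picardIter_le E hT k
  exact ⟨c, N, hc1, fun f hf M Λ h p hp1 hp2 i h1 h2 =>
    le_of_tendsto ((flow_aux hf).2 i p).norm
      (Eventually.of_forall fun m => hc f hf.smooth M Λ h m p hp1 hp2 i h1 h2)⟩

/-- The recursion passes to the limit by dominated convergence, the sup bound of the field on the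
strip being a dominating constant. -/
theorem flow_eq (hf : IsBddField f) (p : E × ℝ × ℝ) :
    flow f p = p.1 + flowInt (fun q => f (endTime E q, flow f q)) p := by
  refine tendsto_nhds_unique ((tendsto_picardIter hf p).comp (tendsto_add_atTop_nat 1)) ?_
  refine tendsto_const_nhds.add ?_
  set T := max |p.2.1| |p.2.2| with hT
  obtain ⟨M, Λ, h⟩ := hf.exists_fieldBound T 0
  refine intervalIntegral.tendsto_integral_filter_of_dominated_convergence (fun _ => M)
    (Eventually.of_forall fun m => ?_) (Eventually.of_forall fun m => Eventually.of_forall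
      fun r hr => ?_) (by simp) (Eventually.of_forall fun r _ => ?_)
  · have := (contDiff_field_picardIter hf.smooth m).continuous
    exact (this.comp (by fun_prop : Continuous fun r : ℝ =>
      (p.1, p.2.1, r))).aestronglyMeasurable
  · have hr' : |r| ≤ T := by
      have h1 := Set.uIoc_subset_uIcc hr
      rw [Set.mem_uIcc] at h1
      have a1 := neg_abs_le p.2.1
      have a2 := le_abs_self p.2.1
      have a3 := neg_abs_le p.2.2
      have a4 := le_abs_self p.2.2
      have a5 : |p.2.1| ≤ T := le_max_left _ _
      have a6 : |p.2.2| ≤ T := le_max_right _ _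
      rw [abs_le]
      rcases h1 with ⟨h1, h2⟩ | ⟨h1, h2⟩ <;> constructor <;> linarith
    have := h.deriv_le r hr' (picardIter f m (p.1, p.2.1, r)) 0 le_rfl
    rw [norm_iteratedFDeriv_zero] at this
    exact this
  · have h1 := tendsto_picardIter hf (p.1, p.2.1, r)
    exact ((hf.smooth.continuous.comp (Continuous.prodMk_right r)).tendsto _).comp h1

theorem flow_self (hf : IsBddField f) (x : E) (t : ℝ) : flow f (x, t, t) = x := by
  rw [flow_eq hf]
  simp [flowInt]

theorem hasDerivAt_flow (hf : IsBddField f) (x : E) (t s : ℝ) :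
    HasDerivAt (fun s => flow f (x, t, s)) (f (s, flow f (x, t, s))) s := by
  have h1 : (fun s => flow f (x, t, s)) = fun s =>
      x + ∫ r in t..s, f (r, flow f (x, t, r)) := funext fun s => flow_eq hf (x, t, s)
  rw [h1]
  have hc : Continuous fun r => f (r, flow f (x, t, r)) :=
    hf.smooth.continuous.comp (continuous_id.prodMk
      ((contDiff_flow hf).continuous.comp (by fun_prop)))
  have := (hc.integral_hasStrictDerivAt t s).hasDerivAt.const_add x
  convert this using 1

/-- Gronwall for the difference of two integral curves that agree at time t. The group law
`flow_flow` is a consequence. -/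
theorem eq_flow (hf : IsBddField f) {α : ℝ → E} (hα : ∀ r, HasDerivAt α (f (r, α r)) r) (t s : ℝ) :
    α s = flow f (α t, t, s) := by
  obtain ⟨M, Λ, h⟩ := hf.exists_fieldBound (max |t| |s|) 0
  have := norm_le_of_norm_deriv_le (fun r => (hα r).sub (hasDerivAt_flow hf (α t) t r))
    (t := t) (s := s) h.nonneg le_rfl (fun r hr => by
      rw [add_zero]
      refine h.norm_sub_le hf.smooth ?_ _ _
      rw [Set.mem_uIcc] at hr
      have a1 := neg_abs_le t
      have a2 := le_abs_self t
      have a3 := neg_abs_le s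
      have a4 := le_abs_self s
      have a5 := le_max_left |t| |s|
      have a6 := le_max_right |t| |s|
      rw [abs_le]
      rcases hr with ⟨h1, h2⟩ | ⟨h1, h2⟩ <;> constructor <;> linarith)
  simp only [Pi.sub_apply, flow_self hf, sub_self, norm_zero, zero_mul, add_zero] at this
  exact sub_eq_zero.1 (norm_le_zero_iff.1 this)

theorem flow_flow (hf : IsBddField f) (x : E) (t s r : ℝ) :
    flow f (flow f (x, t, s), s, r) = flow f (x, t, r) :=
  (eq_flow hf (hasDerivAt_flow hf x t) s r).symm

/-- The flow is constant along the characteristics. -/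
theorem fderiv_flow_transport (hf : IsBddField f) (x : E) (t s : ℝ) :
    fderiv ℝ (flow f) (x, t, s) (f (t, x), 1, 0) = 0 := by
  have h1 : HasDerivAt (fun r => (flow f (x, t, r), r, s)) (f (t, x), (1 : ℝ), (0 : ℝ)) t := by
    have h2 := hasDerivAt_flow hf x t t
    rw [flow_self hf] at h2
    exact h2.prodMk ((hasDerivAt_id t).prodMk (hasDerivAt_const t s))
  have h3 : HasFDerivAt (flow f) (fderiv ℝ (flow f) (x, t, s)) (flow f (x, t, t), t, s) := by
    rw [flow_self hf]
    exact ((contDiff_flow hf).differentiable (by simp) _).hasFDerivAt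
  have h4 := h3.comp_hasDerivAt t h1
  -- By the group law the flow to time s is the same from every point of one characteristic.
  -- Differentiating this constant at r = t gives the transport equation.
  have h5 : (flow f ∘ fun r => (flow f (x, t, r), r, s)) = fun _ => flow f (x, t, s) :=
    funext fun r => flow_flow hf x t r s
  rw [h5] at h4
  exact h4.unique (hasDerivAt_const t _)

/-- Points outside the ball of radius R are stationary. A characteristic found there at time s was
therefore there at time t, so its norm equals that of x. -/
theorem norm_flow_le (hf : IsBddField f) {R : ℝ} (hR : ∀ t x, R < ‖x‖ → f (t, x) = 0)
    (x : E) (t s : ℝ) : ‖flow f (x, t, s)‖ ≤ max ‖x‖ R := by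
  by_contra! h
  have h1 : R < ‖flow f (x, t, s)‖ := (le_max_right _ _).trans_lt h
  have h2 := eq_flow hf (α := fun _ => flow f (x, t, s))
    (fun r => by rw [hR r _ h1]; exact hasDerivAt_const r _) s t
  rw [flow_flow hf, flow_self hf] at h2
  rw [h2] at h
  exact absurd (le_max_left ‖x‖ R) (not_le.2 h)

end Flow

/-! ### Representatives -/

section Instances

variable {X : Type*} [NormedAddCommGroup X] [NormedSpace ℝ X]

instance : CommRing (G X) := Ideal.Quotient.commRing (negligible X)
instance : Ring (G X) := CommRing.toRing
instance : AddCommGroup (G X) := Ring.toAddCommGroup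
instance : AddCommMonoid (G X) := AddCommGroup.toAddCommMonoid
instance : Add (G X) := Distrib.toAdd
instance : Mul (G X) := Distrib.toMul
instance : Sub (G X) := Ring.toSub
instance : Neg (G X) := Ring.toNeg
instance : Zero (G X) := MulZeroClass.toZero
instance : One (G X) := AddMonoidWithOne.toOne

end Instances

section Rep

variable {X Y : Type*} [NormedAddCommGroup X] [NormedSpace ℝ X] [NormedAddCommGroup Y]
  [NormedSpace ℝ Y] {U V : Eps → X → ℂ} {u v : G X}

theorem IsRep.mem (h : IsRep U u) : U ∈ moderate X := h.1

theorem IsRep.contDiff (h : IsRep U u) (ε : Eps) : ContDiff ℝ ∞ (U ε) := h.1.1 ε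

theorem isRep_mk (h : U ∈ moderate X) : IsRep U (Ideal.Quotient.mk (negligible X) ⟨U, h⟩) :=
  ⟨h, rfl⟩

theorem exists_isRep (u : G X) : ∃ U, IsRep U u := by
  obtain ⟨⟨U, hU⟩, rfl⟩ := Ideal.Quotient.mk_surjective u
  exact ⟨U, isRep_mk hU⟩

theorem IsRep.eq_iff (hU : IsRep U u) (hV : IsRep V v) :
    u = v ↔ NegligibleBoundOn Set.univ (U - V) := by
  obtain ⟨hU, rfl⟩ := hU
  obtain ⟨hV, rfl⟩ := hV
  rw [Ideal.Quotient.eq]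
  exact Iff.rfl

theorem IsRep.unique (hU : IsRep U u) (hV : IsRep U v) : u = v := by
  obtain ⟨hU, rfl⟩ := hU
  obtain ⟨hV, rfl⟩ := hV
  rfl

theorem IsRep.of_negligible (hU : IsRep U u) (hV : V ∈ moderate X)
    (h : NegligibleBoundOn Set.univ (V - U)) : IsRep V u :=
  ((isRep_mk hV).eq_iff hU).2 h ▸ isRep_mk hV

theorem IsRep.add (hU : IsRep U u) (hV : IsRep V v) : IsRep (U + V) (u + v) := by
  obtain ⟨hU, rfl⟩ := hU
  obtain ⟨hV, rfl⟩ := hV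
  exact ⟨add_mem hU hV, rfl⟩

theorem IsRep.sub (hU : IsRep U u) (hV : IsRep V v) : IsRep (U - V) (u - v) := by
  obtain ⟨hU, rfl⟩ := hU
  obtain ⟨hV, rfl⟩ := hV
  exact ⟨sub_mem hU hV, rfl⟩

theorem IsRep.neg (hU : IsRep U u) : IsRep (-U) (-u) := by
  obtain ⟨hU, rfl⟩ := hU
  exact ⟨neg_mem hU, rfl⟩

theorem IsRep.mul (hU : IsRep U u) (hV : IsRep V v) : IsRep (U * V) (u * v) := by
  obtain ⟨hU, rfl⟩ := hU
  obtain ⟨hV, rfl⟩ := hV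
  exact ⟨mul_mem hU hV, rfl⟩

theorem IsRep.smul (c : ℂ) (hU : IsRep U u) : IsRep (c • U) (c • u) := by
  obtain ⟨hU, rfl⟩ := hU
  exact ⟨Subalgebra.smul_mem _ hU c, rfl⟩

theorem isRep_zero : IsRep (0 : Eps → X → ℂ) 0 := ⟨zero_mem _, rfl⟩

theorem isRep_one : IsRep (1 : Eps → X → ℂ) 1 := ⟨one_mem _, rfl⟩

theorem IsRep.sum {ι : Type*} (s : Finset ι) {U : ι → Eps → X → ℂ} {u : ι → G X}
    (h : ∀ i, IsRep (U i) (u i)) : IsRep (∑ i ∈ s, U i) (∑ i ∈ s, u i) := by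
  classical
  induction s using Finset.induction_on with
  | empty => exact isRep_zero
  | insert i s hi ih =>
    rw [Finset.sum_insert hi, Finset.sum_insert hi]
    exact (h i).add ih

theorem IsRep.pd (w : X) (hU : IsRep U u) : IsRep (fun ε x => fderiv ℝ (U ε) x w) (pd w u) := by
  obtain ⟨hU, rfl⟩ := hU
  exact ⟨dirDeriv_mem_moderate w hU, rfl⟩

theorem IsRep.D (w : X) (hU : IsRep U u) :
    IsRep (fun ε x => -Complex.I * fderiv ℝ (U ε) x w) (D w u) :=
  (hU.pd w).smul (-Complex.I)

theorem IsRep.pull (L : Y →L[ℝ] X) (hU : IsRep U u) : IsRep (fun ε => U ε ∘ L) (pull L u) := by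
  obtain ⟨hU, rfl⟩ := hU
  exact ⟨pull_mem_moderate L hU, rfl⟩

theorem isRep_ofSmooth {f : X → ℂ} (hf : ContDiff ℝ ∞ f) : IsRep (fun _ => f) (ofSmooth f hf) :=
  ⟨_, rfl⟩

theorem eps_pow_le_one (ε : Eps) (q : ℕ) : (ε : ℝ) ^ q ≤ 1 := pow_le_one₀ ε.2.1.le ε.2.2

/-- A moderate net with negligible values is negligible. -/
theorem negligible_of_zero_order [FiniteDimensional ℝ X] (hU : U ∈ moderate X)
    (h : ∀ K : Set X, IsCompact K → ∀ q : ℕ, ∃ C : ℝ, ∀ᶠ ε in toZero, ∀ x ∈ K,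
      ‖U ε x‖ ≤ C * (ε : ℝ) ^ q) : NegligibleBoundOn Set.univ U := by
  have : ProperSpace X := FiniteDimensional.proper ℝ X
  suffices H : ∀ k : ℕ, ∀ K : Set X, IsCompact K → ∀ q : ℕ, ∃ C : ℝ, ∀ᶠ ε in toZero, ∀ x ∈ K,
      ‖iteratedFDeriv ℝ k (U ε) x‖ ≤ C * (ε : ℝ) ^ q from fun K hK _ k q => H k K hK q
  intro k
  induction k with
  | zero => simpa only [norm_iteratedFDeriv_zero] using h
  | succ k ih =>
    intro K hK q
    have hK1 : IsCompact (Metric.cthickening 1 K) := hK.cthickening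
    obtain ⟨N, C', h1⟩ := hU.2 _ hK1 (k + 2)
    -- Interpolation with step h = ε^{q+N}: the k-th derivatives, of size ε^{2q+N}, divided by h
    -- give ε^q, and h times the moderate bound ε^{-N} of order k+2 gives ε^q as well.
    obtain ⟨C, h2⟩ := ih _ hK1 (q + (q + N))
    refine ⟨2 * C + C', ?_⟩
    filter_upwards [h1, h2] with ε h1 h2 x hx
    have hε := ε.2.1
    have hb : ∀ y ∈ Metric.closedBall x ((ε : ℝ) ^ (q + N)), y ∈ Metric.cthickening 1 K :=
      fun y hy => Metric.cthickening_mono (eps_pow_le_one ε _) K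
        (Metric.closedBall_subset_cthickening hx _ hy)
    refine (norm_iteratedFDeriv_succ_le_interpolation (hU.1 ε) k (pow_pos hε (q + N))
      (fun y hy => h2 y (hb y hy)) (fun y hy => h1 y (hb y hy))).trans (le_of_eq ?_)
    rw [pow_add _ q (q + N), pow_add _ q N, inv_pow]
    field_simp

/-- Each point off the support has a neighbourhood on which some representative is negligible. The
given representative differs from it by a negligible net, and finitely many such neighbourhoods
cover a compact set. -/
theorem IsRep.negligible_compl_gsupport [FiniteDimensional ℝ X] (hU : IsRep U u) :
    NegligibleBoundOn (gsupport u)ᶜ U := by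
  have : ProperSpace X := FiniteDimensional.proper ℝ X
  intro K hK hKV k q
  refine hK.induction_on (p := fun s => ∃ C : ℝ, ∀ᶠ ε in toZero, ∀ x ∈ s,
    ‖iteratedFDeriv ℝ k (U ε) x‖ ≤ C * (ε : ℝ) ^ q) ⟨0, by simp⟩ ?_ ?_ ?_
  · rintro s t hst ⟨C, h⟩
    exact ⟨C, h.mono fun ε h x hx => h x (hst hx)⟩
  · rintro s t ⟨C, h⟩ ⟨C', h'⟩
    refine ⟨max C C', ?_⟩
    filter_upwards [h, h'] with ε h h' x hx
    have hε : (0 : ℝ) ≤ (ε : ℝ) ^ q := pow_nonneg ε.2.1.le q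
    rcases hx with hx | hx
    · exact (h x hx).trans (mul_le_mul_of_nonneg_right (le_max_left _ _) hε)
    · exact (h' x hx).trans (mul_le_mul_of_nonneg_right (le_max_right _ _) hε)
  · intro x hx
    have h1 := hKV hx
    simp only [gsupport, Set.mem_compl_iff, Set.mem_ofPred_eq, not_forall, not_not] at h1
    obtain ⟨V, hV, hxV, W, hW, hWn⟩ := h1
    obtain ⟨K', hK', hK'V, hc⟩ := local_compact_nhds (hV.mem_nhds hxV)
    refine ⟨K', mem_nhdsWithin_of_mem_nhds hK', ?_⟩
    have h2 := (hU.eq_iff hW).1 rfl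
    have h3 := NegligibleBoundOn.add (V := V) (hU.sub hW).contDiff hW.contDiff
      (fun K hK _ => h2 K hK (Set.subset_univ _)) hWn
    rw [sub_add_cancel] at h3
    exact h3 K' hc hK'V k q

/-- Cutting off a representative near the support. -/
theorem IsRep.cutoff [FiniteDimensional ℝ X] (hU : IsRep U u) {χ : X → ℂ} (hχ : ContDiff ℝ ∞ χ)
    {W : Set X} (hW : IsOpen W) (hs : gsupport u ⊆ W) (h1 : ∀ x ∈ W, χ x = 1) :
    IsRep (fun ε x => χ x * U ε x) u := by
  have hχm := moderateBound_smooth hχ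
  have hm : (fun ε x => χ x * U ε x) ∈ moderate X :=
    ⟨fun ε => hχ.mul (hU.contDiff ε), hχm.mul (fun _ => hχ) hU.contDiff hU.mem.2⟩
  refine hU.of_negligible hm ?_
  have hχ' : ContDiff ℝ ∞ fun x => χ x - 1 := hχ.sub contDiff_const
  have hn := NegligibleBoundOn.mul_left (V := (gsupport u)ᶜ) (fun _ => hχ') hU.contDiff
    (moderateBound_smooth hχ') hU.negligible_compl_gsupport
  have he : (fun ε x => χ x * U ε x) - U = (fun _ : Eps => fun x => χ x - 1) * U := by
    ext ε x
    simp only [Pi.sub_apply, Pi.mul_apply]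
    ring
  rw [he]
  intro K hK _ k q
  -- On the open set W the net (χ-1)U vanishes identically, with all derivatives. The rest K \ W is
  -- compact and misses the support, so U is negligible there.
  obtain ⟨C, hC⟩ := hn (K \ W) (hK.diff hW) (fun x hx hx' => hx.2 (hs hx')) k q
  refine ⟨max C 0, ?_⟩
  filter_upwards [hC] with ε hC x hx
  by_cases hxW : x ∈ W
  · have : (fun x => ((fun _ : Eps => fun x => χ x - 1) * U) ε x) =ᶠ[𝓝 x] fun _ => 0 := by
      filter_upwards [hW.mem_nhds hxW] with y hy
      simp [h1 y hy]
    have h0 := (this.iteratedFDeriv ℝ k).eq_of_nhds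
    rw [iteratedFDeriv_fun_zero] at h0
    change ‖iteratedFDeriv ℝ k (fun x => ((fun _ : Eps => fun x => χ x - 1) * U) ε x) x‖ ≤ _
    rw [h0]
    have hε : (0 : ℝ) ≤ (ε : ℝ) ^ q := pow_nonneg ε.2.1.le q
    simp
    positivity
  · refine (hC x ⟨hx, hxW⟩).trans ?_
    exact mul_le_mul_of_nonneg_right (le_max_left _ _) (pow_nonneg ε.2.1.le q)

end Rep

/-- A smooth cutoff function on `ℝⁿ`. -/
theorem exists_cutoff {n : ℕ} {K : Set (Sp n)} (hK : IsCompact K) :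
    ∃ (R : ℝ) (χ : Sp n → ℝ), 0 ≤ R ∧ ContDiff ℝ ∞ χ ∧ K ⊆ Metric.ball 0 R ∧
      (∀ x ∈ Metric.ball (0 : Sp n) R, χ x = 1) ∧ ∀ x, R + 1 < ‖x‖ → χ x = 0 := by
  obtain ⟨R, hR⟩ := hK.isBounded.subset_ball 0
  let χ : ContDiffBump (0 : Sp n) := ⟨max R 1, max R 1 + 1, by positivity, by linarith⟩
  refine ⟨max R 1, χ, by positivity, χ.contDiff, hR.trans (Metric.ball_subset_ball (le_max_left _ _)),
    fun x hx => χ.one_of_mem_closedBall (Metric.ball_subset_closedBall hx), fun x hx => ?_⟩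
  exact χ.zero_of_le_dist (by rw [dist_zero_right]; exact hx.le)

/-! ### Scales of growth -/

/-- A class of nets of real numbers, used to measure growth as `ε → 0`. -/
structure IsScale (S : Set (Eps → ℝ)) : Prop where
  const_mem : ∀ c : ℝ, (fun _ => c) ∈ S
  add_mem : ∀ {r q}, r ∈ S → q ∈ S → (fun ε => r ε + q ε) ∈ S
  mul_mem : ∀ {r q}, r ∈ S → q ∈ S → (fun ε => r ε * q ε) ∈ S
  mono : ∀ {r q}, r ∈ S → (∀ᶠ ε in toZero, |q ε| ≤ |r ε|) → q ∈ S

/-- The nets of polynomial growth in `ε⁻¹`. -/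
def modScale : Set (Eps → ℝ) :=
  {r | ∃ (N : ℕ) (C : ℝ), ∀ᶠ ε in toZero, |r ε| ≤ C * ((ε : ℝ)⁻¹) ^ N}

/-- The slow scale nets. -/
def slowScale : Set (Eps → ℝ) := {r | SlowScale r}

theorem inv_eps_pos (ε : Eps) : 0 < (ε : ℝ)⁻¹ := zero_lt_one.trans_le (one_le_inv_eps ε)

theorem inv_eps_pow_le {N M : ℕ} (h : N ≤ M) (ε : Eps) : ((ε : ℝ)⁻¹) ^ N ≤ ((ε : ℝ)⁻¹) ^ M :=
  pow_le_pow_right₀ (one_le_inv_eps ε) h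

theorem isScale_modScale : IsScale modScale where
  const_mem c := ⟨0, |c|, by simp⟩
  add_mem := by
    rintro r q ⟨N, C, h⟩ ⟨M, D, h'⟩
    refine ⟨N + M, |C| + |D|, ?_⟩
    filter_upwards [h, h'] with ε h h'
    have h1 : |r ε| ≤ |C| * ((ε : ℝ)⁻¹) ^ (N + M) := h.trans (mul_le_mul (le_abs_self C)
      (inv_eps_pow_le (by omega) ε) (pow_pos (inv_eps_pos ε) N).le (abs_nonneg C))
    have h2 : |q ε| ≤ |D| * ((ε : ℝ)⁻¹) ^ (N + M) := h'.trans (mul_le_mul (le_abs_self D)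
      (inv_eps_pow_le (by omega) ε) (pow_pos (inv_eps_pos ε) M).le (abs_nonneg D))
    rw [add_mul]
    exact (abs_add_le _ _).trans (add_le_add h1 h2)
  mul_mem := by
    rintro r q ⟨N, C, h⟩ ⟨M, D, h'⟩
    refine ⟨N + M, C * D, ?_⟩
    filter_upwards [h, h'] with ε h h'
    rw [abs_mul]
    refine (mul_le_mul h h' (abs_nonneg _) ((abs_nonneg _).trans h)).trans (le_of_eq ?_)
    ring
  mono := by
    rintro r q ⟨N, C, h⟩ h'
    exact ⟨N, C, by filter_upwards [h, h'] with ε h h' using h'.trans h⟩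

/-- Integer exponents suffice: a real exponent q is rounded up where |r| ≥ 1, and where |r| ≤ 1 the
power is at most 1 ≤ ε⁻¹. -/
theorem slowScale_iff {r : Eps → ℝ} :
    r ∈ slowScale ↔ ∀ m : ℕ, ∃ C : ℝ, ∀ᶠ ε in toZero, |r ε| ^ m ≤ C * ((ε : Eps) : ℝ)⁻¹ := by
  constructor
  · intro h m
    obtain ⟨C, hC⟩ := (h m (Nat.cast_nonneg m)).bound
    refine ⟨C, hC.mono fun ε h => ?_⟩
    rw [Real.rpow_natCast, Real.norm_of_nonneg (by positivity),
      Real.norm_of_nonneg (inv_eps_pos ε).le] at h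
    exact h
  · intro h q hq
    obtain ⟨C, hC⟩ := h ⌈q⌉₊
    refine Asymptotics.IsBigO.of_bound (1 + C) (hC.mono fun ε h => ?_)
    rw [Real.norm_of_nonneg (by positivity), Real.norm_of_nonneg (inv_eps_pos ε).le, add_mul,
      one_mul]
    have h1 := one_le_inv_eps ε
    rcases le_total |r ε| 1 with h2 | h2
    · have h3 := Real.rpow_le_one (abs_nonneg (r ε)) h2 hq
      have h4 : 0 ≤ C * ((ε : Eps) : ℝ)⁻¹ := le_trans (by positivity) h
      linarith
    · have h3 := Real.rpow_le_rpow_of_exponent_le h2 (Nat.le_ceil q)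
      rw [Real.rpow_natCast] at h3
      linarith

theorem isScale_slowScale : IsScale slowScale := by
  have hconst : ∀ c : ℝ, (fun _ => c) ∈ slowScale := fun c => slowScale_iff.2 fun m =>
    ⟨|c| ^ m, Eventually.of_forall fun ε =>
      le_mul_of_one_le_right (by positivity) (one_le_inv_eps ε)⟩
  have hmono : ∀ {r q}, r ∈ slowScale → (∀ᶠ ε in toZero, |q ε| ≤ |r ε|) → q ∈ slowScale := by
    intro r q h h'
    refine slowScale_iff.2 fun m => ?_
    obtain ⟨C, hC⟩ := slowScale_iff.1 h m
    refine ⟨C, ?_⟩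
    filter_upwards [hC, h'] with ε h h'
    exact (pow_le_pow_left₀ (abs_nonneg _) h' m).trans h
  have hmul : ∀ {r q}, r ∈ slowScale → q ∈ slowScale → (fun ε => r ε * q ε) ∈ slowScale := by
    intro r q h h'
    refine slowScale_iff.2 fun m => ?_
    -- The exponent is doubled in order to use |r|^m |q|^m ≤ |r|^{2m} + |q|^{2m}.
    obtain ⟨C, hC⟩ := slowScale_iff.1 h (m * 2)
    obtain ⟨D, hD⟩ := slowScale_iff.1 h' (m * 2)
    refine ⟨C + D, ?_⟩
    filter_upwards [hC, hD] with ε h h'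
    rw [abs_mul, mul_pow, add_mul]
    rw [pow_mul] at h h'
    nlinarith [sq_nonneg (|r ε| ^ m - |q ε| ^ m), sq_nonneg (|r ε| ^ m), sq_nonneg (|q ε| ^ m)]
  refine ⟨hconst, fun {r q} h h' => ?_, hmul, hmono⟩
  have hone : ∀ {r}, r ∈ slowScale → (fun ε => 1 + |r ε|) ∈ slowScale := by
    intro r h
    refine slowScale_iff.2 fun m => ?_
    obtain ⟨C, hC⟩ := slowScale_iff.1 h m
    refine ⟨2 ^ m * (1 + C), hC.mono fun ε h => ?_⟩
    have h1 := one_le_inv_eps ε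
    have h2 : 1 + |r ε| ≤ 2 * max 1 |r ε| := by
      linarith [le_max_left 1 |r ε|, le_max_right 1 |r ε|]
    have h3 : max 1 |r ε| ^ m ≤ 1 + |r ε| ^ m := by
      rcases max_cases 1 |r ε| with ⟨h4, -⟩ | ⟨h4, -⟩ <;> rw [h4]
      · rw [one_pow]
        linarith [pow_nonneg (abs_nonneg (r ε)) m]
      · linarith
    rw [abs_of_nonneg (by positivity)]
    calc (1 + |r ε|) ^ m ≤ (2 * max 1 |r ε|) ^ m := pow_le_pow_left₀ (by positivity) h2 m
      _ = 2 ^ m * max 1 |r ε| ^ m := mul_pow _ _ _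
      _ ≤ 2 ^ m * ((1 + C) * ((ε : Eps) : ℝ)⁻¹) := by
          gcongr
          linarith
      _ = _ := by ring
  -- Sums reduce to products: |r + q| ≤ (1 + |r|)(1 + |q|).
  refine hmono (hmul (hone h) (hone h')) (Eventually.of_forall fun ε => ?_)
  rw [abs_of_nonneg (a := (1 + |r ε|) * (1 + |q ε|)) (by positivity)]
  refine (abs_add_le _ _).trans ?_
  nlinarith [abs_nonneg (r ε), abs_nonneg (q ε)]

theorem slowScale_subset_modScale : slowScale ⊆ modScale := by
  intro r h
  obtain ⟨C, hC⟩ := slowScale_iff.1 h 1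
  exact ⟨1, C, by simpa using hC⟩

namespace IsScale

variable {S : Set (Eps → ℝ)} {r q : Eps → ℝ}

theorem abs_mem (hS : IsScale S) (h : r ∈ S) : (fun ε => |r ε|) ∈ S :=
  hS.mono h (Eventually.of_forall fun _ => (abs_abs _).le)

theorem const_mul_mem (hS : IsScale S) (c : ℝ) (h : r ∈ S) : (fun ε => c * r ε) ∈ S :=
  hS.mul_mem (hS.const_mem c) h

theorem pow_mem (hS : IsScale S) (h : r ∈ S) (m : ℕ) : (fun ε => r ε ^ m) ∈ S := by
  induction m with
  | zero => simpa using hS.const_mem 1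
  | succ m ih => simpa only [pow_succ] using hS.mul_mem ih h

end IsScale

/-! ### Nets of smooth functions with derivatives of controlled growth -/

theorem exists_abs_time_le {E : Type*} [NormedAddCommGroup E] {K : Set (E × ℝ × ℝ)} (hK : IsCompact K) :
    ∃ T : ℝ, 0 ≤ T ∧ ∀ p ∈ K, ‖p.1‖ ≤ T ∧ |p.2.1| ≤ T ∧ |p.2.2| ≤ T := by
  obtain ⟨R, hR⟩ := hK.isBounded.exists_norm_le
  refine ⟨max R 0, le_max_right _ _, fun p hp => ?_⟩
  have h := (hR p hp).trans (le_max_left R 0)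
  exact ⟨(norm_fst_le p).trans h, ((norm_fst_le p.2).trans (norm_snd_le p)).trans h,
    ((norm_snd_le p.2).trans (norm_snd_le p)).trans h⟩

section SBound

variable {X Y Z F : Type*} [NormedAddCommGroup X] [NormedSpace ℝ X] [NormedAddCommGroup Y]
  [NormedSpace ℝ Y] [NormedAddCommGroup Z] [NormedSpace ℝ Z] [NormedAddCommGroup F]
  [NormedSpace ℝ F] {S : Set (Eps → ℝ)}

/-- On compact sets the derivatives of the net are bounded by nets of the scale `S`. -/
structure SBound (S : Set (Eps → ℝ)) (u : Eps → X → F) : Prop where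
  contDiff : ∀ ε, ContDiff ℝ ∞ (u ε)
  bound : ∀ K : Set X, IsCompact K → ∀ k : ℕ, ∃ μ ∈ S, ∀ᶠ ε in toZero, ∀ x ∈ K,
    ‖iteratedFDeriv ℝ k (u ε) x‖ ≤ μ ε

theorem SBound.uniform (hS : IsScale S) {u : Eps → X → F} (hu : SBound S u) {K : Set X}
    (hK : IsCompact K) (k : ℕ) : ∃ μ ∈ S, (∀ ε, 1 ≤ μ ε) ∧ ∀ᶠ ε in toZero, ∀ x ∈ K, ∀ i ≤ k,
      ‖iteratedFDeriv ℝ i (u ε) x‖ ≤ μ ε := by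
  induction k with
  | zero =>
    obtain ⟨μ, hμ, h⟩ := hu.bound K hK 0
    refine ⟨fun ε => 1 + |μ ε|, hS.add_mem (hS.const_mem 1) (hS.abs_mem hμ), fun ε =>
      le_add_of_nonneg_right (abs_nonneg _), h.mono fun ε h x hx i hi => ?_⟩
    obtain rfl : i = 0 := by omega
    linarith [h x hx, le_abs_self (μ ε)]
  | succ k ih =>
    obtain ⟨μ, hμ, h1, h⟩ := ih
    obtain ⟨ν, hν, h'⟩ := hu.bound K hK (k + 1)
    refine ⟨fun ε => μ ε + |ν ε|, hS.add_mem hμ (hS.abs_mem hν), fun ε =>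
      (h1 ε).trans (le_add_of_nonneg_right (abs_nonneg _)), ?_⟩
    filter_upwards [h, h'] with ε h h' x hx i hi
    rcases Nat.lt_or_ge i (k + 1) with hi' | hi'
    · linarith [h x hx i (by omega), abs_nonneg (ν ε)]
    · obtain rfl : i = k + 1 := by omega
      linarith [h' x hx, le_abs_self (ν ε), h1 ε]

theorem SBound.of_subset {S' : Set (Eps → ℝ)} (h : S ⊆ S') {u : Eps → X → F} (hu : SBound S u) :
    SBound S' u :=
  ⟨hu.contDiff, fun K hK k => by
    obtain ⟨μ, hμ, h1⟩ := hu.bound K hK k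
    exact ⟨μ, h hμ, h1⟩⟩

theorem sBound_const (hS : IsScale S) {f : X → F} (hf : ContDiff ℝ ∞ f) :
    SBound S fun _ : Eps => f :=
  ⟨fun _ => hf, fun K hK k => by
    obtain ⟨C, hC⟩ := hK.exists_bound_of_continuousOn (continuous_iteratedFDeriv hf k).continuousOn
    exact ⟨_, hS.const_mem C, Eventually.of_forall fun ε x hx => hC x hx⟩⟩

theorem SBound.add (hS : IsScale S) {u v : Eps → X → F} (hu : SBound S u) (hv : SBound S v) :
    SBound S fun ε x => u ε x + v ε x := by
  refine ⟨fun ε => (hu.contDiff ε).add (hv.contDiff ε), fun K hK k => ?_⟩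
  obtain ⟨μ, hμ, h⟩ := hu.bound K hK k
  obtain ⟨ν, hν, h'⟩ := hv.bound K hK k
  refine ⟨_, hS.add_mem hμ hν, ?_⟩
  filter_upwards [h, h'] with ε h h' x hx
  have : iteratedFDeriv ℝ k (fun x => u ε x + v ε x) x =
      iteratedFDeriv ℝ k (u ε) x + iteratedFDeriv ℝ k (v ε) x :=
    iteratedFDeriv_add_apply ((hu.contDiff ε).of_le (natCast_le_infty k)).contDiffAt
      ((hv.contDiff ε).of_le (natCast_le_infty k)).contDiffAt
  rw [this]
  exact (norm_add_le _ _).trans (add_le_add (h x hx) (h' x hx))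

theorem SBound.bilinear (hS : IsScale S) {u : Eps → X → Y} {v : Eps → X → Z}
    (B : Y →L[ℝ] Z →L[ℝ] F) (hu : SBound S u) (hv : SBound S v) :
    SBound S fun ε x => B (u ε x) (v ε x) := by
  refine ⟨fun ε => B.isBoundedBilinearMap.contDiff.comp ((hu.contDiff ε).prodMk (hv.contDiff ε)),
    fun K hK k => ?_⟩
  obtain ⟨μ, hμ, h1, h⟩ := hu.uniform hS hK k
  obtain ⟨ν, hν, h1', h'⟩ := hv.uniform hS hK k
  refine ⟨_, hS.const_mul_mem (‖B‖ * 2 ^ k) (hS.mul_mem hμ hν), ?_⟩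
  filter_upwards [h, h'] with ε h h' x hx
  refine (B.norm_iteratedFDeriv_le_of_bilinear (hu.contDiff ε) (hv.contDiff ε) x
    (natCast_le_infty k)).trans ?_
  rw [mul_assoc]
  refine mul_le_mul_of_nonneg_left ?_ (norm_nonneg B)
  have hμ0 : 0 ≤ μ ε := zero_le_one.trans (h1 ε)
  calc _ ≤ ∑ i ∈ Finset.range (k + 1), (k.choose i : ℝ) * μ ε * ν ε := by
        refine Finset.sum_le_sum fun i hi => ?_
        have hi' := Finset.mem_range.1 hi
        have a1 := h x hx i (by omega)
        have a2 := h' x hx (k - i) (by omega)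
        gcongr
    _ = 2 ^ k * (μ ε * ν ε) := by
        rw [← Finset.sum_mul, ← Finset.sum_mul, mul_assoc]
        congr 1
        exact_mod_cast Nat.sum_range_choose k

theorem SBound.mul (hS : IsScale S) {u v : Eps → X → ℂ} (hu : SBound S u) (hv : SBound S v) :
    SBound S fun ε x => u ε x * v ε x :=
  SBound.bilinear hS (ContinuousLinearMap.mul ℝ ℂ) hu hv

theorem SBound.linear_comp (hS : IsScale S) {u : Eps → X → Y} (L : Y →L[ℝ] F) (hu : SBound S u) :
    SBound S fun ε x => L (u ε x) := by
  refine ⟨fun ε => L.contDiff.comp (hu.contDiff ε), fun K hK k => ?_⟩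
  obtain ⟨μ, hμ, h⟩ := hu.bound K hK k
  refine ⟨_, hS.const_mul_mem ‖L‖ hμ, h.mono fun ε h x hx => ?_⟩
  exact (norm_iteratedFDeriv_linear_comp_le (hu.contDiff ε) L k x).trans
    (mul_le_mul_of_nonneg_left (h x hx) (norm_nonneg L))

theorem SBound.comp_linear (hS : IsScale S) {u : Eps → Y → F} (hu : SBound S u) (L : X →L[ℝ] Y) :
    SBound S fun ε x => u ε (L x) := by
  refine ⟨fun ε => (hu.contDiff ε).comp L.contDiff, fun K hK k => ?_⟩
  obtain ⟨μ, hμ, h⟩ := hu.bound _ (hK.image L.continuous) k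
  refine ⟨_, hS.const_mul_mem (‖L‖ ^ k) hμ, h.mono fun ε h x hx => ?_⟩
  exact (norm_iteratedFDeriv_comp_linear_le (hu.contDiff ε) L k x).trans
    (mul_le_mul_of_nonneg_left (h _ ⟨x, hx, rfl⟩) (by positivity))

theorem SBound.prodMk (hS : IsScale S) {u : Eps → X → Y} {v : Eps → X → Z} (hu : SBound S u)
    (hv : SBound S v) : SBound S fun ε x => (u ε x, v ε x) := by
  have h1 := (hu.linear_comp hS (ContinuousLinearMap.inl ℝ Y Z)).add hS
    (hv.linear_comp hS (ContinuousLinearMap.inr ℝ Y Z))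
  simpa using h1

/-- A net of maps is c-bounded if eventually it maps a given compact set into a fixed compact
set. -/
def CBounded (Γ : Eps → X → Y) : Prop :=
  ∀ K : Set X, IsCompact K → ∃ L : Set Y, IsCompact L ∧ ∀ᶠ ε in toZero, ∀ p ∈ K, Γ ε p ∈ L

/-- The c-boundedness keeps the inner values in one compact set, so that a single net bounds the
outer derivatives. The bound ν ≥ 1 allows its powers to be enlarged as the Faà di Bruno estimate
demands. -/
theorem SBound.comp (hS : IsScale S) {u : Eps → Y → F} {Γ : Eps → X → Y} (hu : SBound S u)
    (hΓ : SBound S Γ) (hc : CBounded Γ) : SBound S fun ε x => u ε (Γ ε x) := by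
  refine ⟨fun ε => (hu.contDiff ε).comp (hΓ.contDiff ε), fun K hK k => ?_⟩
  obtain ⟨L, hL, hc⟩ := hc K hK
  obtain ⟨μ, hμ, h1, h⟩ := hu.uniform hS hL k
  obtain ⟨ν, hν, h1', h'⟩ := hΓ.uniform hS hK k
  refine ⟨_, hS.mul_mem (hS.const_mul_mem (k.factorial : ℝ) hμ) (hS.pow_mem hν k), ?_⟩
  filter_upwards [h, h', hc] with ε h h' hc x hx
  exact norm_iteratedFDeriv_comp_le (hu.contDiff ε) (hΓ.contDiff ε) (natCast_le_infty k) x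
    (fun i hi => h _ (hc x hx) i hi)
    (fun i hi hi' => (h' x hx i hi').trans (le_self_pow₀ (h1' ε) (by omega)))

theorem SBound.mem_moderate {u : Eps → X → ℂ} (h : S ⊆ modScale) (hu : SBound S u) :
    u ∈ moderate X := by
  refine ⟨hu.contDiff, fun K hK k => ?_⟩
  obtain ⟨μ, hμ, h1⟩ := hu.bound K hK k
  obtain ⟨N, C, h2⟩ := h hμ
  refine ⟨N, C, ?_⟩
  filter_upwards [h1, h2] with ε h1 h2 x hx
  exact (h1 x hx).trans ((le_abs_self _).trans h2)

theorem sBound_of_mem_moderate {u : Eps → X → ℂ} (hu : u ∈ moderate X) : SBound modScale u := by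
  refine ⟨hu.1, fun K hK k => ?_⟩
  obtain ⟨N, C, h⟩ := hu.2 K hK k
  refine ⟨fun ε => C * ((ε : ℝ)⁻¹) ^ N, ⟨N, |C|, Eventually.of_forall fun ε => ?_⟩, h⟩
  rw [abs_mul, abs_of_pos (pow_pos (inv_eps_pos ε) N)]

/-- Negligible nets have bounded derivatives (q = 0), and constants lie in every scale. Growth
bounds may therefore be transferred between representatives. -/
theorem SBound.add_negligible (hS : IsScale S) {u v : Eps → X → ℂ} (hu : SBound S u)
    (hv : ∀ ε, ContDiff ℝ ∞ (v ε)) (h : NegligibleBoundOn Set.univ (v - u)) : SBound S v := by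
  have h1 : SBound S (v - u) := by
    refine ⟨fun ε => (hv ε).sub (hu.contDiff ε), fun K hK k => ?_⟩
    obtain ⟨C, hC⟩ := h K hK (Set.subset_univ K) k 0
    exact ⟨_, hS.const_mem C, by simpa using hC⟩
  have h2 := hu.add hS h1
  simpa using h2

/-- Nets whose exponentials belong to the scale `S`. -/
def LogNet (S : Set (Eps → ℝ)) (l : Eps → ℝ) : Prop :=
  ∀ c : ℝ, 0 ≤ c → (fun ε => Real.exp (c * l ε)) ∈ S

theorem LogNet.add (hS : IsScale S) {l m : Eps → ℝ} (hl : LogNet S l) (hm : LogNet S m) :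
    LogNet S fun ε => l ε + m ε := fun c hc => by
  simpa only [mul_add, Real.exp_add] using hS.mul_mem (hl c hc) (hm c hc)

theorem logNet_const (hS : IsScale S) (a : ℝ) : LogNet S fun _ => a := fun _ _ => hS.const_mem _

theorem LogNet.const_mul {l : Eps → ℝ} (hl : LogNet S l) {a : ℝ} (ha : 0 ≤ a) :
    LogNet S fun ε => a * l ε := fun c hc => by
  simpa only [mul_assoc] using hl (c * a) (by positivity)

theorem LogNet.max_zero (hS : IsScale S) {l : Eps → ℝ} (hl : LogNet S l) :
    LogNet S fun ε => max (l ε) 0 := fun c hc => by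
  refine hS.mono (hS.add_mem (hl c hc) (hS.const_mem 1)) (Eventually.of_forall fun ε => ?_)
  have h0 := Real.exp_pos (c * l ε)
  rw [abs_of_pos (Real.exp_pos _), abs_of_pos (by linarith)]
  simp only
  rcases max_cases (l ε) 0 with ⟨h, -⟩ | ⟨h, -⟩ <;> rw [h]
  · linarith
  · rw [mul_zero, Real.exp_zero]
    linarith

theorem LogNet.sum {ι : Type*} (s : Finset ι) (hS : IsScale S) {l : ι → Eps → ℝ}
    (hl : ∀ i, LogNet S (l i)) : LogNet S fun ε => ∑ i ∈ s, l i ε := by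
  classical
  induction s using Finset.induction_on with
  | empty => simpa using logNet_const hS 0
  | insert i s hi ih =>
    simp only [Finset.sum_insert hi]
    exact (hl i).add hS ih

/-- On compact sets the values are bounded by logarithmic nets of the scale `S`. -/
def LogBound (S : Set (Eps → ℝ)) (u : Eps → X → F) : Prop :=
  ∀ K : Set X, IsCompact K → ∃ l, LogNet S l ∧ ∀ᶠ ε in toZero, ∀ x ∈ K, ‖u ε x‖ ≤ l ε

theorem LogBound.add_negligible (hS : IsScale S) {u v : Eps → X → ℂ} (hu : LogBound S u)
    (h : NegligibleBoundOn Set.univ (v - u)) : LogBound S v := by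
  intro K hK
  obtain ⟨l, hl, h1⟩ := hu K hK
  obtain ⟨C, hC⟩ := h K hK (Set.subset_univ K) 0 0
  refine ⟨_, hl.add hS (logNet_const hS C), ?_⟩
  filter_upwards [h1, hC] with ε h1 hC x hx
  have h2 := hC x hx
  rw [norm_iteratedFDeriv_zero, pow_zero, mul_one] at h2
  have h3 := norm_add_le (u ε x) (v ε x - u ε x)
  rw [add_sub_cancel] at h3
  exact h3.trans (add_le_add (h1 x hx) h2)

/-- Here e^{c log(1/ε)} = ε^{-c}: this is the reason why logarithmic type is the right hypothesis
for moderate growth of exponentials. -/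
theorem logNet_log : LogNet modScale fun ε => Real.log ((ε : ℝ)⁻¹) := fun c hc => by
  refine ⟨⌈c⌉₊, 1, Eventually.of_forall fun ε => ?_⟩
  rw [abs_of_pos (Real.exp_pos _), one_mul, mul_comm, ← Real.rpow_def_of_pos (inv_eps_pos ε),
    ← Real.rpow_natCast]
  exact Real.rpow_le_rpow_of_exponent_le (one_le_inv_eps ε) (Nat.le_ceil c)

theorem logNet_log_slowScale {μ : Eps → ℝ} (hμ : SlowScale μ) (h1 : ∀ ε, 1 ≤ μ ε) :
    LogNet slowScale fun ε => Real.log (μ ε) := fun c hc => by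
  refine isScale_slowScale.mono (isScale_slowScale.pow_mem (r := μ) hμ ⌈c⌉₊)
    (Eventually.of_forall fun ε => ?_)
  have h0 := zero_lt_one.trans_le (h1 ε)
  rw [abs_of_pos (Real.exp_pos _), abs_of_pos (by positivity), mul_comm,
    ← Real.rpow_def_of_pos h0, ← Real.rpow_natCast]
  exact Real.rpow_le_rpow_of_exponent_le (h1 ε) (Nat.le_ceil c)

theorem LogType.logBound {u : G X} (h : LogType u) {U : Eps → X → ℂ} (hU : IsRep U u) :
    LogBound modScale U := by
  obtain ⟨V, hV, h⟩ := h
  refine LogBound.add_negligible isScale_modScale (u := V) (fun K hK => ?_) ((hU.eq_iff hV).1 rfl)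
  obtain ⟨C, hC⟩ := h K hK
  refine ⟨fun ε => |C| * Real.log ((ε : ℝ)⁻¹), logNet_log.const_mul (abs_nonneg C),
    hC.mono fun ε h x hx => (h x hx).trans ?_⟩
  exact mul_le_mul_of_nonneg_right (le_abs_self C) (Real.log_nonneg (one_le_inv_eps ε))

theorem SlowScaleLogType.logBound {u : G X} (h : SlowScaleLogType u) {U : Eps → X → ℂ}
    (hU : IsRep U u) : LogBound slowScale U := by
  obtain ⟨V, hV, h⟩ := h
  refine LogBound.add_negligible isScale_slowScale (u := V) (fun K hK => ?_) ((hU.eq_iff hV).1 rfl)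
  obtain ⟨μ, hμ, h1, C, hC⟩ := h K hK
  refine ⟨fun ε => |C| * Real.log (μ ε), (logNet_log_slowScale hμ h1).const_mul (abs_nonneg C),
    hC.mono fun ε h x hx => (h x hx).trans ?_⟩
  exact mul_le_mul_of_nonneg_right (le_abs_self C) (Real.log_nonneg (h1 ε))

theorem SlowScaleRegular.sBound {u : G X} (h : SlowScaleRegular u) {U : Eps → X → ℂ}
    (hU : IsRep U u) : SBound slowScale U := by
  obtain ⟨V, hV, h⟩ := h
  refine SBound.add_negligible isScale_slowScale (u := V) ⟨hV.contDiff, fun K hK k => ?_⟩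
    hU.contDiff ((hU.eq_iff hV).1 rfl)
  obtain ⟨μ, hμ, C, hC⟩ := h K hK k
  exact ⟨fun ε => C * |μ ε|, isScale_slowScale.const_mul_mem C (isScale_slowScale.abs_mem hμ), hC⟩

theorem SBound.slowScaleRegular {u : G X} {U : Eps → X → ℂ} (h : SBound slowScale U)
    (hU : IsRep U u) : SlowScaleRegular u := by
  refine ⟨U, hU, fun K hK k => ?_⟩
  obtain ⟨μ, hμ, h1⟩ := h.bound K hK k
  exact ⟨μ, hμ, 1, h1.mono fun ε h x hx => by
    rw [one_mul]
    exact (h x hx).trans (le_abs_self _)⟩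

/-- Exponentials of nets with logarithmic bounds. -/
theorem SBound.cexp (hS : IsScale S) {g : Eps → X → ℂ} (hg : SBound S g) (hl : LogBound S g) :
    SBound S fun ε x => Complex.exp (g ε x) := by
  have hs : ∀ ε, ContDiff ℝ ∞ fun x => Complex.exp (g ε x) := fun ε => (hg.contDiff ε).cexp
  refine ⟨hs, fun K hK k => ?_⟩
  suffices H : ∃ μ ∈ S, ∀ᶠ ε in toZero, ∀ x ∈ K, ∀ i ≤ k,
      ‖iteratedFDeriv ℝ i (fun x => Complex.exp (g ε x)) x‖ ≤ μ ε by
    obtain ⟨μ, hμ, h⟩ := H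
    exact ⟨μ, hμ, h.mono fun ε h x hx => h x hx k le_rfl⟩
  induction k with
  | zero =>
    obtain ⟨l, hl, h⟩ := hl K hK
    refine ⟨_, hl 1 zero_le_one, h.mono fun ε h x hx i hi => ?_⟩
    obtain rfl : i = 0 := by omega
    rw [norm_iteratedFDeriv_zero, Complex.norm_exp, one_mul]
    exact Real.exp_le_exp.2 ((Complex.re_le_norm _).trans (h x hx))
  | succ k ih =>
    obtain ⟨μ, hμ, h⟩ := ih
    obtain ⟨ν, hν, h1, h'⟩ := hg.uniform hS hK (k + 1)
    refine ⟨fun ε => |μ ε| + 2 ^ k * (|μ ε| * ν ε), hS.add_mem (hS.abs_mem hμ)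
      (hS.const_mul_mem _ (hS.mul_mem (hS.abs_mem hμ) hν)), ?_⟩
    filter_upwards [h, h'] with ε h h' x hx i hi
    have hν0 := zero_le_one.trans (h1 ε)
    rcases Nat.lt_or_ge i (k + 1) with hi' | hi'
    · refine (h x hx i (by omega)).trans ((le_abs_self _).trans ?_)
      exact le_add_of_nonneg_right (by positivity)
    · obtain rfl : i = k + 1 := by omega
      -- Since D e^g = e^g D g, the Leibniz formula bounds order k+1 by the orders up to k. The
      -- logarithmic bound is needed only at order zero, where |e^g| ≤ e^{|g|}.
      have hd : fderiv ℝ (fun x => Complex.exp (g ε x)) =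
          fun x => Complex.exp (g ε x) • fderiv ℝ (g ε) x := by
        ext1 y
        exact ((hg.contDiff ε).differentiable (by simp) y).hasFDerivAt.cexp.fderiv
      rw [← norm_iteratedFDeriv_fderiv, hd]
      refine (norm_iteratedFDeriv_smul_le (hs ε)
        ((hg.contDiff ε).fderiv_right (m := ∞) (by simp)) x (natCast_le_infty k)).trans ?_
      refine le_trans ?_ (le_add_of_nonneg_left (abs_nonneg (μ ε)))
      calc _ ≤ ∑ i ∈ Finset.range (k + 1), (k.choose i : ℝ) * |μ ε| * ν ε := by
            refine Finset.sum_le_sum fun i hi => ?_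
            have hi' := Finset.mem_range.1 hi
            have a1 := (h x hx i (by omega)).trans (le_abs_self _)
            have a2 := h' x hx (k - i + 1) (by omega)
            rw [← norm_iteratedFDeriv_fderiv] at a2
            gcongr
        _ = 2 ^ k * (|μ ε| * ν ε) := by
            rw [← Finset.sum_mul, ← Finset.sum_mul, mul_assoc]
            congr 1
            exact_mod_cast Nat.sum_range_choose k

variable {E : Type*} [NormedAddCommGroup E] [NormedSpace ℝ E]

/-- The integral from t to s samples the integrand on whole time segments; they sweep out this
larger compact set, on which the bounds are taken. -/
theorem isCompact_segMap_image {K : Set (E × ℝ × ℝ)} (hK : IsCompact K) :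
    IsCompact ((fun z : ℝ × (E × ℝ × ℝ) => segMap E z.1 z.2) '' (Set.Icc (0 : ℝ) 1 ×ˢ K)) := by
  refine (isCompact_Icc.prod hK).image ?_
  simp only [segMap_apply]
  fun_prop

theorem SBound.flowInt [FiniteDimensional ℝ E] [CompleteSpace F] (hS : IsScale S)
    {h : Eps → E × ℝ × ℝ → F} (hh : SBound S h) : SBound S fun ε => flowInt (h ε) := by
  refine ⟨fun ε => contDiff_flowInt (hh.contDiff ε), fun K hK k => ?_⟩
  obtain ⟨μ, hμ, h1, hb⟩ := hh.uniform hS (isCompact_segMap_image hK) k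
  obtain ⟨T, hT, hKT⟩ := exists_abs_time_le hK
  refine ⟨_, hS.const_mul_mem (2 * T + 2 * k) hμ, hb.mono fun ε hb p hp => ?_⟩
  have hμ0 := zero_le_one.trans (h1 ε)
  have hseg : ∀ i ≤ k, ∀ θ ∈ Set.Icc (0 : ℝ) 1, ‖iteratedFDeriv ℝ i (h ε) (segMap E θ p)‖ ≤ μ ε :=
    fun i hi θ hθ => hb _ ⟨(θ, p), ⟨hθ, hp⟩, rfl⟩ i hi
  -- No feedback of the integral into the integrand occurs here, so the exponential part of the
  -- estimate is switched off.
  have key := norm_iteratedFDeriv_flowInt_le (hh.contDiff ε) k p (A := 0) (Λ := 0) (R := μ ε)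
    (R' := μ ε) (fun θ hθ => by simpa using hseg k le_rfl θ hθ)
    (fun j hj θ hθ => hseg j (by omega) θ hθ)
  have hd : |p.2.2 - p.2.1| ≤ 2 * T := (abs_sub _ _).trans (by linarith [hKT p hp])
  have := mul_le_mul_of_nonneg_right hd hμ0
  rw [zero_mul, zero_add] at key
  linarith

theorem LogBound.flowInt [FiniteDimensional ℝ E] [CompleteSpace F]
    {h : Eps → E × ℝ × ℝ → F} (hs : ∀ ε, ContDiff ℝ ∞ (h ε)) (hS : IsScale S) (hh : LogBound S h) :
    LogBound S fun ε => flowInt (h ε) := by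
  intro K hK
  obtain ⟨l, hl, hb⟩ := hh _ (isCompact_segMap_image hK)
  obtain ⟨T, hT, hKT⟩ := exists_abs_time_le hK
  refine ⟨_, (hl.max_zero hS).const_mul (a := 2 * T) (by positivity), hb.mono fun ε hb p hp => ?_⟩
  have key := norm_flowInt_le (hs ε) p (A := 0) (Λ := 0) (R := max (l ε) 0)
    (fun θ hθ => by
      have := (hb _ ⟨(θ, p), ⟨hθ, hp⟩, rfl⟩).trans (le_max_left _ 0)
      simpa using this)
  have hd : |p.2.2 - p.2.1| ≤ 2 * T := (abs_sub _ _).trans (by linarith [hKT p hp])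
  have := mul_le_mul_of_nonneg_right hd (le_max_right (l ε) 0)
  rw [zero_mul, zero_add] at key
  exact key.trans this

end SBound

/-! ### Representatives with support in a fixed compact set -/

section Support

variable {n : ℕ}

theorem contDiff_ofReal {X : Type*} [NormedAddCommGroup X] [NormedSpace ℝ X] {f : X → ℝ}
    (hf : ContDiff ℝ ∞ f) : ContDiff ℝ ∞ fun x => (f x : ℂ) :=
  Complex.ofRealCLM.contDiff.comp hf

/-- The cutoff depends on x alone, because the support is not compact in time, and it is real, so a
real representative stays real. -/
theorem exists_isRep_eq_zero_outside_x {a : G (ℝ × Sp n)} (ha : CompactlySupportedInX a)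
    {U : Eps → ℝ × Sp n → ℂ} (hU : IsRep U a) : ∃ (R : ℝ) (χ : Sp n → ℝ), 0 ≤ R ∧
      (∀ x, R < ‖x‖ → χ x = 0) ∧ IsRep (fun ε z => ((χ z.2 : ℝ) : ℂ) * U ε z) a := by
  obtain ⟨K, hK, hs⟩ := ha
  obtain ⟨R, χ, hR, hχ, hKR, h1, h0⟩ := exists_cutoff hK
  refine ⟨R + 1, χ, by positivity, h0, hU.cutoff (χ := fun z : ℝ × Sp n => ((χ z.2 : ℝ) : ℂ))
    (contDiff_ofReal (hχ.comp contDiff_snd)) (W := Prod.snd ⁻¹' Metric.ball (0 : Sp n) R)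
    (Metric.isOpen_ball.preimage continuous_snd) (fun z hz => hKR (hs hz).2) fun z hz => ?_⟩
  rw [h1 _ hz, Complex.ofReal_one]

theorem exists_isRep_eq_zero_outside {u : G (Sp n)} (hu : CompactlySupported u) :
    ∃ U, IsRep U u ∧ ∃ K : Set (Sp n), IsCompact K ∧ ∀ ε, ∀ x ∉ K, U ε x = 0 := by
  obtain ⟨V, hV⟩ := exists_isRep u
  obtain ⟨K, hK, hs⟩ := hu
  obtain ⟨R, χ, hR, hχ, hKR, h1, h0⟩ := exists_cutoff hK
  refine ⟨_, hV.cutoff (contDiff_ofReal hχ) Metric.isOpen_ball (hs.trans hKR) fun x hx => ?_,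
    Metric.closedBall 0 (R + 1), isCompact_closedBall _ _, fun ε x hx => ?_⟩
  · rw [h1 _ hx, Complex.ofReal_one]
  · rw [h0 x (by simpa using hx), Complex.ofReal_zero, zero_mul]

theorem iteratedFDeriv_eq_zero_of_outside {E F : Type*} [NormedAddCommGroup E] [NormedSpace ℝ E]
    [NormedAddCommGroup F] [NormedSpace ℝ F] {f : ℝ × E → F} {R : ℝ}
    (h : ∀ t x, R < ‖x‖ → f (t, x) = 0) (k : ℕ) {t : ℝ} {x : E} (hx : R < ‖x‖) :
    iteratedFDeriv ℝ k f (t, x) = 0 := by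
  have hopen : IsOpen {z : ℝ × E | R < ‖z.2‖} := isOpen_lt continuous_const (by fun_prop)
  have h1 : f =ᶠ[𝓝 (t, x)] fun _ => 0 := by
    filter_upwards [hopen.mem_nhds (show (t, x) ∈ {z : ℝ × E | R < ‖z.2‖} from hx)] with z hz
    exact h z.1 z.2 hz
  have h2 := (h1.iteratedFDeriv ℝ k).eq_of_nhds
  rwa [iteratedFDeriv_fun_zero] at h2

end Support

/-! ### The vector field of the characteristic system -/

section Field

variable {n : ℕ} {S : Set (Eps → ℝ)}

/-- Real nets of coefficients that vanish outside a ball in `x`, with derivatives measured by the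
scale `S` and with logarithmic `x`-derivatives. -/
structure CoeffNet (S : Set (Eps → ℝ)) (R : ℝ) (A : Fin n → Eps → ℝ × Sp n → ℝ) : Prop where
  outside : ∀ j ε t x, R < ‖x‖ → A j ε (t, x) = 0
  sBound : ∀ j, SBound S (A j)
  logBound : ∀ j k, LogBound S fun ε z => fderiv ℝ (A j ε) z ((0 : ℝ), e k)

/-- The vector field `-(a_1,…,a_n)`. -/
noncomputable def vecField (A : Fin n → Eps → ℝ × Sp n → ℝ) (ε : Eps) (z : ℝ × Sp n) : Sp n :=
  ∑ j, (-A j ε z) • e j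

theorem e_apply (j k : Fin n) : e j k = if k = j then 1 else 0 := by
  simp [e]

theorem norm_e (j : Fin n) : ‖e j‖ = 1 := by simp [e]

theorem sum_apply_smul_e (v : Sp n) : ∑ j, v j • e j = v := by
  ext k
  simp [e_apply]

theorem vecField_apply (A : Fin n → Eps → ℝ × Sp n → ℝ) (ε : Eps) (z : ℝ × Sp n) (j : Fin n) :
    vecField A ε z j = -A j ε z := by
  simp [vecField, e_apply]

theorem SBound.sum {X F ι : Type*} [NormedAddCommGroup X] [NormedSpace ℝ X] [NormedAddCommGroup F]
    [NormedSpace ℝ F] (hS : IsScale S) (s : Finset ι) {u : ι → Eps → X → F}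
    (h : ∀ i, SBound S (u i)) : SBound S fun ε x => ∑ i ∈ s, u i ε x := by
  classical
  induction s using Finset.induction_on with
  | empty => simpa using sBound_const hS contDiff_const
  | insert i s hi ih =>
    simp only [Finset.sum_insert hi]
    exact (h i).add hS ih

variable {R : ℝ} {A : Fin n → Eps → ℝ × Sp n → ℝ}

theorem CoeffNet.sBound_vecField (hS : IsScale S) (hA : CoeffNet S R A) :
    SBound S (vecField A) :=
  SBound.sum hS Finset.univ fun j => by
    have := (hA.sBound j).linear_comp hS
      ((-1 : ℝ) • (ContinuousLinearMap.id ℝ ℝ).smulRight (e j))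
    simpa using this

theorem CoeffNet.vecField_outside (hA : CoeffNet S R A) (ε : Eps) (t : ℝ) (x : Sp n)
    (hx : R < ‖x‖) : vecField A ε (t, x) = 0 := by
  simp [vecField, fun j => hA.outside j ε t x hx]

theorem isCompact_timeStrip (T R : ℝ) :
    IsCompact (Set.Icc (-T) T ×ˢ Metric.closedBall (0 : Sp n) R) :=
  isCompact_Icc.prod (isCompact_closedBall _ _)

/-- Vanishing outside a ball in x turns a strip |t| ≤ T into a compact set as far as bounds are
concerned. -/
theorem CoeffNet.isBddField (hS : IsScale S) (hA : CoeffNet S R A) (ε : Eps) :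
    IsBddField (vecField A ε) := by
  have hs := (hA.sBound_vecField hS).contDiff ε
  refine ⟨hs, fun k T => ?_⟩
  obtain ⟨B, hB⟩ := (isCompact_timeStrip (n := n) T R).exists_bound_of_continuousOn
    (continuous_iteratedFDeriv hs k).continuousOn
  refine ⟨max B 0, fun t ht x => ?_⟩
  rcases lt_or_ge R ‖x‖ with hx | hx
  · rw [iteratedFDeriv_eq_zero_of_outside (hA.vecField_outside ε) k hx]
    simp
  · exact (hB (t, x) ⟨abs_le.1 ht, by simpa using hx⟩).trans (le_max_left _ _)

/-- Reduces the operator norm of D_x f to the entries ∂_k a_j, on which the logarithmic hypothesis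
is made. -/
theorem CoeffNet.norm_fderiv_comp_inr_le (hA : CoeffNet S R A) (ε : Eps)
    (z : ℝ × Sp n) : ‖(fderiv ℝ (vecField A ε) z).comp (ContinuousLinearMap.inr ℝ ℝ (Sp n))‖ ≤
      ∑ k, ∑ j, ‖fderiv ℝ (A j ε) z ((0 : ℝ), e k)‖ := by
  have hd : ∀ v, fderiv ℝ (vecField A ε) z v = ∑ j, (-fderiv ℝ (A j ε) z v) • e j := fun v => by
    have h1 : HasFDerivAt (vecField A ε) (∑ j, (-fderiv ℝ (A j ε) z).smulRight (e j)) z :=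
      HasFDerivAt.fun_sum fun j _ =>
        ((((hA.sBound j).contDiff ε).differentiable (by simp) z).hasFDerivAt.neg).smul_const (e j)
    rw [h1.fderiv]
    simp
  refine ContinuousLinearMap.opNorm_le_bound _
    (Finset.sum_nonneg fun k _ => Finset.sum_nonneg fun j _ => norm_nonneg _) fun v => ?_
  have h2 : (fderiv ℝ (vecField A ε) z).comp (ContinuousLinearMap.inr ℝ ℝ (Sp n)) v =
      ∑ k, v k • fderiv ℝ (vecField A ε) z ((0 : ℝ), e k) := by
    conv_lhs => rw [← sum_apply_smul_e v]
    rw [map_sum]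
    simp
  rw [h2, Finset.sum_mul]
  refine (norm_sum_le _ _).trans (Finset.sum_le_sum fun k _ => ?_)
  rw [norm_smul, mul_comm]
  refine mul_le_mul ?_ (PiLp.norm_apply_le v k) (norm_nonneg _)
    (Finset.sum_nonneg fun j _ => norm_nonneg _)
  rw [hd]
  refine (norm_sum_le _ _).trans (Finset.sum_le_sum fun j _ => ?_)
  rw [norm_smul, norm_neg, norm_e, mul_one]

/-- The separation on which everything rests: all derivatives of the field are measured in S, but
the bound of its x-derivative is logarithmic. Positive parts of the logarithmic nets make Λ
nonnegative. -/
theorem CoeffNet.exists_fieldBound (hS : IsScale S) (hA : CoeffNet S R A) (T : ℝ) (k : ℕ) :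
    ∃ μ ∈ S, ∃ l, LogNet S l ∧ ∀ᶠ ε in toZero, FieldBound (vecField A ε) T k (μ ε) (l ε) := by
  obtain ⟨μ, hμ, h1, hb⟩ := (hA.sBound_vecField hS).uniform hS (isCompact_timeStrip T R) k
  choose l hl hlb using fun k j => hA.logBound j k _ (isCompact_timeStrip T R)
  refine ⟨μ, hμ, fun ε => ∑ k, ∑ j, max (l k j ε) 0,
    LogNet.sum _ hS fun k => LogNet.sum _ hS fun j => (hl k j).max_zero hS, ?_⟩
  have hlb' := eventually_all.2 fun k => eventually_all.2 (hlb k)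
  filter_upwards [hb, hlb'] with ε hb hlb
  have h0 : 0 ≤ ∑ k, ∑ j, max (l k j ε) 0 :=
    Finset.sum_nonneg fun k _ => Finset.sum_nonneg fun j _ => le_max_right _ _
  refine ⟨h1 ε, h0, fun t ht x i hi => ?_, fun t ht x => ?_⟩
  · rcases lt_or_ge R ‖x‖ with hx | hx
    · rw [iteratedFDeriv_eq_zero_of_outside (hA.vecField_outside ε) i hx, norm_zero]
      exact zero_le_one.trans (h1 ε)
    · exact hb (t, x) ⟨abs_le.1 ht, by simpa using hx⟩ i hi
  · rcases lt_or_ge R ‖x‖ with hx | hx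
    · have h2 := iteratedFDeriv_eq_zero_of_outside (hA.vecField_outside ε) 1 (t := t) hx
      have h3 : fderiv ℝ (vecField A ε) (t, x) = 0 := by
        rw [← norm_eq_zero, ← norm_iteratedFDeriv_one, h2, norm_zero]
      rw [h3]
      simpa using h0
    · refine (hA.norm_fderiv_comp_inr_le ε (t, x)).trans ?_
      refine Finset.sum_le_sum fun k _ => Finset.sum_le_sum fun j _ => ?_
      exact (hlb k j (t, x) ⟨abs_le.1 ht, by simpa using hx⟩).trans (le_max_left _ _)

theorem CoeffNet.cBounded_flow (hS : IsScale S) (hA : CoeffNet S R A) :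
    CBounded fun ε => flow (vecField A ε) := by
  intro K hK
  obtain ⟨T, hT, hKT⟩ := exists_abs_time_le hK
  refine ⟨Metric.closedBall 0 (max T R), isCompact_closedBall _ _, Eventually.of_forall
    fun ε p hp => ?_⟩
  rw [mem_closedBall_zero_iff]
  exact (norm_flow_le (hA.isBddField hS ε) (hA.vecField_outside ε) p.1 p.2.1 p.2.2).trans
    (max_le_max_right _ (hKT p hp).1)

/-- Positive orders are bounded by a power of M e^{2TΛ}, and the exponential of a logarithmic net
lies in S. Order zero follows from c-boundedness. -/
theorem CoeffNet.sBound_flow (hS : IsScale S) (hA : CoeffNet S R A) :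
    SBound S fun ε => flow (vecField A ε) := by
  refine ⟨fun ε => contDiff_flow (hA.isBddField hS ε), fun K hK k => ?_⟩
  rcases Nat.eq_zero_or_pos k with rfl | hk
  · obtain ⟨L, hL, h⟩ := hA.cBounded_flow hS K hK
    obtain ⟨C, hC⟩ := hL.isBounded.exists_norm_le
    refine ⟨_, hS.const_mem C, h.mono fun ε h p hp => ?_⟩
    rw [norm_iteratedFDeriv_zero]
    exact hC _ (h p hp)
  · obtain ⟨T, hT, hKT⟩ := exists_abs_time_le hK
    obtain ⟨c, N, -, hc⟩ := exists_norm_iteratedFDeriv_flow_le (Sp n) hT k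
    obtain ⟨μ, hμ, l, hl, hb⟩ := hA.exists_fieldBound hS T k
    refine ⟨fun ε => c * (μ ε * Real.exp (2 * T * l ε)) ^ N, hS.const_mul_mem c
      (hS.pow_mem (hS.mul_mem hμ (hl (2 * T) (by positivity))) N), hb.mono fun ε hb p hp => ?_⟩
    obtain ⟨-, h1, h2⟩ := hKT p hp
    exact hc _ (hA.isBddField hS ε) _ _ hb p h1 h2 k hk le_rfl

end Field

/-! ### Real coefficient nets and existence for the characteristic system. -/

section Field

variable {n : ℕ} {S : Set (Eps → ℝ)} {R : ℝ} {A : Fin n → Eps → ℝ × Sp n → ℝ}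
  {a : Fin n → G (ℝ × Sp n)}

theorem exists_coeffNet (hS : IsScale S) (hr : ∀ j, RealValued (a j))
    (hs : ∀ j, CompactlySupportedInX (a j)) (hb : ∀ j U, IsRep U (a j) → SBound S U)
    (hl : ∀ j k U, IsRep U (pd ((0 : ℝ), e k) (a j)) → LogBound S U) :
    ∃ R A, CoeffNet S R A ∧ ∀ j, IsRep (fun ε z => (A j ε z : ℂ)) (a j) := by
  choose V hV using hr
  choose R χ hR hχ hrep using fun j => exists_isRep_eq_zero_outside_x (hs j) (hV j)
  have hrep' : ∀ j, IsRep (fun ε z => ((χ j z.2 * V j ε z : ℝ) : ℂ)) (a j) := fun j => by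
    simpa only [Complex.ofReal_mul] using hrep j
  have hsm : ∀ j, SBound S fun ε z => χ j z.2 * V j ε z := fun j => by
    simpa using (hb j _ (hrep' j)).linear_comp hS Complex.reCLM
  -- The sum of the nonnegative radii is a common radius for all coefficients.
  refine ⟨∑ j, R j, fun j ε z => χ j z.2 * V j ε z,
    ⟨fun j ε t x hx => ?_, hsm, fun j k K hK => ?_⟩, hrep'⟩
  · have h1 : R j ≤ ∑ j, R j := Finset.single_le_sum (fun j _ => hR j) (Finset.mem_univ j)
    simp [hχ j x (h1.trans_lt hx)]
  · obtain ⟨l, hl, h⟩ := hl j k _ ((hrep' j).pd ((0 : ℝ), e k)) K hK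
    refine ⟨l, hl, h.mono fun ε h z hz => ?_⟩
    have h2 : HasFDerivAt (fun z : ℝ × Sp n => ((χ j z.2 * V j ε z : ℝ) : ℂ)) _ z :=
      Complex.ofRealCLM.hasFDerivAt.comp z
        (((hsm j).contDiff ε).differentiable (by simp) z).hasFDerivAt
    have h3 := h z hz
    beta_reduce at h3
    rw [h2.fderiv] at h3
    simpa using h3

theorem contDiff_of_ofReal {X : Type*} [NormedAddCommGroup X] [NormedSpace ℝ X] {f : X → ℝ}
    (hf : ContDiff ℝ ∞ fun x => (f x : ℂ)) : ContDiff ℝ ∞ f := by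
  simpa [Function.comp_def] using Complex.reCLM.contDiff.comp hf

theorem IsFlowRep.contDiff {γ : Fin n → G (FlowSp n)} {Γ : Eps → FlowSp n → Sp n}
    (h : IsFlowRep γ Γ) (ε : Eps) : ContDiff ℝ ∞ (Γ ε) :=
  contDiff_euclidean.2 fun j => contDiff_of_ofReal ((h.1 j).contDiff ε)

theorem fderiv_ofReal_apply_coord {X : Type*} [NormedAddCommGroup X] [NormedSpace ℝ X]
    {f : X → Sp n} {x : X} (hf : DifferentiableAt ℝ f x) (j : Fin n) (v : X) :
    fderiv ℝ (fun x => ((f x j : ℝ) : ℂ)) x v = ((fderiv ℝ f x v j : ℝ) : ℂ) := by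
  have h : HasFDerivAt (fun x => ((f x j : ℝ) : ℂ)) _ x :=
    (Complex.ofRealCLM.comp (EuclideanSpace.proj (𝕜 := ℝ) j)).hasFDerivAt.comp x hf.hasFDerivAt
  rw [h.fderiv]
  simp

theorem fderiv_flow_endTime {f : ℝ × Sp n → Sp n} (hf : IsBddField f) (p : FlowSp n) :
    fderiv ℝ (flow f) p ((0 : Sp n), (0 : ℝ), (1 : ℝ)) = f (p.2.2, flow f p) := by
  have h1 : HasDerivAt (fun s => (p.1, p.2.1, s)) ((0 : Sp n), (0 : ℝ), (1 : ℝ)) p.2.2 :=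
    (hasDerivAt_const _ _).prodMk ((hasDerivAt_const _ _).prodMk (hasDerivAt_id _))
  have h2 : HasFDerivAt (flow f) (fderiv ℝ (flow f) p) (p.1, p.2.1, p.2.2) :=
    ((contDiff_flow hf).differentiable (by simp) _).hasFDerivAt
  have h3 := h2.comp_hasDerivAt p.2.2 h1
  exact h3.unique (hasDerivAt_flow hf p.1 p.2.1 p.2.2)

theorem CoeffNet.isFlowRep (hS : IsScale S) (hA : CoeffNet S R A) {γ : Fin n → G (FlowSp n)}
    (hγ : ∀ h, IsRep (fun ε p => ((flow (vecField A ε) p h : ℝ) : ℂ)) (γ h)) :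
    IsFlowRep γ fun ε => flow (vecField A ε) :=
  ⟨hγ, hA.cBounded_flow hS⟩

theorem CoeffNet.isCharacteristic (hS : IsScale S) (hA : CoeffNet S R A)
    (hAa : ∀ j, IsRep (fun ε z => (A j ε z : ℂ)) (a j)) {γ : Fin n → G (FlowSp n)}
    (hγ : ∀ h, IsRep (fun ε p => ((flow (vecField A ε) p h : ℝ) : ℂ)) (γ h)) :
    IsCharacteristic a γ := by
  -- Taking w = -∂_s γ_h makes the equation trivial; what remains is that a_h along the flow
  -- represents w, which holds exactly for every ε.
  refine ⟨fun h => ⟨-pd ((0 : Sp n), (0 : ℝ), (1 : ℝ)) (γ h),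
    ⟨_, _, hAa h, hA.isFlowRep hS hγ, ?_⟩, (neg_neg _).symm⟩, fun h => ?_⟩
  · convert ((hγ h).pd ((0 : Sp n), (0 : ℝ), (1 : ℝ))).neg using 1
    ext ε p
    have hd := (contDiff_flow (hA.isBddField hS ε)).differentiable (by simp) p
    rw [Pi.neg_apply, Pi.neg_apply, fderiv_ofReal_apply_coord hd,
      fderiv_flow_endTime (hA.isBddField hS ε), vecField_apply]
    simp
  · have h1 := (hγ h).pull (diagMap n)
    have h2 : IsRep _ (pull (ContinuousLinearMap.fst ℝ (Sp n) ℝ) (coord h)) :=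
      (isRep_ofSmooth (contDiff_coordFn h)).pull _
    refine IsRep.unique h1 ?_
    convert h2 using 1
    ext ε p
    simp [diagMap, coordFn, flow_self (hA.isBddField hS ε)]

/-! ### Nets with negligible values -/

/-- Nets whose values are `O(ε^q)` for all `q` on compact sets. -/
def NullNet {X F : Type*} [TopologicalSpace X] [Norm F] (u : Eps → X → F) : Prop :=
  ∀ K : Set X, IsCompact K → ∀ q : ℕ, ∃ C : ℝ, ∀ᶠ ε in toZero, ∀ x ∈ K, ‖u ε x‖ ≤ C * (ε : ℝ) ^ q

section NullNet

variable {X Y F F' : Type*} [TopologicalSpace X] [TopologicalSpace Y] [NormedAddCommGroup F]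
  [NormedAddCommGroup F']

theorem NegligibleBoundOn.nullNet {X : Type*} [NormedAddCommGroup X] [NormedSpace ℝ X]
    {u : Eps → X → ℂ} (h : NegligibleBoundOn Set.univ u) : NullNet u := fun K hK q => by
  simpa only [norm_iteratedFDeriv_zero] using h K hK (Set.subset_univ K) 0 q

/-- A net that is bounded on compact sets by a moderate multiple of a null net is a null net. -/
theorem NullNet.of_bound {u : Eps → X → F} {v : Eps → Y → F'} (hu : NullNet u)
    (h : ∀ K : Set Y, IsCompact K → ∃ K' : Set X, IsCompact K' ∧ ∃ μ ∈ modScale, ∀ᶠ ε in toZero,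
      ∀ δ : ℝ, 0 ≤ δ → (∀ x ∈ K', ‖u ε x‖ ≤ δ) → ∀ y ∈ K, ‖v ε y‖ ≤ μ ε * δ) : NullNet v := by
  intro K hK q
  obtain ⟨K', hK', μ, ⟨N, C, hμ⟩, h⟩ := h K hK
  obtain ⟨C', h'⟩ := hu K' hK' (q + N)
  refine ⟨C * |C'|, ?_⟩
  filter_upwards [hμ, h, h'] with ε hμ h h' y hy
  have h0 : 0 ≤ |C'| * (ε : ℝ) ^ (q + N) := mul_nonneg (abs_nonneg _) (pow_nonneg ε.2.1.le _)
  have h1 := h _ h0 (fun x hx => (h' x hx).trans (mul_le_mul_of_nonneg_right (le_abs_self C')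
    (pow_nonneg ε.2.1.le _))) y hy
  refine h1.trans ((mul_le_mul_of_nonneg_right ((le_abs_self _).trans hμ) h0).trans (le_of_eq ?_))
  have h2 : ((ε : ℝ)⁻¹) ^ N * (ε : ℝ) ^ N = 1 := by
    rw [← mul_pow, inv_mul_cancel₀ ε.2.1.ne', one_pow]
  rw [pow_add]
  linear_combination C * |C'| * (ε : ℝ) ^ q * h2

theorem NullNet.mono {u : Eps → X → F} {v : Eps → X → F'} (hu : NullNet u)
    (h : ∀ ε x, ‖v ε x‖ ≤ ‖u ε x‖) : NullNet v := fun K hK q => by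
  obtain ⟨C, hC⟩ := hu K hK q
  exact ⟨C, hC.mono fun ε hC x hx => (h ε x).trans (hC x hx)⟩

theorem NullNet.add {u v : Eps → X → F} (hu : NullNet u) (hv : NullNet v) :
    NullNet fun ε x => u ε x + v ε x := fun K hK q => by
  obtain ⟨C, hC⟩ := hu K hK q
  obtain ⟨C', hC'⟩ := hv K hK q
  refine ⟨C + C', ?_⟩
  filter_upwards [hC, hC'] with ε h h' x hx
  rw [add_mul]
  exact (norm_add_le _ _).trans (add_le_add (h x hx) (h' x hx))

theorem NullNet.neg {u : Eps → X → F} (hu : NullNet u) : NullNet fun ε x => -u ε x :=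
  hu.mono fun _ _ => (norm_neg _).le

theorem NullNet.prodMk {u : Eps → X → F} {v : Eps → X → F'} (hu : NullNet u) (hv : NullNet v) :
    NullNet fun ε x => (u ε x, v ε x) := fun K hK q => by
  obtain ⟨C, hC⟩ := hu K hK q
  obtain ⟨C', hC'⟩ := hv K hK q
  refine ⟨max C C', ?_⟩
  filter_upwards [hC, hC'] with ε h h' x hx
  have hε : (0 : ℝ) ≤ (ε : ℝ) ^ q := pow_nonneg ε.2.1.le q
  exact norm_prod_le_iff.2
    ⟨(h x hx).trans (mul_le_mul_of_nonneg_right (le_max_left _ _) hε),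
      (h' x hx).trans (mul_le_mul_of_nonneg_right (le_max_right _ _) hε)⟩

theorem NullNet.comp {u : Eps → X → F} (hu : NullNet u) {g : Eps → Y → X}
    (hg : ∀ K : Set Y, IsCompact K → ∃ L : Set X, IsCompact L ∧ ∀ᶠ ε in toZero, ∀ p ∈ K, g ε p ∈ L) :
    NullNet fun ε y => u ε (g ε y) :=
  hu.of_bound fun K hK => by
    obtain ⟨L, hL, h⟩ := hg K hK
    refine ⟨L, hL, _, isScale_modScale.const_mem 1, h.mono fun ε h δ _ hδ y hy => ?_⟩
    rw [one_mul]
    exact hδ _ (h y hy)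

theorem NullNet.comp_continuous {u : Eps → X → F} (hu : NullNet u) {g : Y → X}
    (hg : Continuous g) : NullNet fun ε y => u ε (g y) :=
  hu.comp fun K hK => ⟨g '' K, hK.image hg, Eventually.of_forall fun _ y hy => ⟨y, hy, rfl⟩⟩

theorem NullNet.sum {ι : Type*} (s : Finset ι) {u : ι → Eps → X → F} (h : ∀ i, NullNet (u i)) :
    NullNet fun ε x => ∑ i ∈ s, u i ε x := by
  classical
  induction s using Finset.induction_on with
  | empty => exact fun K _ q => ⟨0, by simp⟩
  | insert i s hi ih =>
    simp only [Finset.sum_insert hi]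
    exact (h i).add ih

theorem nullNet_of_apply {u : Eps → X → Sp n} (h : ∀ j, NullNet fun ε x => u ε x j) :
    NullNet u := by
  have h1 : NullNet fun ε x => ∑ j, u ε x j • e j := NullNet.sum _ fun j =>
    (h j).mono fun ε x => by rw [norm_smul, norm_e, mul_one]
  simpa only [sum_apply_smul_e] using h1

end NullNet

end Field

/-! ### Uniqueness by Gronwall estimates modulo null nets. -/

section Uniqueness

variable {n : ℕ} {S : Set (Eps → ℝ)} {R : ℝ} {A : Fin n → Eps → ℝ × Sp n → ℝ}
  {a : Fin n → G (ℝ × Sp n)}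

/-- Two representatives of a generalised function differ by a null net. -/
theorem IsRep.nullNet_sub {X : Type*} [NormedAddCommGroup X] [NormedSpace ℝ X]
    {U V : Eps → X → ℂ} {u : G X} (hU : IsRep U u) (hV : IsRep V u) :
    NullNet fun ε x => U ε x - V ε x :=
  ((hU.eq_iff hV).1 rfl).nullNet

theorem IsFlowRep.nullNet_sub {γ : Fin n → G (FlowSp n)} {Γ Γ' : Eps → FlowSp n → Sp n}
    (h : IsFlowRep γ Γ) (h' : IsFlowRep γ Γ') : NullNet fun ε p => Γ ε p - Γ' ε p :=
  nullNet_of_apply fun j => ((h.1 j).nullNet_sub (h'.1 j)).mono fun ε x => by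
    rw [← Complex.ofReal_sub, Complex.norm_real, PiLp.sub_apply]

theorem eq_of_nullNet_sub {X : Type*} [NormedAddCommGroup X] [NormedSpace ℝ X]
    [FiniteDimensional ℝ X] {U V : Eps → X → ℂ} {u v : G X} (hU : IsRep U u) (hV : IsRep V v)
    (h : NullNet fun ε x => U ε x - V ε x) : u = v :=
  (hU.eq_iff hV).2 (negligible_of_zero_order (hU.sub hV).mem h)

theorem LogNet.mem {l : Eps → ℝ} (hS : IsScale S) (hl : LogNet S l) (h0 : ∀ᶠ ε in toZero, 0 ≤ l ε) : l ∈ S := by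
  refine hS.mono (hl 1 zero_le_one) (h0.mono fun ε h => ?_)
  rw [abs_of_nonneg h, abs_of_pos (Real.exp_pos _), one_mul]
  linarith [Real.add_one_le_exp (l ε)]

theorem cBounded_time_prod {Γ : Eps → FlowSp n → Sp n} (hΓ : CBounded Γ) :
    CBounded fun ε p => ((p.2.2, Γ ε p) : ℝ × Sp n) := by
  intro K hK
  obtain ⟨L, hL, h⟩ := hΓ K hK
  exact ⟨_, (hK.image (endTime (Sp n)).continuous).prod hL, h.mono fun ε h p hp =>
    ⟨⟨p, hp, rfl⟩, h p hp⟩⟩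

/-- The residual of a representative of a solution of the characteristic system. -/
theorem CoeffNet.nullNet_residual (hS : IsScale S) (hSm : S ⊆ modScale) (hA : CoeffNet S R A)
    (hAa : ∀ j, IsRep (fun ε z => (A j ε z : ℂ)) (a j)) {γ : Fin n → G (FlowSp n)}
    (hγ : IsCharacteristic a γ) {Γ : Eps → FlowSp n → Sp n} (hΓ : IsFlowRep γ Γ) :
    NullNet fun ε p => fderiv ℝ (Γ ε) p ((0 : Sp n), (0 : ℝ), (1 : ℝ)) -
      vecField A ε (p.2.2, Γ ε p) := by
  refine nullNet_of_apply fun j => ?_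
  -- The equation is only known for some representatives F and Γ'. The residual is a sum of three
  -- null nets: the error of the equation itself, F - A_j along the c-bounded Γ', and the exchange
  -- of Γ' for Γ, controlled by the logarithmic Lipschitz constant of the field.
  obtain ⟨w, ⟨F, Γ', hF, hΓ', hw⟩, hode⟩ := hγ.ode j
  have h1 := (hΓ.1 j).pd ((0 : Sp n), (0 : ℝ), (1 : ℝ))
  rw [hode] at h1
  have h2 := h1.nullNet_sub hw.neg
  have h3 := (hF.nullNet_sub (hAa j)).comp (cBounded_time_prod hΓ'.2)
  have h4 : NullNet fun ε p => vecField A ε (p.2.2, Γ' ε p) - vecField A ε (p.2.2, Γ ε p) := by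
    refine (hΓ'.nullNet_sub hΓ).of_bound fun K hK => ?_
    obtain ⟨T, -, hT⟩ := exists_abs_time_le hK
    obtain ⟨μ, hμ, l, hl, hb⟩ := hA.exists_fieldBound hS T 0
    refine ⟨K, hK, l, hSm (hl.mem hS (hb.mono fun ε h => h.nonneg)), hb.mono fun ε hb δ _ hδ p hp => ?_⟩
    exact (hb.norm_sub_le (hA.isBddField hS ε).smooth (hT p hp).2.2 _ _).trans
      (mul_le_mul_of_nonneg_left (hδ p hp) hb.nonneg)
  have h5 : NullNet fun ε p => (((vecField A ε (p.2.2, Γ' ε p) - vecField A ε (p.2.2, Γ ε p)) j : ℝ) : ℂ) :=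
    h4.mono fun ε p => by
      rw [Complex.norm_real]
      exact PiLp.norm_apply_le _ j
  refine ((h2.add h3.neg).add h5).mono fun ε p => ?_
  rw [← Complex.norm_real]
  refine le_of_eq (congrArg norm ?_)
  have hd := (hΓ.contDiff ε).differentiable (by simp) p
  simp only [Pi.neg_apply, PiLp.sub_apply, vecField_apply]
  rw [fderiv_ofReal_apply_coord hd]
  push_cast
  ring

/-- Gronwall compares a representative of any solution with the exact flow. The factor e^{2TΛ} is
moderate, since Λ is logarithmic, so null initial error and null residual give a null difference. -/
theorem CoeffNet.characteristic_unique (hS : IsScale S) (hSm : S ⊆ modScale) (hA : CoeffNet S R A)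
    (hAa : ∀ j, IsRep (fun ε z => (A j ε z : ℂ)) (a j)) {γ : Fin n → G (FlowSp n)}
    (hγ : ∀ h, IsRep (fun ε p => ((flow (vecField A ε) p h : ℝ) : ℂ)) (γ h))
    {γ' : Fin n → G (FlowSp n)} (hγ' : IsCharacteristic a γ') : γ' = γ := by
  funext h
  obtain ⟨-, ⟨-, Γ, -, hΓ, -⟩, -⟩ := hγ'.ode h
  have hinit : NullNet fun ε (p : FlowSp n) => Γ ε (p.1, p.2.1, p.2.1) - p.1 := by
    refine nullNet_of_apply fun j => ?_
    have h1 := (hΓ.1 j).pull (diagMap n)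
    rw [hγ'.init j] at h1
    have h2 : IsRep _ (pull (ContinuousLinearMap.fst ℝ (Sp n) ℝ) (coord j)) :=
      (isRep_ofSmooth (contDiff_coordFn j)).pull _
    refine ((h1.nullNet_sub h2).comp_continuous (g := fun p : FlowSp n => (p.1, p.2.1))
      (by fun_prop)).mono fun ε p => le_of_eq ?_
    simp [diagMap, coordFn, ← Complex.ofReal_sub]
  have hres := hA.nullNet_residual hS hSm hAa hγ' hΓ
  have hdiff : NullNet fun ε p => Γ ε p - flow (vecField A ε) p := by
    -- Pairing the two null nets lets one number δ dominate both the initial error and the residual.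
    refine (hinit.prodMk hres).of_bound fun K hK => ?_
    obtain ⟨T, hT0, hT⟩ := exists_abs_time_le hK
    obtain ⟨μ, hμ, l, hl, hb⟩ := hA.exists_fieldBound hS T 0
    refine ⟨Metric.closedBall 0 T ×ˢ Set.Icc (-T) T ×ˢ Set.Icc (-T) T,
      (isCompact_closedBall _ _).prod (isCompact_Icc.prod isCompact_Icc),
      fun ε => (1 + 2 * T) * Real.exp (2 * T * l ε), hSm (hS.const_mul_mem _
        (hl (2 * T) (by positivity))), hb.mono fun ε hb δ hδ0 hδ => ?_⟩
    rintro ⟨x, t, s⟩ hp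
    obtain ⟨hx, ht, hs⟩ := hT _ hp
    have hmem : ∀ r, |r| ≤ T → (x, t, r) ∈
        Metric.closedBall (0 : Sp n) T ×ˢ Set.Icc (-T) T ×ˢ Set.Icc (-T) T := fun r hr =>
      ⟨by simpa using hx, abs_le.1 ht, abs_le.1 hr⟩
    have hf := hA.isBddField hS ε
    have hder : ∀ r, HasDerivAt (fun r => Γ ε (x, t, r))
        (fderiv ℝ (Γ ε) (x, t, r) ((0 : Sp n), (0 : ℝ), (1 : ℝ))) r := fun r => by
      have h1 : HasDerivAt (fun r => (x, t, r)) ((0 : Sp n), (0 : ℝ), (1 : ℝ)) r :=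
        (hasDerivAt_const _ _).prodMk ((hasDerivAt_const _ _).prodMk (hasDerivAt_id _))
      exact ((hΓ.contDiff ε).differentiable (by simp) (x, t, r)).hasFDerivAt.comp_hasDerivAt r h1
    have key := norm_le_of_norm_deriv_le (t := t) (s := s) (K := l ε) (δ := δ)
      (fun r => (hder r).sub (hasDerivAt_flow hf x t r)) hb.nonneg hδ0 fun r hr => by
        have hr' : |r| ≤ T := abs_le.2 (Set.uIcc_subset_Icc (abs_le.1 ht) (abs_le.1 hs) hr)
        have h1 := (norm_snd_le _).trans (hδ _ (hmem r hr'))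
        have h2 := hb.norm_sub_le hf.smooth hr' (flow (vecField A ε) (x, t, r)) (Γ ε (x, t, r))
        refine (norm_sub_le_norm_sub_add_norm_sub _ (vecField A ε (r, Γ ε (x, t, r))) _).trans ?_
        rw [add_comm]
        exact add_le_add h2 h1
    have h0 : ‖Γ ε (x, t, t) - x‖ ≤ δ := (norm_fst_le _).trans (hδ _ (hmem s hs))
    have hd : |s - t| ≤ 2 * T := (abs_sub _ _).trans (by linarith)
    have hl0 := hb.nonneg
    simp only [Pi.sub_apply, flow_self hf] at key
    refine key.trans ?_
    calc _ ≤ (δ + δ * (2 * T)) * Real.exp (l ε * (2 * T)) := by gcongr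
      _ = _ := by ring_nf
  refine eq_of_nullNet_sub (hΓ.1 h) (hγ h) (hdiff.mono fun ε p => ?_)
  rw [← Complex.ofReal_sub, Complex.norm_real]
  exact PiLp.norm_apply_le (Γ ε p - flow (vecField A ε) p) h

/-- The derivative of a function along a characteristic. -/
theorem hasDerivAt_comp_flow {f : ℝ × Sp n → Sp n} (hf : IsBddField f) {F : Type*}
    [NormedAddCommGroup F] [NormedSpace ℝ F] {w : ℝ × Sp n → F} (hw : Differentiable ℝ w)
    (x : Sp n) (t s : ℝ) : HasDerivAt (fun s => w (s, flow f (x, t, s)))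
      (fderiv ℝ w (s, flow f (x, t, s)) (1, f (s, flow f (x, t, s)))) s :=
  (hw _).hasFDerivAt.comp_hasDerivAt s ((hasDerivAt_id s).prodMk (hasDerivAt_flow hf x t s))

/-- The derivative in the characteristic direction (1, f) is the transport operator ∂_t - ∑ a_j ∂_j.
-/
theorem fderiv_one_vecField {F : Type*} [NormedAddCommGroup F] [NormedSpace ℝ F]
    (L : ℝ × Sp n →L[ℝ] F) (ε : Eps) (z : ℝ × Sp n) :
    L (1, vecField A ε z) = L (1, 0) - ∑ j, A j ε z • L (0, e j) := by
  have h : ((1 : ℝ), vecField A ε z) = ((1 : ℝ), (0 : Sp n)) - ∑ j, A j ε z • ((0 : ℝ), e j) := by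
    ext1
    · simp [Prod.fst_sum]
    · simp [Prod.snd_sum, vecField]
  rw [h, map_sub, map_sum]
  simp only [map_smul]

/-- Along a characteristic a representative satisfies W' = i a₀ W up to a null net, with null
initial value. The Gronwall factor is the exponential of a bound of a₀, moderate because a₀ is
logarithmic. -/
theorem CoeffNet.eq_zero_of_solvesCauchy (hS : IsScale S) (hSm : S ⊆ modScale)
    (hA : CoeffNet S R A) (hAa : ∀ j, IsRep (fun ε z => (A j ε z : ℂ)) (a j))
    {a₀ : G (ℝ × Sp n)} {A₀ : Eps → ℝ × Sp n → ℂ} (hA₀ : IsRep A₀ a₀) (hl₀ : LogBound S A₀)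
    {w : G (ℝ × Sp n)} (hw : SolvesCauchy a a₀ 0 w) : w = 0 := by
  obtain ⟨W, hW⟩ := exists_isRep w
  have h1 := hW.D ((1 : ℝ), (0 : Sp n))
  rw [hw.1] at h1
  have hres := h1.nullNet_sub ((IsRep.sum Finset.univ fun j =>
    (hAa j).mul (hW.D ((0 : ℝ), e j))).add (hA₀.mul hW))
  have h2 := hW.pull (ContinuousLinearMap.inr ℝ ℝ (Sp n))
  change IsRep _ (atTimeZero w) at h2
  rw [hw.2] at h2
  have hinit := (h2.nullNet_sub isRep_zero).comp_continuous (g := fun z : ℝ × Sp n => z.2)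
    (by fun_prop)
  refine eq_of_nullNet_sub hW isRep_zero ((hinit.prodMk hres).of_bound fun K hK => ?_)
  obtain ⟨T, hT0, hT⟩ := hK.isBounded.exists_pos_norm_le
  -- Characteristics through points with ‖x‖ ≤ T stay in the ball of radius max T R.
  have hK' := isCompact_timeStrip (n := n) T (max T R)
  obtain ⟨l, hl, hb⟩ := hl₀ _ hK'
  refine ⟨_, hK', fun ε => (1 + T) * Real.exp (T * max (l ε) 0), ?_, ?_⟩
  · exact hSm (hS.const_mul_mem _ (hl.max_zero hS T hT0.le))
  · refine hb.mono fun ε hb δ hδ0 hδ => ?_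
    rintro ⟨t, x⟩ hz
    have ht : |t| ≤ T := (norm_fst_le _).trans (hT _ hz)
    have hx : ‖x‖ ≤ T := (norm_snd_le _).trans (hT _ hz)
    have hf := hA.isBddField hS ε
    have hmem : ∀ r, |r| ≤ T → (r, flow (vecField A ε) (x, t, r)) ∈
        Set.Icc (-T) T ×ˢ Metric.closedBall (0 : Sp n) (max T R) := fun r hr =>
      ⟨abs_le.1 hr, by
        rw [mem_closedBall_zero_iff]
        exact (norm_flow_le hf (hA.vecField_outside ε) x t r).trans (max_le_max_right _ hx)⟩
    have key := norm_le_of_norm_deriv_le (t := 0) (s := t) (K := max (l ε) 0) (δ := δ)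
      (fun r => hasDerivAt_comp_flow hf ((hW.contDiff ε).differentiable (by simp)) x t r)
      (le_max_right _ _) hδ0 fun r hr => by
        have hr' : |r| ≤ T := abs_le.2 (Set.uIcc_subset_Icc ⟨by linarith, hT0.le⟩ (abs_le.1 ht) hr)
        have h3 := (norm_snd_le _).trans (hδ _ (hmem r hr'))
        have h4 := (hb _ (hmem r hr')).trans (le_max_left _ 0)
        generalize (r, flow (vecField A ε) (x, t, r)) = z at h3 h4 ⊢
        rw [fderiv_one_vecField]
        -- Multiplying the equation in D = -i∂ by i isolates the derivative along the
        -- characteristic: i a₀ W plus i times the residual.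
        have h5 : fderiv ℝ (W ε) z (1, 0) - ∑ j, A j ε z • fderiv ℝ (W ε) z (0, e j) =
            Complex.I * (A₀ ε z * W ε z) + Complex.I * (-Complex.I * fderiv ℝ (W ε) z (1, 0) -
              (∑ j, (A j ε z : ℂ) * (-Complex.I * fderiv ℝ (W ε) z (0, e j)) + A₀ ε z * W ε z)) := by
          have : ∑ j, (A j ε z : ℂ) * (-Complex.I * fderiv ℝ (W ε) z (0, e j)) =
              -Complex.I * ∑ j, A j ε z • fderiv ℝ (W ε) z (0, e j) := by
            rw [Finset.mul_sum]
            refine Finset.sum_congr rfl fun j _ => ?_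
            rw [Complex.real_smul]
            ring
          rw [this]
          linear_combination (fderiv ℝ (W ε) z (1, 0) -
            ∑ j, A j ε z • fderiv ℝ (W ε) z (0, e j)) * Complex.I_mul_I
        rw [h5]
        refine (norm_add_le _ _).trans (add_le_add ?_ ?_)
        · rw [norm_mul, norm_mul, Complex.norm_I, one_mul]
          exact mul_le_mul_of_nonneg_right h4 (norm_nonneg _)
        · rw [norm_mul, Complex.norm_I, one_mul]
          simpa using h3
    have h0 : ‖W ε (0, flow (vecField A ε) (x, t, 0))‖ ≤ δ := by
      simpa using (norm_fst_le _).trans (hδ _ (hmem 0 (by simpa using hT0.le)))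
    simp only [flow_self hf, sub_zero] at key
    have h6 : 0 ≤ max (l ε) 0 := le_max_right _ _
    simp only [Pi.zero_apply, sub_zero]
    refine key.trans ?_
    calc _ ≤ (δ + δ * T) * Real.exp (max (l ε) 0 * T) := by gcongr
      _ = _ := by ring_nf

theorem CoeffNet.solvesCauchy_unique (hS : IsScale S) (hSm : S ⊆ modScale)
    (hA : CoeffNet S R A) (hAa : ∀ j, IsRep (fun ε z => (A j ε z : ℂ)) (a j))
    {a₀ : G (ℝ × Sp n)} {A₀ : Eps → ℝ × Sp n → ℂ} (hA₀ : IsRep A₀ a₀) (hl₀ : LogBound S A₀)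
    {u₀ : G (Sp n)} {u v : G (ℝ × Sp n)} (hu : SolvesCauchy a a₀ u₀ u)
    (hv : SolvesCauchy a a₀ u₀ v) : u = v := by
  have hD : ∀ w, D w (u - v) = D w u - D w v := fun w => by
    rw [D, D, D, map_sub, smul_sub]
  refine sub_eq_zero.1 (hA.eq_zero_of_solvesCauchy hS hSm hAa hA₀ hl₀ ⟨?_, ?_⟩)
  · simp only [hD, hu.1, hv.1, mul_sub, Finset.sum_sub_distrib]
    abel
  · have h1 := hu.2
    have h2 := hv.2
    rw [atTimeZero] at h1 h2 ⊢
    rw [RingHom.map_sub, h1, h2, sub_self]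

end Uniqueness

/-! ### Solutions of the transport equations -/

section Solutions

variable {n : ℕ} {S : Set (Eps → ℝ)} {R : ℝ} {A : Fin n → Eps → ℝ × Sp n → ℝ}
  {a : Fin n → G (ℝ × Sp n)} {a₀ : G (ℝ × Sp n)} {A₀ : Eps → ℝ × Sp n → ℂ}

/-- For solutions built from the flow the equation holds exactly for each ε, so an identity along
characteristics suffices and no error terms arise. -/
theorem solvesCauchy_of_fderiv (hAa : ∀ j, IsRep (fun ε z => (A j ε z : ℂ)) (a j))
    (hA₀ : IsRep A₀ a₀) {u₀ : G (Sp n)} {U₀ : Eps → Sp n → ℂ} (hU₀ : IsRep U₀ u₀)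
    {u : G (ℝ × Sp n)} {U : Eps → ℝ × Sp n → ℂ} (hU : IsRep U u)
    (h : ∀ ε z, fderiv ℝ (U ε) z (1, vecField A ε z) = Complex.I * A₀ ε z * U ε z)
    (h0 : ∀ ε x, U ε (0, x) = U₀ ε x) : SolvesCauchy a a₀ u₀ u := by
  constructor
  · refine IsRep.unique (hU.D _) ?_
    convert (IsRep.sum Finset.univ fun j => (hAa j).mul (hU.D ((0 : ℝ), e j))).add
      (hA₀.mul hU) using 1
    ext ε z
    have h1 := h ε z
    rw [fderiv_one_vecField] at h1
    have h2 : ∑ j, (A j ε z : ℂ) * (-Complex.I * fderiv ℝ (U ε) z (0, e j)) =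
        -Complex.I * ∑ j, A j ε z • fderiv ℝ (U ε) z (0, e j) := by
      rw [Finset.mul_sum]
      refine Finset.sum_congr rfl fun j _ => ?_
      rw [Complex.real_smul]
      ring
    simp only [Pi.add_apply, Finset.sum_apply, Pi.mul_apply]
    rw [h2]
    linear_combination -Complex.I * h1 - A₀ ε z * U ε z * Complex.I_mul_I
  · refine IsRep.unique (hU.pull (ContinuousLinearMap.inr ℝ ℝ (Sp n))) ?_
    convert hU₀ using 1
    ext ε x
    simp [h0]

/-- The position at time `0` of the characteristic through `(t,x)`. -/
noncomputable def footPoint (A : Fin n → Eps → ℝ × Sp n → ℝ) (ε : Eps) (z : ℝ × Sp n) : Sp n :=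
  flow (vecField A ε) (z.2, z.1, 0)

theorem CoeffNet.sBound_footPoint (hS : IsScale S) (hA : CoeffNet S R A) :
    SBound S (footPoint A) :=
  (hA.sBound_flow hS).comp_linear hS (toFlowZero n)

theorem CoeffNet.cBounded_footPoint (hS : IsScale S) (hA : CoeffNet S R A) :
    CBounded (footPoint A) := fun K hK => by
  obtain ⟨L, hL, h⟩ := hA.cBounded_flow hS _ (hK.image (toFlowZero n).continuous)
  exact ⟨L, hL, h.mono fun ε h p hp => h _ ⟨p, hp, rfl⟩⟩

theorem CoeffNet.footPoint_zero (hS : IsScale S) (hA : CoeffNet S R A) (ε : Eps) (x : Sp n) :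
    footPoint A ε (0, x) = x := flow_self (hA.isBddField hS ε) x 0

theorem CoeffNet.fderiv_footPoint (hS : IsScale S) (hA : CoeffNet S R A) (ε : Eps)
    (z : ℝ × Sp n) : fderiv ℝ (footPoint A ε) z (1, vecField A ε z) = 0 := by
  have hf := hA.isBddField hS ε
  have h1 : HasFDerivAt (footPoint A ε)
      ((fderiv ℝ (flow (vecField A ε)) (toFlowZero n z)).comp (toFlowZero n)) z :=
    ((contDiff_flow hf).differentiable (by simp) _).hasFDerivAt.comp z
      (toFlowZero n).hasFDerivAt
  rw [h1.fderiv]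
  exact fderiv_flow_transport hf z.2 z.1 0

/-- The net `∫_0^t a₀(s, γ(x,t,s)) ds`. -/
noncomputable def sourceInt (A : Fin n → Eps → ℝ × Sp n → ℝ) (A₀ : Eps → ℝ × Sp n → ℂ) (ε : Eps)
    (z : ℝ × Sp n) : ℂ :=
  ∫ s in (0 : ℝ)..z.1, A₀ ε (s, flow (vecField A ε) (z.2, z.1, s))

/-- `flowInt` integrates from t to the end time 0, which accounts for the sign. This form inherits
its smoothness and growth estimates. -/
theorem sourceInt_eq (ε : Eps) (z : ℝ × Sp n) : sourceInt A A₀ ε z =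
    -flowInt (fun p => A₀ ε (p.2.2, flow (vecField A ε) p)) (toFlowZero n z) :=
  intervalIntegral.integral_symm _ _

theorem CoeffNet.sBound_along (hS : IsScale S) (hA : CoeffNet S R A) (hs₀ : SBound S A₀) :
    SBound S fun ε p => A₀ ε (p.2.2, flow (vecField A ε) p) :=
  hs₀.comp hS (SBound.prodMk hS (sBound_const hS (endTime (Sp n)).contDiff) (hA.sBound_flow hS))
    (cBounded_time_prod (hA.cBounded_flow hS))

theorem CoeffNet.sBound_sourceInt (hS : IsScale S) (hA : CoeffNet S R A) (hs₀ : SBound S A₀) :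
    SBound S (sourceInt A A₀) := by
  have h := (((hA.sBound_along hS hs₀).flowInt hS).comp_linear hS (toFlowZero n)).linear_comp hS
    (-ContinuousLinearMap.id ℝ ℂ)
  have he : sourceInt A A₀ = fun ε x => (-ContinuousLinearMap.id ℝ ℂ)
      (flowInt (fun p => A₀ ε (p.2.2, flow (vecField A ε) p)) (toFlowZero n x)) := by
    ext ε z
    rw [sourceInt_eq]
    rfl
  rwa [he]

theorem LogBound.comp {X Y F : Type*} [NormedAddCommGroup X] [NormedAddCommGroup Y]
    [NormedAddCommGroup F] {u : Eps → Y → F} {Γ : Eps → X → Y}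
    (hu : LogBound S u) (hΓ : CBounded Γ) : LogBound S fun ε x => u ε (Γ ε x) := fun K hK => by
  obtain ⟨L, hL, h⟩ := hΓ K hK
  obtain ⟨l, hl, h'⟩ := hu L hL
  refine ⟨l, hl, ?_⟩
  filter_upwards [h, h'] with ε h h' x hx using h' _ (h x hx)

theorem CoeffNet.logBound_sourceInt (hS : IsScale S) (hA : CoeffNet S R A) (hs₀ : SBound S A₀)
    (hl₀ : LogBound S A₀) : LogBound S (sourceInt A A₀) := by
  have h1 := LogBound.flowInt (hA.sBound_along hS hs₀).contDiff hS
    (hl₀.comp (cBounded_time_prod (hA.cBounded_flow hS)))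
  have h2 := h1.comp (Γ := fun _ => toFlowZero n) fun K hK =>
    ⟨_, hK.image (toFlowZero n).continuous, Eventually.of_forall fun _ x hx => ⟨x, hx, rfl⟩⟩
  intro K hK
  obtain ⟨l, hl, h⟩ := h2 K hK
  refine ⟨l, hl, h.mono fun ε h z hz => ?_⟩
  rw [sourceInt_eq, norm_neg]
  exact h z hz

/-- Moving along one characteristic leaves the integrand unchanged, by the group law, and only the
upper limit varies; the fundamental theorem of calculus gives the value a₀. -/
theorem CoeffNet.fderiv_sourceInt (hS : IsScale S) (hA : CoeffNet S R A) (hs₀ : SBound S A₀)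
    (ε : Eps) (z : ℝ × Sp n) :
    fderiv ℝ (sourceInt A A₀ ε) z (1, vecField A ε z) = A₀ ε z := by
  have hf := hA.isBddField hS ε
  obtain ⟨t, x⟩ := z
  have h1 := hasDerivAt_comp_flow hf
    (((hA.sBound_sourceInt hS hs₀).contDiff ε).differentiable (by simp)) x t t
  have h2 : (fun s => sourceInt A A₀ ε (s, flow (vecField A ε) (x, t, s))) =
      fun s => ∫ r in (0 : ℝ)..s, A₀ ε (r, flow (vecField A ε) (x, t, r)) := by
    ext s
    simp only [sourceInt, flow_flow hf]
  have hc : Continuous fun r => A₀ ε (r, flow (vecField A ε) (x, t, r)) :=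
    (hs₀.contDiff ε).continuous.comp (continuous_id.prodMk
      ((contDiff_flow hf).continuous.comp (by fun_prop)))
  rw [h2] at h1
  have h3 := h1.unique (intervalIntegral.integral_hasDerivAt_right (hc.intervalIntegrable _ _)
    hc.stronglyMeasurable.stronglyMeasurableAtFilter hc.continuousAt)
  rwa [flow_self hf] at h3

/-- The amplitude `e^{iβ}`. -/
noncomputable def amplitude (A : Fin n → Eps → ℝ × Sp n → ℝ) (A₀ : Eps → ℝ × Sp n → ℂ) (ε : Eps)
    (z : ℝ × Sp n) : ℂ :=
  Complex.exp (Complex.I * sourceInt A A₀ ε z)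

/-- The integral β inherits the logarithmic bound of a₀, as its time interval is bounded on compact
sets. Hence e^{iβ} stays within the scale. -/
theorem CoeffNet.sBound_amplitude (hS : IsScale S) (hA : CoeffNet S R A) (hs₀ : SBound S A₀)
    (hl₀ : LogBound S A₀) : SBound S (amplitude A A₀) := by
  refine SBound.cexp hS ((sBound_const hS contDiff_const).mul hS (hA.sBound_sourceInt hS hs₀))
    fun K hK => ?_
  obtain ⟨l, hl, h⟩ := hA.logBound_sourceInt hS hs₀ hl₀ K hK
  exact ⟨l, hl, h.mono fun ε h z hz => by simpa using h z hz⟩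

theorem CoeffNet.fderiv_amplitude (hS : IsScale S) (hA : CoeffNet S R A) (hs₀ : SBound S A₀)
    (ε : Eps) (z : ℝ × Sp n) : fderiv ℝ (amplitude A A₀ ε) z (1, vecField A ε z) =
      Complex.I * A₀ ε z * amplitude A A₀ ε z := by
  have h1 : HasFDerivAt (amplitude A A₀ ε) _ z :=
    ((((hA.sBound_sourceInt hS hs₀).contDiff ε).differentiable
      (by simp) z).hasFDerivAt.const_mul Complex.I).cexp
  rw [h1.fderiv]
  simp only [smul_apply, smul_eq_mul, hA.fderiv_sourceInt hS hs₀, amplitude]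
  ring

theorem amplitude_zero (ε : Eps) (x : Sp n) : amplitude A A₀ ε (0, x) = 1 := by
  simp [amplitude, sourceInt]

theorem CoeffNet.isExpIntegral (hS : IsScale S) (hSm : S ⊆ modScale) (hA : CoeffNet S R A)
    (hA₀ : IsRep A₀ a₀) (hs₀ : SBound S A₀) {γ : Fin n → G (FlowSp n)}
    (hγ : ∀ h, IsRep (fun ε p => ((flow (vecField A ε) p h : ℝ) : ℂ)) (γ h))
    {b : G (ℝ × Sp n)} (hb : IsRep (amplitude A A₀) b) : IsExpIntegral a₀ γ b :=
  have h := isRep_mk ((hA.sBound_sourceInt hS hs₀).mem_moderate hSm)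
  ⟨A₀, _, _, sourceInt A A₀, hA₀, hA.isFlowRep hS hγ, h, h, hb⟩

theorem CoeffNet.solvesCauchy_amplitude (hS : IsScale S) (hA : CoeffNet S R A)
    (hAa : ∀ j, IsRep (fun ε z => (A j ε z : ℂ)) (a j)) (hA₀ : IsRep A₀ a₀) (hs₀ : SBound S A₀)
    {b : G (ℝ × Sp n)} (hb : IsRep (amplitude A A₀) b) : SolvesCauchy a a₀ 1 b :=
  solvesCauchy_of_fderiv hAa hA₀ isRep_one hb (hA.fderiv_amplitude hS hs₀) amplitude_zero

/-- The first factor is constant along characteristics because the foot point is, so the product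
satisfies the same equation as the amplitude. -/
theorem CoeffNet.solvesCauchy_mul_amplitude (hS : IsScale S) (hA : CoeffNet S R A)
    (hAa : ∀ j, IsRep (fun ε z => (A j ε z : ℂ)) (a j)) (hA₀ : IsRep A₀ a₀) (hs₀ : SBound S A₀)
    {u₀ : G (Sp n)} {U₀ : Eps → Sp n → ℂ} (hU₀ : IsRep U₀ u₀) {u : G (ℝ × Sp n)}
    (hu : IsRep (fun ε z => U₀ ε (footPoint A ε z) * amplitude A A₀ ε z) u)
    (hB : ∀ ε, Differentiable ℝ (amplitude A A₀ ε)) : SolvesCauchy a a₀ u₀ u := by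
  refine solvesCauchy_of_fderiv hAa hA₀ hU₀ hu (fun ε z => ?_) fun ε x => ?_
  · have h1 : HasFDerivAt (fun z => U₀ ε (footPoint A ε z)) _ z :=
      ((hU₀.contDiff ε).differentiable (by simp) _).hasFDerivAt.comp z
        (((hA.sBound_footPoint hS).contDiff ε).differentiable (by simp) z).hasFDerivAt
    rw [(h1.fun_mul (hB ε z).hasFDerivAt).fderiv]
    simp only [add_apply, smul_apply, smul_eq_mul,
      ContinuousLinearMap.comp_apply, hA.fderiv_footPoint hS, map_zero, mul_zero, add_zero,
      hA.fderiv_amplitude hS hs₀]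
    ring
  · rw [hA.footPoint_zero hS, amplitude_zero, mul_one]

/-! ### The phase function -/

/-- The net `∑_h γ_h(x,t,0) η_h`. -/
noncomputable def phaseNet (A : Fin n → Eps → ℝ × Sp n → ℝ) (ε : Eps) (p : PhaseSp n) : ℝ :=
  inner ℝ (footPoint A ε (p.1, p.2.1)) p.2.2

theorem CoeffNet.sBound_phaseNet (hS : IsScale S) (hA : CoeffNet S R A) :
    SBound S fun ε p => (phaseNet A ε p : ℂ) := by
  have h1 := (hA.sBound_footPoint hS).comp_linear hS (toTX n)
  have h2 : SBound S fun ε p => ∑ h, footPoint A ε (toTX n p) h * toEta n p h :=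
    SBound.sum hS _ fun h => SBound.bilinear hS (ContinuousLinearMap.mul ℝ ℝ)
      (h1.linear_comp hS (EuclideanSpace.proj (𝕜 := ℝ) h))
      (sBound_const hS ((EuclideanSpace.proj (𝕜 := ℝ) h).comp (toEta n)).contDiff)
  have h3 := h2.linear_comp hS Complex.ofRealCLM
  have he : (fun ε p => (phaseNet A ε p : ℂ)) = fun ε p =>
      Complex.ofRealCLM (∑ h, footPoint A ε (toTX n p) h * toEta n p h) := by
    ext ε p
    rw [phaseNet, PiLp.inner_apply, Complex.ofRealCLM_apply]
    congr 1
    refine Finset.sum_congr rfl fun h _ => ?_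
    rw [real_inner_comm]
    simp [toTX, toEta]
  rwa [he]

theorem isRep_phase {γ : Fin n → G (FlowSp n)}
    (hγ : ∀ h, IsRep (fun ε p => ((flow (vecField A ε) p h : ℝ) : ℂ)) (γ h)) :
    IsRep (fun ε p => (phaseNet A ε p : ℂ)) (phase γ) := by
  have h1 : IsRep _ (phase γ) := IsRep.sum Finset.univ fun h =>
    (((hγ h).pull (toFlowZero n)).pull (toTX n)).mul
      ((isRep_ofSmooth (contDiff_coordFn h)).pull (toEta n))
  convert h1 using 1
  ext ε p
  simp only [Finset.sum_apply, Pi.mul_apply, phaseNet, PiLp.inner_apply]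
  push_cast
  refine Finset.sum_congr rfl fun h _ => ?_
  simp [coordFn, toFlowZero, toTX, toEta, footPoint, mul_comm]

/-- Constancy of the foot point along characteristics, paired with the fixed vector η. -/
theorem CoeffNet.solvesEikonal (hS : IsScale S) (hA : CoeffNet S R A)
    (hAa : ∀ j, IsRep (fun ε z => (A j ε z : ℂ)) (a j)) {φ : G (PhaseSp n)}
    (hφ : IsRep (fun ε p => (phaseNet A ε p : ℂ)) φ) : SolvesEikonal a φ := by
  have hd : ∀ ε p τ ξ, fderiv ℝ (fun p => (phaseNet A ε p : ℂ)) p (τ, ξ, (0 : Sp n)) =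
      ((inner ℝ (fderiv ℝ (footPoint A ε) (toTX n p) (τ, ξ)) p.2.2 : ℝ) : ℂ) := fun ε p τ ξ => by
    have h1 : HasFDerivAt (fun p => footPoint A ε (p.1, p.2.1))
        ((fderiv ℝ (footPoint A ε) (toTX n p)).comp (toTX n)) p :=
      (((hA.sBound_footPoint hS).contDiff ε).differentiable (by simp) _).hasFDerivAt.comp p
        (toTX n).hasFDerivAt
    have h2 : HasFDerivAt (fun p => (phaseNet A ε p : ℂ)) _ p :=
      Complex.ofRealCLM.hasFDerivAt.comp p (h1.inner ℝ (toEta n).hasFDerivAt)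
    rw [h2.fderiv]
    simp [toTX, toEta]
  constructor
  · refine IsRep.unique (hφ.pd _) ?_
    convert IsRep.sum Finset.univ fun j => ((hAa j).pull (toTX n)).mul
      (hφ.pd ((0 : ℝ), e j, (0 : Sp n))) using 1
    ext ε p
    simp only [Finset.sum_apply, Pi.mul_apply, hd, Function.comp_apply, ← Complex.ofReal_mul,
      ← Complex.ofReal_sum]
    congr 1
    have h3 := hA.fderiv_footPoint hS ε (toTX n p)
    rw [fderiv_one_vecField, sub_eq_zero] at h3
    rw [h3, sum_inner]
    refine Finset.sum_congr rfl fun j _ => ?_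
    rw [real_inner_smul_left]
  · refine IsRep.unique (hφ.pull (ContinuousLinearMap.inr ℝ ℝ (Sp n × Sp n))) ?_
    convert IsRep.sum Finset.univ fun h =>
      ((isRep_ofSmooth (contDiff_coordFn h)).pull (ContinuousLinearMap.fst ℝ (Sp n) (Sp n))).mul
      ((isRep_ofSmooth (contDiff_coordFn h)).pull (ContinuousLinearMap.snd ℝ (Sp n) (Sp n))) using 1
    · ext ε p
      simp only [Finset.sum_apply, Pi.mul_apply, Function.comp_apply, phaseNet,
        ContinuousLinearMap.inr_apply, hA.footPoint_zero hS, PiLp.inner_apply]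
      push_cast
      refine Finset.sum_congr rfl fun h _ => ?_
      simp [coordFn, mul_comm]
    · rfl

end Solutions

/-! ### Phase functions that are linear in the frequency -/

section LinearPhase

/-- For a linear map, the weight ‖ξ‖^{-1} compensates the linear growth at order zero, order one is
the operator norm without weight, and higher orders vanish. -/
theorem homogeneous_seminorm_linear_le {Z W : Type*} [NormedAddCommGroup Z] [NormedSpace ℝ Z]
    [NormedAddCommGroup W] [NormedSpace ℝ W] (g : Z →ₗ[ℝ] W) {C : ℝ}
    (hg : ∀ ζ, ‖g ζ‖ ≤ C * ‖ζ‖) (k : ℕ) {ξ : Z} (hξ : ξ ≠ 0) :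
    ‖ξ‖ ^ ((k : ℤ) - 1) * ‖iteratedFDeriv ℝ k (fun ζ => g ζ) ξ‖ ≤ C := by
  have hξ' : 0 < ‖ξ‖ := norm_pos_iff.2 hξ
  have hC : 0 ≤ C := nonneg_of_mul_nonneg_left ((norm_nonneg _).trans (hg ξ)) hξ'
  set L := g.mkContinuous C hg with hL
  have hLg : (fun ζ => g ζ) = L := rfl
  have hfd : fderiv ℝ (fun ζ => g ζ) = fun _ => L := by
    rw [hLg]
    ext1 x
    exact L.fderiv
  rcases k with _ | _ | k
  · rw [norm_iteratedFDeriv_zero, Nat.cast_zero, zero_sub, zpow_neg_one, inv_mul_le_iff₀ hξ',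
      mul_comm]
    exact hg ξ
  · rw [← norm_iteratedFDeriv_fderiv, hfd, norm_iteratedFDeriv_zero]
    simpa using g.mkContinuous_norm_le hC hg
  · rw [← norm_iteratedFDeriv_fderiv, hfd, iteratedFDeriv_succ_const]
    simpa using hC

/-- Derivatives in (x, y) fall on v and leave a linear function of η, so the symbol seminorms of
every order in η are governed by derivatives of v. -/
theorem hgSeminorm_inner_le {X Y : Type*} [NormedAddCommGroup X] [NormedSpace ℝ X]
    [NormedAddCommGroup Y] [NormedSpace ℝ Y] {n : ℕ} {v : X × Y → Sp n} (hv : ContDiff ℝ ∞ v)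
    (k l : ℕ) (p : X × Y) {ξ : Sp n} (hξ : ξ ≠ 0) :
    hgSeminorm (fun x y η => (inner ℝ (v (x, y)) η : ℝ)) k l p.1 p.2 ξ ≤ ‖iteratedFDeriv ℝ l v p‖ := by
  have he : ∀ ζ : Sp n, iteratedFDeriv ℝ l (fun p : X × Y => (inner ℝ (v (p.1, p.2)) ζ : ℝ)) p =
      (innerSL ℝ ζ).compContinuousMultilinearMap (iteratedFDeriv ℝ l v p) := fun ζ => by
    have := (innerSL ℝ ζ).iteratedFDeriv_comp_left (hv.contDiffAt (x := p)) (natCast_le_infty l)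
    rw [← this]
    congr 1
    ext q
    simp [real_inner_comm]
  let g : Sp n →ₗ[ℝ] ((X × Y) [×l]→L[ℝ] ℝ) :=
    { toFun ζ := (innerSL ℝ ζ).compContinuousMultilinearMap (iteratedFDeriv ℝ l v p)
      map_add' ζ ζ' := by
        ext m
        simp
      map_smul' c ζ := by
        ext m
        simp }
  have := homogeneous_seminorm_linear_le g (C := ‖iteratedFDeriv ℝ l v p‖) (fun ζ => by
    refine ((innerSL ℝ ζ).norm_compContinuousMultilinearMap_le _).trans ?_
    rw [innerSL_apply_norm, mul_comm]) k hξ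
  rw [hgSeminorm]
  simp only [Prod.mk.eta] at he ⊢
  simp only [he]
  exact this

/-- The y-gradient of ⟨v - y, η⟩ is -η. The term -y·η alone thus gives a lower bound of the gradient
uniform in ε. -/
theorem sq_norm_le_gradSq {X : Type*} {n : ℕ} (v : X → Sp n) (x : X) (y ξ : Sp n) :
    ‖ξ‖ ^ 2 ≤ gradSq (fun x (y : Sp n) η => (inner ℝ (v x - y) η : ℝ)) x y ξ := by
  have h1 : HasFDerivAt (fun p : Sp n × Sp n => (inner ℝ (v x - p.1) p.2 : ℝ)) _ (y, ξ) :=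
    (hasFDerivAt_fst.const_sub (v x)).inner ℝ hasFDerivAt_snd
  rw [gradSq, h1.fderiv]
  refine pow_le_pow_left₀ (norm_nonneg _) ?_ 2
  rcases eq_or_ne ξ 0 with rfl | hξ
  · simp
  refine le_of_mul_le_mul_right ?_ (norm_pos_iff.2 hξ)
  -- Testing with the direction (ξ, 0), of norm ‖ξ‖, gives the value -‖ξ‖².
  have h2 := ContinuousLinearMap.le_opNorm (fderivInnerCLM ℝ (v x - y, ξ) ∘L
    (-ContinuousLinearMap.fst ℝ (Sp n) (Sp n)).prod (ContinuousLinearMap.snd ℝ (Sp n) (Sp n)))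
    (ξ, (0 : Sp n))
  have h3 : ‖(ξ, (0 : Sp n))‖ = ‖ξ‖ := by simp [Prod.norm_def]
  rw [h3] at h2
  refine le_trans (le_of_eq ?_) h2
  simp [← sq]

variable {n : ℕ} {V : Eps → ℝ × Sp n → Sp n}

theorem isPhaseNet_inner (hV : ∀ ε, ContDiff ℝ ∞ (V ε)) :
    IsPhaseNet fun ε p (y η : Sp n) => (inner ℝ (V ε p - y) η : ℝ) := by
  have hs : ∀ ε, ContDiff ℝ ∞ fun p : (ℝ × Sp n) × Sp n × Sp n =>
      (inner ℝ (V ε p.1 - p.2.1) p.2.2 : ℝ) := fun ε =>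
    (((hV ε).comp contDiff_fst).sub contDiff_snd.fst).inner ℝ contDiff_snd.snd
  refine ⟨fun ε => (hs ε).continuous, fun ε => (hs ε).contDiffOn, fun ε x y ξ r _ => ?_,
    fun ε x y ξ hξ => ?_⟩
  · exact real_inner_smul_right _ _ _
  · exact ((pow_pos (norm_pos_iff.2 hξ) 2).trans_le (sq_norm_le_gradSq (V ε) x y ξ)).ne'

theorem SBound.hgSeminorm_inner_le {S : Set (Eps → ℝ)} (hS : IsScale S) (hV : SBound S V)
    {K : Set ((ℝ × Sp n) × Sp n)} (hK : IsCompact K) (k l : ℕ) : ∃ μ ∈ S, ∀ᶠ ε in toZero,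
      ∀ p ∈ K, ∀ ξ : Sp n, ξ ≠ 0 →
        hgSeminorm (fun p (y η : Sp n) => (inner ℝ (V ε p - y) η : ℝ)) k l p.1 p.2 ξ ≤ μ ε := by
  have h1 := (hV.comp_linear hS (ContinuousLinearMap.fst ℝ (ℝ × Sp n) (Sp n))).add hS
    (sBound_const hS (-ContinuousLinearMap.snd ℝ (ℝ × Sp n) (Sp n)).contDiff)
  obtain ⟨μ, hμ, h⟩ := h1.bound K hK l
  refine ⟨μ, hμ, h.mono fun ε h p hp ξ hξ => ?_⟩
  refine le_trans (le_of_eq ?_) ((Colombeau.hgSeminorm_inner_le (h1.contDiff ε) k l p hξ).trans (h p hp))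
  simp [sub_eq_add_neg]

theorem SBound.isModeratePhase_inner {S : Set (Eps → ℝ)} (hS : IsScale S) (hSm : S ⊆ modScale)
    (hV : SBound S V) : IsModeratePhase fun ε p (y η : Sp n) => (inner ℝ (V ε p - y) η : ℝ) := by
  -- The squared gradient is at least 1 on the unit sphere, and ε ≤ 1, so the exponent r = 1 will
  -- do.
  refine ⟨isPhaseNet_inner hV.contDiff, fun K hK k l => ?_, fun K L _ _ => ⟨1, one_pos,
    Eventually.of_forall fun ε x _ y _ ξ hξ => ?_⟩⟩
  · obtain ⟨μ, hμ, h⟩ := hV.hgSeminorm_inner_le hS hK k l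
    obtain ⟨N, C, h'⟩ := hSm hμ
    refine ⟨N, C, ?_⟩
    filter_upwards [h, h'] with ε h h' p hp ξ hξ
    exact (h p hp ξ hξ).trans ((le_abs_self _).trans h')
  · have := sq_norm_le_gradSq (V ε) x y ξ
    rw [hξ, one_pow] at this
    rw [Real.rpow_one]
    exact ε.2.2.trans this

theorem SBound.isSlowScalePhase_inner (hV : SBound slowScale V) :
    IsSlowScalePhase fun ε p (y η : Sp n) => (inner ℝ (V ε p - y) η : ℝ) := by
  refine ⟨isPhaseNet_inner hV.contDiff, fun K hK k l => ?_, fun K L _ _ => ⟨fun _ => 1,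
    isScale_slowScale.const_mem 1, fun _ => one_pos,
    Eventually.of_forall fun ε x _ y _ ξ hξ => ?_⟩⟩
  · obtain ⟨μ, hμ, h⟩ := hV.hgSeminorm_inner_le isScale_slowScale hK k l
    refine ⟨μ, hμ, 1, h.mono fun ε h p hp ξ hξ => ?_⟩
    rw [one_mul]
    exact (h p hp ξ hξ).trans (le_abs_self _)
  · have := sq_norm_le_gradSq (V ε) x y ξ
    rwa [hξ, one_pow, ← inv_one] at this

end LinearPhase

/-! ### Fourier inversion -/

section Fourier

open scoped FourierTransform

variable {n : ℕ}

/-- Passes between the kernel e^{-iy·η} and the kernel e^{-2πi y·w} of `𝓕`. -/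
theorem fourierT_eq (f : Sp n → ℂ) (η : Sp n) : fourierT f η = 𝓕 f ((2 * Real.pi)⁻¹ • η) := by
  rw [Real.fourier_eq', fourierT]
  refine integral_congr_ae (Eventually.of_forall fun y => ?_)
  simp only [smul_eq_mul]
  congr 2
  rw [real_inner_smul_right]
  have : (Real.pi : ℂ) ≠ 0 := by exact_mod_cast Real.pi_ne_zero
  push_cast
  field_simp

variable {f : Sp n → ℂ}

/-- A smooth function of compact support is a Schwartz function, hence so is its Fourier transform;
the oscillating factor has modulus 1. -/
theorem integrable_exp_mul_fourierT (hf : ContDiff ℝ ∞ f) (hc : HasCompactSupport f) (x : Sp n) :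
    Integrable fun η => Complex.exp (Complex.I * ((inner ℝ x η : ℝ) : ℂ)) * fourierT f η := by
  have h1 : Integrable (𝓕 f) := by
    have := (𝓕 (hc.toSchwartzMap hf)).integrable (μ := volume)
    rwa [SchwartzMap.fourier_coe] at this
  have h2 : Integrable (fourierT f) := by
    rw [funext (fourierT_eq f)]
    exact h1.comp_smul (by positivity)
  refine h2.bdd_mul (c := 1) (by fun_prop) (Eventually.of_forall fun η => ?_)
  rw [mul_comm, Complex.norm_exp_ofReal_mul_I]

theorem integral_exp_mul_fourierT (hf : ContDiff ℝ ∞ f) (hc : HasCompactSupport f) (x : Sp n) :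
    ∫ η, Complex.exp (Complex.I * ((inner ℝ x η : ℝ) : ℂ)) * fourierT f η =
      (((2 * Real.pi) ^ n : ℝ) : ℂ) * f x := by
  have h1 : Integrable (𝓕 f) := by
    have := (𝓕 (hc.toSchwartzMap hf)).integrable (μ := volume)
    rwa [SchwartzMap.fourier_coe] at this
  have h2 := congrFun (hf.continuous.fourierInv_fourier_eq
    (hf.continuous.integrable_of_hasCompactSupport hc) h1) x
  rw [Real.fourierInv_eq'] at h2
  -- The substitution w = η/(2π) has Jacobian (2π)^{-n}, the source of the factor (2π)^n.
  have h3 := Measure.integral_comp_smul (volume : Measure (Sp n))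
    (fun w => Complex.exp (((2 * Real.pi * inner ℝ w x : ℝ) : ℂ) * Complex.I) • 𝓕 f w)
    (2 * Real.pi)⁻¹
  rw [h2, finrank_euclideanSpace_fin, ← inv_pow, inv_inv, abs_of_pos (by positivity)] at h3
  rw [← Complex.real_smul, ← h3]
  refine integral_congr_ae (Eventually.of_forall fun η => ?_)
  simp only [smul_eq_mul, fourierT_eq]
  congr 2
  rw [real_inner_smul_left, real_inner_comm]
  have : (Real.pi : ℂ) ≠ 0 := by exact_mod_cast Real.pi_ne_zero
  push_cast
  field_simp

end Fourier

/-! ### The representation formula -/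

section Formula

variable {n : ℕ} {S : Set (Eps → ℝ)} {R : ℝ} {A : Fin n → Eps → ℝ × Sp n → ℝ}
  {A₀ : Eps → ℝ × Sp n → ℂ}

theorem fullPhase_phaseNet : fullPhase (phaseNet A) =
    fun ε p (y η : Sp n) => (inner ℝ (footPoint A ε p - y) η : ℝ) := by
  ext ε p y η
  exact (inner_sub_left _ _ _).symm

theorem CoeffNet.isPhaseRep (hS : IsScale S) (hSm : S ⊆ modScale) (hA : CoeffNet S R A)
    {φ : G (PhaseSp n)} (hφ : IsRep (fun ε p => (phaseNet A ε p : ℂ)) φ) :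
    IsPhaseRep (phaseNet A) φ :=
  ⟨hφ, fullPhase_phaseNet (A := A) ▸ (hA.sBound_footPoint hS).isModeratePhase_inner hS hSm⟩

/-- The phase is the pairing of η with the foot point and b does not depend on η. The integral is
thus Fourier inversion of U₀ at the foot point, times b. -/
theorem isFIO_mul_amplitude {φ : G (PhaseSp n)} (hφ : IsPhaseRep (phaseNet A) φ)
    {b : G (ℝ × Sp n)} (hb : IsRep (amplitude A A₀) b) {u₀ : G (Sp n)} {U₀ : Eps → Sp n → ℂ}
    (hU₀ : IsRep U₀ u₀) {K : Set (Sp n)} (hK : IsCompact K) (hUK : ∀ ε, ∀ x ∉ K, U₀ ε x = 0)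
    {u : G (ℝ × Sp n)}
    (hu : IsRep (fun ε z => U₀ ε (footPoint A ε z) * amplitude A A₀ ε z) u) :
    IsFIO φ b u₀ u := by
  have hc : ∀ ε, HasCompactSupport (U₀ ε) := fun ε => HasCompactSupport.intro hK (hUK ε)
  have he : ∀ ε p, fioIntegrand (phaseNet A ε) (amplitude A A₀ ε) (U₀ ε) p = fun η =>
      amplitude A A₀ ε p * (Complex.exp (Complex.I * ((inner ℝ (footPoint A ε p) η : ℝ) : ℂ)) *
        fourierT (U₀ ε) η) := fun ε p => by
    ext η
    simp only [fioIntegrand, phaseNet]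
    ring
  refine ⟨phaseNet A, amplitude A A₀, U₀, hφ, hb, hU₀, ⟨K, hK, hUK⟩, fun ε p => ?_, ?_⟩
  · rw [he]
    exact (integrable_exp_mul_fourierT (hU₀.contDiff ε) (hc ε) _).const_mul _
  · convert hu using 3 with ε p
    rw [he, integral_const_mul, integral_exp_mul_fourierT (hU₀.contDiff ε) (hc ε)]
    have : (((2 * Real.pi) ^ n : ℝ) : ℂ) ≠ 0 := by exact_mod_cast (by positivity)
    field_simp

/-- Existence, uniqueness and growth for an arbitrary scale S of moderate nets; the additional nets
in the conclusion carry the S-bounds from which slow scale regularity is read off. -/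
theorem exists_fioFormula (hS : IsScale S) (hSm : S ⊆ modScale) {a : Fin n → G (ℝ × Sp n)}
    {a₀ : G (ℝ × Sp n)} {u₀ : G (Sp n)} (hu₀ : CompactlySupported u₀)
    (hr : ∀ j, RealValued (a j)) (hs : ∀ j, CompactlySupportedInX (a j))
    (hb : ∀ j U, IsRep U (a j) → SBound S U)
    (hl : ∀ j k U, IsRep U (pd ((0 : ℝ), e k) (a j)) → LogBound S U)
    (hb₀ : ∀ U, IsRep U a₀ → SBound S U) (hl₀ : ∀ U, IsRep U a₀ → LogBound S U) :
    ∃ (γ : Fin n → G (FlowSp n)) (φ : G (PhaseSp n)) (b u : G (ℝ × Sp n))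
      (V : Eps → ℝ × Sp n → Sp n) (Φ : Eps → PhaseSp n → ℝ) (B : Eps → ℝ × Sp n → ℂ),
      FIOFormula a a₀ u₀ γ φ b u ∧ SBound S V ∧
      fullPhase Φ = (fun ε p (y η : Sp n) => (inner ℝ (V ε p - y) η : ℝ)) ∧ IsPhaseRep Φ φ ∧
      SBound S (fun ε p => (Φ ε p : ℂ)) ∧ IsRep B b ∧ SBound S B := by
  obtain ⟨R, A, hA, hAa⟩ := exists_coeffNet hS hr hs hb hl
  obtain ⟨A₀, hA₀⟩ := exists_isRep a₀
  obtain ⟨U₀, hU₀, K, hK, hUK⟩ := exists_isRep_eq_zero_outside hu₀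
  have hs₀ := hb₀ A₀ hA₀
  have hlog := hl₀ A₀ hA₀
  have hΓ : ∀ h : Fin n, SBound S fun ε p => ((flow (vecField A ε) p h : ℝ) : ℂ) := fun h =>
    (hA.sBound_flow hS).linear_comp hS
      (Complex.ofRealCLM.comp (EuclideanSpace.proj (𝕜 := ℝ) h))
  have hγ := fun h => isRep_mk ((hΓ h).mem_moderate hSm)
  have hBs := hA.sBound_amplitude hS hs₀ hlog
  have hB := isRep_mk (hBs.mem_moderate hSm)
  -- The datum u₀ is merely moderate, so the solution is estimated in the moderate scale whatever S
  -- is.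
  have hU₀V := ((sBound_of_mem_moderate hU₀.mem).comp isScale_modScale
    ((hA.sBound_footPoint hS).of_subset hSm) (hA.cBounded_footPoint hS)).mul isScale_modScale
    (hBs.of_subset hSm)
  have hu := isRep_mk (hU₀V.mem_moderate subset_rfl)
  have hφ := isRep_phase hγ
  have hΦ := hA.isPhaseRep hS hSm hφ
  refine ⟨_, _, _, _, footPoint A, phaseNet A, amplitude A A₀, ⟨?_, ?_, rfl, ⟨_, hΦ⟩, ?_, ?_, ?_,
    hA.isExpIntegral hS hSm hA₀ hs₀ hγ hB, ?_, ?_, isFIO_mul_amplitude hΦ hB hU₀ hK hUK hu⟩,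
    hA.sBound_footPoint hS, fullPhase_phaseNet, hΦ, hA.sBound_phaseNet hS, hB, hBs⟩
  · exact hA.isCharacteristic hS hAa hγ
  · exact fun γ' h => hA.characteristic_unique hS hSm hAa hγ h
  · exact hA.solvesEikonal hS hAa hφ
  · exact hA.solvesCauchy_amplitude hS hAa hA₀ hs₀ hB
  · exact fun b' h => hA.solvesCauchy_unique hS hSm hAa hA₀ hlog h
      (hA.solvesCauchy_amplitude hS hAa hA₀ hs₀ hB)
  · exact hA.solvesCauchy_mul_amplitude hS hAa hA₀ hs₀ hU₀ hu
      fun ε => (hBs.contDiff ε).differentiable (by simp)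
  · exact fun u' h => hA.solvesCauchy_unique hS hSm hAa hA₀ hlog h
      (hA.solvesCauchy_mul_amplitude hS hAa hA₀ hs₀ hU₀ hu
        fun ε => (hBs.contDiff ε).differentiable (by simp))

end Formula

end Colombeau

/-! ### The theorem, as the moderate and slow scale instances of one construction. -/

theorem mainTheorem3 (n : ℕ) (a : Fin n → Colombeau.G (ℝ × Colombeau.Sp n))
    (a₀ : Colombeau.G (ℝ × Colombeau.Sp n)) (u₀ : Colombeau.G (Colombeau.Sp n))
    (hu₀ : Colombeau.CompactlySupported u₀) :
    (Colombeau.HypH1 a → Colombeau.HypI1 a₀ →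
      ∃ γ φ b u, Colombeau.FIOFormula a a₀ u₀ γ φ b u) ∧
    (Colombeau.HypH2 a → Colombeau.HypI2 a₀ →
      ∃ γ φ b u, Colombeau.FIOFormula a a₀ u₀ γ φ b u ∧
        Colombeau.SlowScaleRegular φ ∧ Colombeau.IsSlowScaleGenPhase φ ∧
        Colombeau.SlowScaleRegular b) := by
  refine ⟨fun h hi => ?_, fun h hi => ?_⟩
  · obtain ⟨γ, φ, b, u, -, -, -, hF, -⟩ := Colombeau.exists_fioFormula Colombeau.isScale_modScale
      subset_rfl hu₀ h.realValued h.support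
      (fun _ _ hU => Colombeau.sBound_of_mem_moderate hU.mem)
      (fun j k _ hU => (h.logType j k).logBound hU)
      (fun _ hU => Colombeau.sBound_of_mem_moderate hU.mem) fun _ hU => hi.logType.logBound hU
    exact ⟨γ, φ, b, u, hF⟩
  · obtain ⟨γ, φ, b, u, V, Φ, B, hF, hV, hΦV, hΦ, hΦs, hB, hBs⟩ :=
      Colombeau.exists_fioFormula Colombeau.isScale_slowScale Colombeau.slowScale_subset_modScale
        hu₀ h.realValued h.support (fun j _ hU => (h.slowScale j).sBound hU)
        (fun j k _ hU => (h.logType j k).logBound hU) (fun _ hU => hi.slowScale.sBound hU)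
        fun _ hU => hi.logType.logBound hU
    exact ⟨γ, φ, b, u, hF, hΦs.slowScaleRegular hΦ.1,
      ⟨Φ, hΦ, hΦV ▸ hV.isSlowScalePhase_inner⟩, hBs.slowScaleRegular hB⟩
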